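/- **Notation.** For $\tau>0$ let $\psi=\Gamma'/\Gamma$, $$C(\tau)=\lim_{m\to\infty}\Big[\sum_{k=1}^{m-1}\psi(k\tau)+\tfrac12\psi(m\tau)-\tfrac1\tau\log\frac{\Gamma(m\tau)}{\sqrt{2\pi}}\Big],\qquad D(\tau)=\lim_{m\to\infty}\Big[\sum_{k=1}^{m-1}\psi'(k\tau)+\tfrac12\psi'(m\tau)-\tfrac1\tau\psi(m\tau)\Big],$$ $a(\tau)=\gamma\tau+\frac\tau2\log(2\pi\tau)+\frac12\log\tau-\tau C(\tau)$ and $b(\tau)=-\frac{\pi^2\tau^2}{6}-\tau\log\tau-\tau^2D(\tau)$ ($\gamma$ is Euler's constant), and let $$G(z;\tau)=\frac z\tau\exp\Big[a(\tau)\frac z\tau+b(\tau)\frac{z^2}{2\tau^2}\Big]\prod_{(k,l)\in\mathbb N^2\setminus\{(0,0)\}}\Big(1+\frac z{k\tau+l}\Big)\exp\Big(-\frac z{k\tau+l}+\frac{z^2}{2(k\tau+l)^2}\Big)$$ be the Barnes double gamma function. Let $0\le m\le q$, $0\le n\le p$, $\tau,\alpha_i,\beta_i>0$, $a_i,b_i,\varepsilon\in\mathbb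 C$ and $$\mathcal I(s)=\frac{\prod_{i=1}^mG(b_i+\beta_is;\tau)\prod_{i=1}^nG(1+\tau-a_i-\alpha_is;\tau)}{\prod_{i=m+1}^qG(1+\tau-b_i-\beta_is;\tau)\prod_{i=n+1}^pG(a_i+\alpha_is;\tau)},$$ $$\mathcal A=-\min_{n<i\le p}\frac{\operatorname{Re}a_i}{\alpha_i},\qquad \mathcal B=\min_{m<i\le q}\frac{1+\tau-\operatorname{Re}b_i}{\beta_i}$$ ($\mathcal A=-\infty$ if $n=p$, $\mathcal B=+\infty$ if $m=q$). The Fox-Barnes $I$-function, on the vertical line $\operatorname{Re}s=c$ with $\mathcal A<c<\mathcal B$, is $$I^{m,n}_{p,q}\Big[x;\tau,\varepsilon\,\Big|\,{(a_i,\alpha_i)_{1,p}\atop(b_i,\beta_i)_{1,q}}\Big]=\frac1{2\pi i}\int_{c-i\infty}^{c+i\infty}\mathcal I(s)\,e^{\pi\varepsilon s^2/\tau}x^{-s}\,ds ,$$ where $x$ is a point of the Riemann surface of the logarithm and $x^{-s}=e^{-s\log x}$, $\arg x=\operatorname{Im}\log x$. For numbers $u_i$ (attached to the lower row) and $v_i$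 (attached to the upper row) write $\langle u,v\rangle=\sum_{i\le m}u_i+\sum_{i\le n}v_i-\sum_{i>m}u_i-\sum_{i>n}v_i$, and put $\Delta_k=\langle\beta^k,\alpha^k\rangle$, $\Theta_k=\langle\beta^k\log\beta,\alpha^k\log\alpha\rangle$, $\Pi=\langle b\beta,a\alpha\rangle$, $\Lambda=\langle b\beta\log\beta,a\alpha\log\alpha\rangle$, $D_k=\langle b^k,a^k\rangle$, $\Omega_k=\sum_{i\le n}\alpha_i^k-\sum_{i>m}\beta_i^k$, $\Upsilon=\sum_{i>m}b_i\beta_i-\sum_{i\le n}a_i\alpha_i$, $\varkappa=\frac12(1+\frac1\tau)$, $\mathcal N=2(m+n)-(p+q)$, $\Phi_1=\frac{\operatorname{Re}\Pi+c\Delta_2}\tau-\varkappa\Delta_1$, $\Phi_3=\frac{\operatorname{Re}\Upsilon-c\,\Omega_2}\tau+\varkappa\,\Omega_1$, $\chi=\frac1{2\tau}\operatorname{Re}D_2-\varkappa\operatorname{Re}D_1+\big(\frac\tau{12}+\frac14+\frac1{12\tau}\big)\mathcal N$. A vertical line (VL) condition, for the argument $x$ and the line $\operatorname{Re}s=c$,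 is any of: 1. $\Delta_2>0$; 2. $\Delta_2=0$ and $\Theta_2+2\pi\operatorname{Re}\varepsilon>0$; 3. $\Delta_2=\Theta_2+2\pi\operatorname{Re}\varepsilon=\Omega_2=\operatorname{Im}\varepsilon=\operatorname{Im}\Pi=0$, $\Phi_1+2\Phi_3>0$ and $|\arg x-\tau^{-1}\operatorname{Im}\Lambda|<(\Phi_1+2\Phi_3)\pi/2$; 4. $\Delta_2=\Theta_2+2\pi\operatorname{Re}\varepsilon=\Omega_2=\operatorname{Im}\varepsilon=\operatorname{Im}\Pi=0$, $\Phi_1+2\Phi_3=0$, $\arg x=\tau^{-1}\operatorname{Im}\Lambda$ and $\chi+c\,\Phi_1<-1$. **Proposition.** Let $\nu>0$, let $\lambda$ be a point of the Riemann surface of the logarithm, and suppose that $\mathcal A<\mathcal B$, $\mathcal A<1/\nu$, $\mathcal A<c<\mathcal B$ and that $I^{m,n}_{p,q}[\lambda t^\nu;\tau,\varepsilon\,|\cdots]$ ($t>0$), taken on the line $\operatorname{Re}s=c$, satisfies a VL condition. In the case of condition 4 suppose moreover that the inequality $\chi+c_0\Phi_1<-1$ holds for some $c_0$ with $\mathcal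 A<c_0<\min(\mathcal B,1/\nu)$ (automatic if $\Phi_1\ge0$ or $c<1/\nu$). Then the defining integral converges absolutely for every $t>0$, and for every $z\in\mathbb C$ with $\operatorname{Re}z>0$ the Laplace transform $\int_0^\infty e^{-zt}I^{m,n}_{p,q}[\lambda t^\nu;\tau,\varepsilon\,|\cdots]\,dt$ exists (converges absolutely) and equals $$\frac{\tau^{1/2}}{(2\pi)^{(\tau-1)/2}}\frac1z\,I^{m,n+1}_{p+1,q+1}\Big[\frac{\lambda\tau^\nu}{z^\nu};\tau,\varepsilon\,\Big|\,{(0,\nu),(a_i,\alpha_i)_{1,p}\atop(b_i,\beta_i)_{1,q},(\tau,\nu)}\Big]$$ $$=\frac{\tau^{1/2}}{(2\pi)^{(\tau-1)/2}}\frac1z\,I^{n+1,m}_{q+1,p+1}\Big[\frac{z^\nu}{\lambda\tau^\nu};\tau,\varepsilon\,\Big|\,{(1+\tau-b_i,\beta_i)_{1,q},(1,\nu)\atop(1+\tau,\nu),(1+\tau-a_i,\alpha_i)_{1,p}}\Big],$$ with $\log z$ the principal logarithm and $\log(\lambda\tau^\nu/z^\nu)=\log\lambda+\nu\log\tau-\nu\log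 z$. For each of these two functions the corresponding quantities satisfy $\mathcal A'<\mathcal B'$, and for every line $\operatorname{Re}s=c'$ with $\mathcal A'<c'<\mathcal B'$ the function again satisfies a VL condition, its defining integral converges absolutely, and the equality holds. -/

import Mathlib

/-- Real digamma function `ψ = Γ' / Γ`. -/
noncomputable def barnesPsi (x : ℝ) : ℝ := logDeriv Real.Gamma x

/-- Barnes' first modular constant `C(τ)`. -/
noncomputable def barnesC (τ : ℝ) : ℝ :=
  Filter.limUnder Filter.atTop (fun m : ℕ =>
    ∑ k ∈ Finset.Ico 1 m, barnesPsi (k * τ) + (1 / 2) * barnesPsi (m * τ)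
      - (1 / τ) * Real.log (Real.Gamma (m * τ) / Real.sqrt (2 * Real.pi)))

/-- Barnes' second modular constant `D(τ)`. -/
noncomputable def barnesD (τ : ℝ) : ℝ :=
  Filter.limUnder Filter.atTop (fun m : ℕ =>
    ∑ k ∈ Finset.Ico 1 m, deriv barnesPsi (k * τ) + (1 / 2) * deriv barnesPsi (m * τ)
      - (1 / τ) * barnesPsi (m * τ))

/-- The constant `a(τ)`. -/
noncomputable def barnesa (τ : ℝ) : ℝ :=
  Real.eulerMascheroniConstant * τ + τ / 2 * Real.log (2 * Real.pi * τ)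
    + (1 / 2) * Real.log τ - τ * barnesC τ

/-- The constant `b(τ)`. -/
noncomputable def barnesb (τ : ℝ) : ℝ :=
  -(Real.pi ^ 2 * τ ^ 2 / 6) - τ * Real.log τ - τ ^ 2 * barnesD τ

/-- The double gamma function `G(z; τ)` of Barnes, as a Weierstrass product over
`(m, n) ∈ ℕ × ℕ`, `(m, n) ≠ (0, 0)`. -/
noncomputable def doubleGamma (τ : ℝ) (z : ℂ) : ℂ :=
  z / τ * Complex.exp ((barnesa τ : ℂ) * (z / τ) + (barnesb τ : ℂ) * (z ^ 2 / (2 * (τ : ℂ) ^ 2))) *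
    ∏' k : {k : ℕ × ℕ // k ≠ (0, 0)},
      ((1 + z / ((k.1.1 : ℂ) * τ + k.1.2)) *
        Complex.exp (-(z / ((k.1.1 : ℂ) * τ + k.1.2))
          + z ^ 2 / (2 * ((k.1.1 : ℂ) * τ + k.1.2) ^ 2)))

/-- Parameters of a Fox-Barnes function `I^{m,n}_{p,q}[ · ; τ, ε | (a_i, α_i)_{1,p} ; (b_i, β_i)_{1,q}]`.
Indices are shifted by one: `Fin p` is `{0, …, p-1}`, so the blocks `1 ≤ i ≤ n` and
`n + 1 ≤ i ≤ p` read `i < n` and `n ≤ i`. -/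
structure FoxBarnes (p q : ℕ) where
  m : ℕ
  n : ℕ
  hm : m ≤ q
  hn : n ≤ p
  τ : ℝ
  hτ : 0 < τ
  ε : ℂ
  a : Fin p → ℂ
  α : Fin p → ℝ
  hα : ∀ i, 0 < α i
  b : Fin q → ℂ
  β : Fin q → ℝ
  hβ : ∀ i, 0 < β i

namespace FoxBarnes

variable {p q : ℕ}

/-- The indices `1 ≤ i ≤ m` of the lower row. -/
def lowNum (P : FoxBarnes p q) : Finset (Fin q) := Finset.univ.filter (fun i => (i : ℕ) < P.m)

/-- The indices `m + 1 ≤ i ≤ q` of the lower row. -/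
def lowDen (P : FoxBarnes p q) : Finset (Fin q) := Finset.univ.filter (fun i => P.m ≤ (i : ℕ))

/-- The indices `1 ≤ i ≤ n` of the upper row. -/
def upNum (P : FoxBarnes p q) : Finset (Fin p) := Finset.univ.filter (fun i => (i : ℕ) < P.n)

/-- The indices `n + 1 ≤ i ≤ p` of the upper row. -/
def upDen (P : FoxBarnes p q) : Finset (Fin p) := Finset.univ.filter (fun i => P.n ≤ (i : ℕ))

/-- The quotient of double gamma functions `ℐ^{m,n}_{p,q}(s)`. -/
noncomputable def quot (P : FoxBarnes p q) (s : ℂ) : ℂ :=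
  ((∏ i ∈ P.lowNum, doubleGamma P.τ (P.b i + P.β i * s)) *
      (∏ i ∈ P.upNum, doubleGamma P.τ (1 + P.τ - P.a i - P.α i * s))) /
    ((∏ i ∈ P.lowDen, doubleGamma P.τ (1 + P.τ - P.b i - P.β i * s)) *
      (∏ i ∈ P.upDen, doubleGamma P.τ (P.a i + P.α i * s)))

/-- The full integrand `ℐ(s) e^{π ε s² / τ} x^{-s}`. The argument `x ≠ 0` is a point of the Riemann
surface of the logarithm and is given by `w = log x`, so that `x^{-s} = e^{-s w}`, `arg x = Im w`. -/
noncomputable def integrand (P : FoxBarnes p q) (w s : ℂ) : ℂ :=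
  P.quot s * Complex.exp (Real.pi * P.ε * s ^ 2 / P.τ) * Complex.exp (-(s * w))

/-- Absolute convergence of the defining integral along the vertical line `Re s = c`. -/
def Converges (P : FoxBarnes p q) (c : ℝ) (w : ℂ) : Prop :=
  MeasureTheory.Integrable (fun y : ℝ => P.integrand w ((c : ℂ) + y * Complex.I))

/-- The Fox-Barnes function at the point with logarithm `w`:
`(2πi)⁻¹ ∫ ℐ(s) e^{π ε s² / τ} e^{-s w} ds` along the upward vertical line `Re s = c`. -/
noncomputable def value (P : FoxBarnes p q) (c : ℝ) (w : ℂ) : ℂ :=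
  1 / (2 * Real.pi * Complex.I) *
    ∫ y : ℝ, P.integrand w ((c : ℂ) + y * Complex.I) * Complex.I

/-- `𝒜 = - min_{n+1 ≤ i ≤ p} Re a_i / α_i = max_{n+1 ≤ i ≤ p} (- Re a_i / α_i)`, equal to `-∞` if
`n = p`. -/
noncomputable def A (P : FoxBarnes p q) : EReal :=
  P.upDen.sup (fun i => ((-((P.a i).re / P.α i) : ℝ) : EReal))

/-- `ℬ = min_{m+1 ≤ i ≤ q} (1 + τ - Re b_i) / β_i`, equal to `+∞` if `m = q`. -/
noncomputable def B (P : FoxBarnes p q) : EReal :=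
  P.lowDen.inf (fun i => (((1 + P.τ - (P.b i).re) / P.β i : ℝ) : EReal))

/-- `ϰ = (1 + 1/τ) / 2`. -/
noncomputable def kap (P : FoxBarnes p q) : ℝ := (1 / 2) * (1 + 1 / P.τ)

/-- `𝒩 = 2(m + n) - (p + q)`. -/
def N (P : FoxBarnes p q) : ℝ := 2 * ((P.m : ℝ) + P.n) - ((p : ℝ) + q)

/-- `Δ_k`. -/
noncomputable def Delta (P : FoxBarnes p q) (k : ℕ) : ℝ :=
  ∑ i ∈ P.lowNum, P.β i ^ k + ∑ i ∈ P.upNum, P.α i ^ k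
    - ∑ i ∈ P.lowDen, P.β i ^ k - ∑ i ∈ P.upDen, P.α i ^ k

/-- `Θ_k`. -/
noncomputable def Theta (P : FoxBarnes p q) (k : ℕ) : ℝ :=
  ∑ i ∈ P.lowNum, P.β i ^ k * Real.log (P.β i) + ∑ i ∈ P.upNum, P.α i ^ k * Real.log (P.α i)
    - ∑ i ∈ P.lowDen, P.β i ^ k * Real.log (P.β i) - ∑ i ∈ P.upDen, P.α i ^ k * Real.log (P.α i)

/-- `Ω_k`. -/
noncomputable def Omega (P : FoxBarnes p q) (k : ℕ) : ℝ :=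
  ∑ i ∈ P.upNum, P.α i ^ k - ∑ i ∈ P.lowDen, P.β i ^ k

/-- `Π`. -/
noncomputable def PiSum (P : FoxBarnes p q) : ℂ :=
  ∑ i ∈ P.lowNum, P.b i * P.β i + ∑ i ∈ P.upNum, P.a i * P.α i
    - ∑ i ∈ P.lowDen, P.b i * P.β i - ∑ i ∈ P.upDen, P.a i * P.α i

/-- `Λ`. -/
noncomputable def Lambda (P : FoxBarnes p q) : ℂ :=
  ∑ i ∈ P.lowNum, P.b i * P.β i * (Real.log (P.β i) : ℂ)
    + ∑ i ∈ P.upNum, P.a i * P.α i * (Real.log (P.α i) : ℂ)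
    - ∑ i ∈ P.lowDen, P.b i * P.β i * (Real.log (P.β i) : ℂ)
    - ∑ i ∈ P.upDen, P.a i * P.α i * (Real.log (P.α i) : ℂ)

/-- `Υ`. -/
noncomputable def Upsilon (P : FoxBarnes p q) : ℂ :=
  ∑ i ∈ P.lowDen, P.b i * P.β i - ∑ i ∈ P.upNum, P.a i * P.α i

/-- `D_k`. -/
noncomputable def D (P : FoxBarnes p q) (k : ℕ) : ℂ :=
  ∑ i ∈ P.lowNum, P.b i ^ k + ∑ i ∈ P.upNum, P.a i ^ k
    - ∑ i ∈ P.lowDen, P.b i ^ k - ∑ i ∈ P.upDen, P.a i ^ k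

/-- `Φ₁`. -/
noncomputable def Phi1 (P : FoxBarnes p q) (c : ℝ) : ℝ :=
  (P.PiSum.re + c * P.Delta 2) / P.τ - P.kap * P.Delta 1

/-- `Φ₃`. -/
noncomputable def Phi3 (P : FoxBarnes p q) (c : ℝ) : ℝ :=
  (P.Upsilon.re - c * P.Omega 2) / P.τ + P.kap * P.Omega 1

/-- `χ`. -/
noncomputable def chi (P : FoxBarnes p q) : ℝ :=
  1 / (2 * P.τ) * (P.D 2).re - P.kap * (P.D 1).re
    + (P.τ / 12 + 1 / 4 + 1 / (12 * P.τ)) * P.N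

/-- The parameter equations shared by the vertical-line conditions 3 and 4. -/
def VLBalanced (P : FoxBarnes p q) : Prop :=
  P.Delta 2 = 0 ∧ P.Theta 2 + 2 * Real.pi * P.ε.re = 0 ∧ P.Omega 2 = 0 ∧ P.ε.im = 0 ∧ P.PiSum.im = 0

/-- Vertical-line condition 1. -/
def VL1 (P : FoxBarnes p q) : Prop := 0 < P.Delta 2

/-- Vertical-line condition 2. -/
def VL2 (P : FoxBarnes p q) : Prop := P.Delta 2 = 0 ∧ 0 < P.Theta 2 + 2 * Real.pi * P.ε.re

/-- Vertical-line condition 3, for an argument of the function with `arg = θ`. -/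
def VL3 (P : FoxBarnes p q) (c θ : ℝ) : Prop :=
  P.VLBalanced ∧ 0 < P.Phi1 c + 2 * P.Phi3 c ∧
    |θ - P.Lambda.im / P.τ| < (P.Phi1 c + 2 * P.Phi3 c) * Real.pi / 2

/-- Vertical-line condition 4, for an argument of the function with `arg = θ`. -/
def VL4 (P : FoxBarnes p q) (c θ : ℝ) : Prop :=
  P.VLBalanced ∧ P.Phi1 c + 2 * P.Phi3 c = 0 ∧ θ = P.Lambda.im / P.τ ∧ P.chi + c * P.Phi1 c < -1

/-- A vertical-line condition (for the line `Re s = c` and an argument with `arg = θ`). -/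
def VL (P : FoxBarnes p q) (c θ : ℝ) : Prop :=
  P.VL1 ∨ P.VL2 ∨ P.VL3 c θ ∨ P.VL4 c θ

/-- The parameters of
`I^{m,n+1}_{p+1,q+1}[ · ; τ, ε | (0, ν), (a_i, α_i)_{1,p} ; (b_i, β_i)_{1,q}, (τ, ν)]`. -/
noncomputable def laplaceParams (P : FoxBarnes p q) (ν : ℝ) (hν : 0 < ν) :
    FoxBarnes (p + 1) (q + 1) where
  m := P.m
  n := P.n + 1
  hm := Nat.le_succ_of_le P.hm
  hn := Nat.succ_le_succ P.hn
  τ := P.τ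
  hτ := P.hτ
  ε := P.ε
  a := Fin.cons (α := fun _ => ℂ) 0 P.a
  α := Fin.cons (α := fun _ => ℝ) ν P.α
  hα := Fin.cases (by simpa using hν) (fun i => by simpa using P.hα i)
  b := Fin.snoc (α := fun _ => ℂ) P.b (P.τ : ℂ)
  β := Fin.snoc (α := fun _ => ℝ) P.β ν
  hβ := Fin.lastCases (by simpa using hν) (fun i => by simpa using P.hβ i)

/-- The parameters of `I^{n+1,m}_{q+1,p+1}[ · ; τ, ε | (1 + τ - b_i, β_i)_{1,q}, (1, ν) ;
(1 + τ, ν), (1 + τ - a_i, α_i)_{1,p}]`. -/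
noncomputable def laplaceParamsInv (P : FoxBarnes p q) (ν : ℝ) (hν : 0 < ν) :
    FoxBarnes (q + 1) (p + 1) where
  m := P.n + 1
  n := P.m
  hm := Nat.succ_le_succ P.hn
  hn := Nat.le_succ_of_le P.hm
  τ := P.τ
  hτ := P.hτ
  ε := P.ε
  a := Fin.snoc (α := fun _ => ℂ) (fun i => 1 + (P.τ : ℂ) - P.b i) 1
  α := Fin.snoc (α := fun _ => ℝ) P.β ν
  hα := Fin.lastCases (by simpa using hν) (fun i => by simpa using P.hβ i)
  b := Fin.cons (α := fun _ => ℂ) (1 + (P.τ : ℂ)) (fun i => 1 + (P.τ : ℂ) - P.a i)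
  β := Fin.cons (α := fun _ => ℝ) ν P.α
  hβ := Fin.cases (by simpa using hν) (fun i => by simpa using P.hα i)

end FoxBarnes

/-- Existence (absolute convergence) of the Laplace transform of `f` at `z`. -/
def LaplaceExists (f : ℝ → ℂ) (z : ℂ) : Prop :=
  MeasureTheory.IntegrableOn (fun t : ℝ => Complex.exp (-(z * t)) * f t) (Set.Ioi 0)

/-- The Laplace transform `∫₀^∞ e^{-z t} f(t) dt`. -/
noncomputable def laplaceTransform (f : ℝ → ℂ) (z : ℂ) : ℂ :=
  ∫ t in Set.Ioi (0 : ℝ), Complex.exp (-(z * t)) * f t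

/-!
The Laplace transform of `I[λ t^ν]` is computed under the integral sign: for a line `Re s = c₀` with
`ν c₀ < 1`, integrating `e^{-z t} t^{-ν s}` over `t` gives `z^{ν s - 1} Γ(1 - ν s)`, and the
functional equation `doubleGamma_add`,
`G(u + τ) = (2π)^{(τ - 1) / 2} τ^{1 / 2 - u} Γ(u) G(u)`, with `u = 1 - ν s`, rewrites
`Γ(1 - ν s)` as the two double gamma factors that distinguish the new parameters from the old ones
(`FoxBarnes.integrand_laplaceParams`, `FoxBarnes.laplaceTransform_value`). The second form of the
result is the substitution `s ↦ -s`. What remains is analytic: the integrals must converge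
absolutely, and must not depend on the line.

Both follow from the growth of `|G|` on vertical strips. Summing the Weierstrass product over the rows
of the lattice turns `G` into a product of the functions `1 / Γ(z + k τ)`, `k ≥ 0`, with
exponential factors whose limits are governed by `C(τ)` and `D(τ)`
(`tendsto_doubleGammaPartial`); the shift `z ↦ z + τ` telescopes in this product, which is the
functional equation. The function `barnesApprox` solves `K(z + τ) - K(z) = log Γ(z)` up to an error
`O(z⁻²)`, by Stirling's formula. Summing this over `z + k τ` shows that `log |G(z)| - Re K(z)` is,
up to a bounded error, the real part of a quadratic polynomial in `z` with real coefficients, whose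
values need not be known: the coefficient of `z²` enters the growth of the integrand only through
multiples of `Δ₂` and `Im Π`, and the other two terms are bounded on strips
(`exists_abs_log_norm_doubleGamma_sub_barnesApprox_le`).

Adding the contributions of all factors gives the logarithm of the modulus of the Fox-Barnes integrand
at `x + i y`, up to a bounded error, as a combination of `y² log |y|`, `y²`, `y log |y|`, `y`, `|y|`
and `log |y|` (`FoxBarnes.integrandLeading`). Under each vertical-line condition a dominant term of
this list is negative, and in the fourth only `log |y|` is left, with a coefficient below `-1`; so
the integrand is `O(|y|^{-1-δ})` uniformly on the strip between two admissible lines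
(`FoxBarnes.exists_norm_integrand_le`). This gives absolute convergence, and by Cauchy's theorem
independence of the line (`FoxBarnes.value_eq_value`). Passing
to the parameters of the Laplace transform changes `Φ₁ + 2 Φ₃` to `Φ₁ + 2 Φ₃ + ν` and the argument
`θ` to `θ - ν arg z` with `|arg z| < π / 2`, so the conditions persist and the fourth one becomes the
third (`FoxBarnes.VL1_or_VL2_or_VL3_laplaceParams`).
-/

open Filter Topology Asymptotics MeasureTheory

/-! ### The digamma function and the constants `C(τ)` and `D(τ)` -/

theorem hasDerivAt_log_Gamma_barnesPsi {x : ℝ} (hx : 0 < x) :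
    HasDerivAt (fun y => Real.log (Real.Gamma y)) (barnesPsi x) x := by
  have hd : DifferentiableAt ℝ Real.Gamma x :=
    Real.differentiableAt_Gamma fun m h => by
      have : (0 : ℝ) ≤ m := m.cast_nonneg
      linarith
  simpa [barnesPsi, logDeriv_apply] using hd.hasDerivAt.log (Real.Gamma_pos_of_pos hx).ne'

theorem log_Gamma_add_one {x : ℝ} (hx : 0 < x) :
    Real.log (Real.Gamma (x + 1)) = Real.log x + Real.log (Real.Gamma x) := by
  rw [Real.Gamma_add_one hx.ne', Real.log_mul hx.ne' (Real.Gamma_pos_of_pos hx).ne']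

theorem barnesPsi_add_one {x : ℝ} (hx : 0 < x) : barnesPsi (x + 1) = barnesPsi x + 1 / x := by
  have h1 : HasDerivAt (fun y => Real.log (Real.Gamma (y + 1))) (barnesPsi (x + 1)) x := by
    have := (hasDerivAt_log_Gamma_barnesPsi (x := x + 1) (by linarith)).comp_add_const x 1
    simpa using this
  have h2 : HasDerivAt (fun y => Real.log y + Real.log (Real.Gamma y)) (x⁻¹ + barnesPsi x) x :=
    (Real.hasDerivAt_log hx.ne').add (hasDerivAt_log_Gamma_barnesPsi hx)
  have h3 := h2.congr_of_eventuallyEq (f₁ := fun y => Real.log (Real.Gamma (y + 1))) (by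
    filter_upwards [lt_mem_nhds hx] with y hy using log_Gamma_add_one hy)
  rw [h1.unique h3]; ring

/-- Log-convexity of `Γ` puts the tangent slope at `x` below the chord slope over `[x, x + 1]`. -/
theorem barnesPsi_le_log {x : ℝ} (hx : 0 < x) : barnesPsi x ≤ Real.log x := by
  have := Real.convexOn_log_Gamma.deriv_le_slope (x := x) (y := x + 1) hx
    (show (0:ℝ) < x + 1 by linarith) (by linarith) (hasDerivAt_log_Gamma_barnesPsi hx).differentiableAt
  rw [slope_def_field] at this
  simp only [Function.comp] at this
  rw [log_Gamma_add_one hx] at this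
  have h2 : deriv (Real.log ∘ Real.Gamma) x = barnesPsi x := (hasDerivAt_log_Gamma_barnesPsi hx).deriv
  rw [h2] at this
  simpa using this

theorem log_le_barnesPsi_add_one {x : ℝ} (hx : 0 < x) : Real.log x ≤ barnesPsi (x + 1) := by
  have h := hasDerivAt_log_Gamma_barnesPsi (x := x + 1) (by linarith)
  have := Real.convexOn_log_Gamma.slope_le_deriv (x := x) (y := x + 1) hx
    (show (0:ℝ) < x + 1 by linarith) (by linarith) h.differentiableAt
  rw [slope_def_field] at this
  simp only [Function.comp] at this
  rw [log_Gamma_add_one hx] at this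
  have h2 : deriv (Real.log ∘ Real.Gamma) (x + 1) = barnesPsi (x + 1) := h.deriv
  rw [h2] at this
  simpa using this

theorem log_sub_inv_le_barnesPsi {x : ℝ} (hx : 0 < x) : Real.log x - 1 / x ≤ barnesPsi x := by
  linarith [log_le_barnesPsi_add_one hx, barnesPsi_add_one hx]

theorem barnesPsi_add_nat {x : ℝ} (hx : 0 < x) (n : ℕ) :
    barnesPsi (x + n) = barnesPsi x + ∑ l ∈ Finset.range n, 1 / (x + l) := by
  induction n with
  | zero => simp
  | succ n ih =>
    rw [Finset.sum_range_succ, ← add_assoc, ← ih, Nat.cast_succ, ← add_assoc,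
      barnesPsi_add_one (by positivity)]

theorem tendsto_barnesPsi_sub_log : Tendsto (fun x => barnesPsi x - Real.log x) atTop (𝓝 0) := by
  have h : Tendsto (fun x : ℝ => -(1 / x)) atTop (𝓝 0) := by
    simpa using (tendsto_inv_atTop_zero (𝕜 := ℝ)).neg
  refine tendsto_of_tendsto_of_tendsto_of_le_of_le' h tendsto_const_nhds ?_ ?_
  · filter_upwards [eventually_gt_atTop 0] with x hx
    linarith [log_sub_inv_le_barnesPsi hx]
  · filter_upwards [eventually_gt_atTop 0] with x hx
    linarith [barnesPsi_le_log hx]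

theorem tendsto_log_add_nat_sub_log (x : ℝ) :
    Tendsto (fun n : ℕ => Real.log (x + n) - Real.log n) atTop (𝓝 0) := by
  have h : Tendsto (fun n : ℕ => 1 + x / n) atTop (𝓝 1) := by
    simpa using (tendsto_const_div_atTop_nhds_zero_nat x).const_add 1
  have h2 := (Real.continuousAt_log one_ne_zero).tendsto.comp h
  rw [Real.log_one] at h2
  refine h2.congr' ?_
  have h3 : ∀ᶠ n : ℕ in atTop, 0 < x + n :=
    (tendsto_atTop_add_const_left _ x tendsto_natCast_atTop_atTop).eventually_gt_atTop 0
  filter_upwards [eventually_gt_atTop 0, h3] with n hn hxn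
  have : (n : ℝ) ≠ 0 := by positivity
  rw [← Real.log_div hxn.ne' this]
  simp only [Function.comp]
  congr 1
  field_simp
  ring

/-- Gauss' limit for the digamma function. -/
theorem tendsto_log_sub_sum_barnesPsi {x : ℝ} (hx : 0 < x) :
    Tendsto (fun n : ℕ => Real.log n - ∑ l ∈ Finset.range (n + 1), 1 / (x + l)) atTop
      (𝓝 (barnesPsi x)) := by
  have h1 : Tendsto (fun n : ℕ => barnesPsi (x + n) - Real.log (x + n)) atTop (𝓝 0) :=
    tendsto_barnesPsi_sub_log.comp (tendsto_atTop_add_const_left _ x tendsto_natCast_atTop_atTop)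
  have h2 : Tendsto (fun n : ℕ => 1 / (x + n)) atTop (𝓝 0) := by
    simp only [one_div]
    exact (tendsto_atTop_add_const_left _ x
      (tendsto_natCast_atTop_atTop (R := ℝ))).inv_tendsto_atTop
  have h3 := ((h1.add (tendsto_log_add_nat_sub_log x)).add h2).const_sub (barnesPsi x)
  simp only [add_zero, sub_zero] at h3
  refine h3.congr fun n => ?_
  rw [barnesPsi_add_nat hx, Finset.sum_range_succ]
  ring

theorem summable_inv_add_sq {x : ℝ} (hx : 0 < x) : Summable fun l : ℕ => 1 / (x + l) ^ 2 := by
  have := (Real.summable_one_div_nat_add_rpow x 2).2 (by norm_num)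
  refine this.congr fun l => ?_
  rw [abs_of_pos (by positivity), add_comm]
  norm_num

theorem hasSum_barnesPsi_sub {x : ℝ} (hx : 0 < x) :
    HasSum (fun l : ℕ => 1 / (1 + (l : ℝ)) - 1 / (x + l)) (barnesPsi x - barnesPsi 1) := by
  have hs : Summable (fun l : ℕ => 1 / (1 + (l : ℝ)) - 1 / (x + l)) := by
    have h1 := (summable_inv_add_sq (x := min 1 x) (by positivity)).mul_left |x - 1|
    refine Summable.of_norm_bounded h1 fun l => ?_
    have hm : 0 < min 1 x := by positivity
    have a1 : min 1 x + (l : ℝ) ≤ 1 + l := by gcongr; exact min_le_left _ _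
    have a2 : min 1 x + (l : ℝ) ≤ x + l := by gcongr; exact min_le_right _ _
    have e : 1 / (1 + (l : ℝ)) - 1 / (x + l) = (x - 1) * (1 / ((1 + l) * (x + l))) := by
      field_simp; ring
    rw [e, norm_mul, Real.norm_eq_abs, Real.norm_of_nonneg (by positivity), sq]
    gcongr
  have h := (tendsto_log_sub_sum_barnesPsi hx).sub (tendsto_log_sub_sum_barnesPsi one_pos)
  have h' := hs.hasSum.tendsto_sum_nat.comp (tendsto_add_atTop_nat 1)
  have : ∑' l : ℕ, (1 / (1 + (l : ℝ)) - 1 / (x + l)) = barnesPsi x - barnesPsi 1 := by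
    refine tendsto_nhds_unique h' (h.congr fun n => ?_)
    simp only [Function.comp, Finset.sum_sub_distrib]
    ring
  exact this ▸ hs.hasSum

theorem hasDerivAt_barnesPsi {x : ℝ} (hx : 0 < x) :
    HasDerivAt barnesPsi (∑' l : ℕ, 1 / (x + l) ^ 2) x := by
  have hx2 : 0 < x / 2 := by positivity
  have key := hasDerivAt_tsum_of_isPreconnected (𝕜 := ℝ) (F := ℝ)
    (g := fun (l : ℕ) (y : ℝ) => 1 / (1 + (l : ℝ)) - 1 / (y + l))
    (g' := fun (l : ℕ) (y : ℝ) => 1 / (y + l) ^ 2) (t := Set.Ioi (x / 2)) (y₀ := x) (y := x)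
    (summable_inv_add_sq hx2) isOpen_Ioi isPreconnected_Ioi
    (fun l y hy => by
      have hy' : y + l ≠ 0 := by have : 0 < y := hx2.trans hy; positivity
      have h1 := ((hasDerivAt_id y).add_const (l : ℝ)).inv hy'
      have h2 := h1.const_sub (1 / (1 + (l : ℝ)))
      refine (h2.congr_deriv ?_).congr_of_eventuallyEq (Eventually.of_forall fun w => ?_)
      · simp; field_simp
      · simp)
    (fun l y hy => by
      have : x / 2 < y := hy
      rw [Real.norm_of_nonneg (by positivity)]
      gcongr)
    (show x / 2 < x by linarith) (hasSum_barnesPsi_sub hx).summable (show x / 2 < x by linarith)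
  have h2 := key.const_add (barnesPsi 1)
  refine h2.congr_of_eventuallyEq ?_
  filter_upwards [lt_mem_nhds hx] with y hy
  rw [(hasSum_barnesPsi_sub hy).tsum_eq]; ring

theorem deriv_barnesPsi {x : ℝ} (hx : 0 < x) :
    deriv barnesPsi x = ∑' l : ℕ, 1 / (x + l) ^ 2 := (hasDerivAt_barnesPsi hx).deriv

theorem deriv_barnesPsi_nonneg {x : ℝ} (hx : 0 < x) : 0 ≤ deriv barnesPsi x := by
  rw [deriv_barnesPsi hx]; exact tsum_nonneg fun l => by positivity

theorem deriv_barnesPsi_antitone {x y : ℝ} (hx : 0 < x) (hxy : x ≤ y) :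
    deriv barnesPsi y ≤ deriv barnesPsi x := by
  have hy := hx.trans_le hxy
  rw [deriv_barnesPsi hx, deriv_barnesPsi hy]
  exact (summable_inv_add_sq hy).tsum_le_tsum (fun l => by gcongr) (summable_inv_add_sq hx)

theorem tsum_inv_add_sq_le {x : ℝ} (hx : 0 < x) :
    ∑' l : ℕ, 1 / (x + l) ^ 2 ≤ 1 / x ^ 2 + 1 / x := by
  refine (summable_inv_add_sq hx).tsum_le_of_sum_range_le fun n => ?_
  have key : ∀ n : ℕ, ∑ l ∈ Finset.range (n + 1), 1 / (x + l) ^ 2 ≤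
      1 / x ^ 2 + 1 / x - 1 / (x + n) := by
    intro n
    induction n with
    | zero => simp
    | succ n ih =>
      rw [Finset.sum_range_succ]
      have h0 : 0 < x + n := by positivity
      have h1 : 1 / (x + (n + 1 : ℕ)) ^ 2 ≤ 1 / (x + n) - 1 / (x + (n + 1 : ℕ)) := by
        push_cast
        have : 1 / (x + n) - 1 / (x + (n + 1)) = 1 / ((x + n) * (x + (n + 1))) := by
          field_simp; ring
        rw [this, sq]
        gcongr
        linarith
      linarith
  have h1 : ∑ l ∈ Finset.range n, 1 / (x + l) ^ 2 ≤ ∑ l ∈ Finset.range (n + 1), 1 / (x + l) ^ 2 :=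
    Finset.sum_le_sum_of_subset_of_nonneg (by simp) fun l _ _ => by positivity
  have h2 : 0 < 1 / (x + n) := by positivity
  linarith [key n]

theorem tendsto_deriv_barnesPsi_mul {τ : ℝ} (hτ : 0 < τ) :
    Tendsto (fun m : ℕ => deriv barnesPsi (m * τ)) atTop (𝓝 0) := by
  have h0 : Tendsto (fun m : ℕ => (m : ℝ) * τ) atTop atTop :=
    tendsto_natCast_atTop_atTop.atTop_mul_const hτ
  have h1 : Tendsto (fun x : ℝ => 1 / x ^ 2 + 1 / x) atTop (𝓝 0) := by
    have := (tendsto_pow_neg_atTop (𝕜 := ℝ) (n := 2) two_ne_zero).add tendsto_inv_atTop_zero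
    simpa using this
  refine tendsto_of_tendsto_of_tendsto_of_le_of_le' tendsto_const_nhds (h1.comp h0) ?_ ?_
  · filter_upwards [eventually_gt_atTop 0] with m hm
    exact deriv_barnesPsi_nonneg (by positivity)
  · filter_upwards [eventually_gt_atTop 0] with m hm
    have : 0 < (m : ℝ) * τ := by positivity
    rw [deriv_barnesPsi this]
    exact tsum_inv_add_sq_le this

/-- Error of the trapezoidal rule for a function with antitone derivative. The bound telescopes
over consecutive intervals. -/
theorem abs_trapezoid_sub_le {F f g : ℝ → ℝ} {x h : ℝ} (hh : 0 < h)
    (hF : ∀ t ∈ Set.Icc x (x + h), HasDerivAt F (f t) t)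
    (hf : ∀ t ∈ Set.Icc x (x + h), HasDerivAt f (g t) t)
    (hg : AntitoneOn g (Set.Icc x (x + h))) :
    |h / 2 * (f x + f (x + h)) - (F (x + h) - F x)| ≤ h ^ 2 * (g x - g (x + h)) := by
  have hx0 : x ∈ Set.Icc x (x + h) := ⟨le_rfl, by linarith⟩
  have hmem : ∀ t ∈ Set.Icc 0 h, x + t ∈ Set.Icc x (x + h) := fun t ht =>
    ⟨by linarith [ht.1], by linarith [ht.2]⟩
  set φ : ℝ → ℝ := fun t => t / 2 * (f x + f (x + t)) - (F (x + t) - F x) with hφ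
  have hd : ∀ t ∈ Set.Icc 0 h, HasDerivAt φ ((t * g (x + t) - (f (x + t) - f x)) / 2) t := by
    intro t ht
    have h1 := (hF _ (hmem t ht)).comp_const_add x t
    have h2 := (hf _ (hmem t ht)).comp_const_add x t
    have h3 := (((hasDerivAt_id t).div_const 2).mul (h2.const_add (f x))).sub (h1.sub_const (F x))
    refine h3.congr_deriv ?_
    simp; ring_nf
  have hb : ∀ t ∈ Set.Icc 0 h, ‖(t * g (x + t) - (f (x + t) - f x)) / 2‖ ≤
      h * (g x - g (x + h)) := by
    intro t ht
    have hgx : g (x + h) ≤ g x := hg hx0 (hmem h ⟨hh.le, le_rfl⟩) (by linarith)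
    rcases eq_or_lt_of_le ht.1 with rfl | ht0
    · simp; nlinarith
    obtain ⟨ξ, hξ, he⟩ := exists_hasDerivAt_eq_slope f g (a := x) (b := x + t) (by linarith)
      (fun s hs => (hf s ⟨hs.1, by linarith [hs.2, ht.2]⟩).continuousAt.continuousWithinAt)
      (fun s hs => hf s ⟨hs.1.le, by linarith [hs.2, ht.2]⟩)
    have hξm : ξ ∈ Set.Icc x (x + h) := ⟨hξ.1.le, by linarith [hξ.2, ht.2]⟩
    have e1 : f (x + t) - f x = t * g ξ := by
      rw [he, add_sub_cancel_left]; field_simp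
    have g1 : g ξ ≤ g x := hg hx0 hξm hξ.1.le
    have g2 : g (x + t) ≤ g ξ := hg hξm (hmem t ht) hξ.2.le
    have g3 : g (x + h) ≤ g (x + t) := hg (hmem t ht) (hmem h ⟨hh.le, le_rfl⟩) (by linarith [ht.2])
    rw [e1, ← mul_sub, Real.norm_eq_abs, abs_le]
    have ht2 := ht.2
    constructor <;> nlinarith
  have := (convex_Icc (0:ℝ) h).norm_image_sub_le_of_norm_hasDerivWithin_le
    (fun t ht => (hd t ht).hasDerivWithinAt) hb ⟨le_rfl, hh.le⟩ ⟨hh.le, le_rfl⟩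
  simp only [hφ, add_zero, zero_div, zero_mul, sub_self, sub_zero, Real.norm_eq_abs,
    abs_of_pos hh] at this
  calc _ ≤ _ := this
    _ = _ := by ring

theorem exists_tendsto_of_norm_succ_sub_le {u v : ℕ → ℝ} (N : ℕ) (hv : Summable v)
    (h : ∀ m ≥ N, |u (m + 1) - u m| ≤ v m) : ∃ L, Tendsto u atTop (𝓝 L) := by
  have hs : Summable fun m => u (m + N + 1) - u (m + N) :=
    ((summable_nat_add_iff N).2 hv).of_norm_bounded fun m => h (m + N) (by omega)
  refine ⟨_, (tendsto_add_atTop_iff_nat N).1 ((hs.hasSum.tendsto_sum_nat.add_const (u N)).congr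
    fun m => ?_)⟩
  have := Finset.sum_range_sub (fun m => u (m + N)) m
  simp only [zero_add] at this
  have e : ∀ i, u (i + N + 1) - u (i + N) = u (i + 1 + N) - u (i + N) := fun i => by
    rw [show i + N + 1 = i + 1 + N by ring]
  simp only [e, this]; ring

/-- The limit defining `C(τ)` exists: consecutive terms differ by an error of the trapezoidal rule for
`∫ ψ = log Γ`. -/
theorem tendsto_barnesC {τ : ℝ} (hτ : 0 < τ) :
    Tendsto (fun m : ℕ => ∑ k ∈ Finset.Ico 1 m, barnesPsi (k * τ) + (1 / 2) * barnesPsi (m * τ)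
      - (1 / τ) * Real.log (Real.Gamma (m * τ) / Real.sqrt (2 * Real.pi))) atTop
      (𝓝 (barnesC τ)) := by
  refine tendsto_nhds_limUnder ?_
  have hv : Summable fun m : ℕ => τ * (deriv barnesPsi (m * τ) - deriv barnesPsi ((m + 1 : ℕ) * τ)) := by
    refine Summable.mul_left _ ((summable_nat_add_iff 1).1 ?_)
    refine summable_of_sum_range_le (c := deriv barnesPsi τ) (fun m => ?_) fun n => ?_
    · refine sub_nonneg.2 (deriv_barnesPsi_antitone (by positivity) ?_)
      gcongr; simp
    · rw [Finset.sum_range_sub' (fun m : ℕ => deriv barnesPsi ((m + 1 : ℕ) * τ)) n]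
      have := deriv_barnesPsi_nonneg (x := (n + 1 : ℕ) * τ) (by positivity)
      simp only [zero_add, Nat.cast_one, one_mul]
      linarith
  refine exists_tendsto_of_norm_succ_sub_le 1 hv fun m hm => ?_
  have hm0 : 0 < (m : ℝ) * τ := by positivity
  have e1 : ((m + 1 : ℕ) : ℝ) * τ = m * τ + τ := by push_cast; ring
  have key := abs_trapezoid_sub_le (F := fun y => Real.log (Real.Gamma y)) (f := barnesPsi)
    (g := deriv barnesPsi) (x := m * τ) hτ
    (fun t ht => hasDerivAt_log_Gamma_barnesPsi (hm0.trans_le ht.1))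
    (fun t ht => (hasDerivAt_barnesPsi (hm0.trans_le ht.1)).differentiableAt.hasDerivAt)
    (fun s hs t _ hst => deriv_barnesPsi_antitone (hm0.trans_le hs.1) hst)
  have hsq : Real.sqrt (2 * Real.pi) ≠ 0 := by positivity
  rw [Finset.sum_Ico_succ_top hm, e1, Real.log_div (Real.Gamma_pos_of_pos hm0).ne' hsq,
    Real.log_div (Real.Gamma_pos_of_pos (by positivity)).ne' hsq]
  calc _ = |τ / 2 * (barnesPsi (m * τ) + barnesPsi (m * τ + τ)) -
        (Real.log (Real.Gamma (m * τ + τ)) - Real.log (Real.Gamma (m * τ)))| / τ := by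
        rw [← abs_of_pos hτ, ← abs_div, abs_of_pos hτ]
        congr 1
        field_simp
        ring_nf
    _ ≤ τ ^ 2 * (deriv barnesPsi (m * τ) - deriv barnesPsi (m * τ + τ)) / τ := by gcongr
    _ = _ := by field_simp

/-- The limit defining `D(τ)` exists: by the series for `ψ` and `ψ'`, consecutive terms differ by
`O(m⁻²)`. -/
theorem tendsto_barnesD {τ : ℝ} (hτ : 0 < τ) :
    Tendsto (fun m : ℕ => ∑ k ∈ Finset.Ico 1 m, deriv barnesPsi (k * τ)
      + (1 / 2) * deriv barnesPsi (m * τ) - (1 / τ) * barnesPsi (m * τ)) atTop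
      (𝓝 (barnesD τ)) := by
  refine tendsto_nhds_limUnder ?_
  have hv : Summable fun m : ℕ => (1 / 2 : ℝ) * ((1 / τ ^ 2 + 1 / τ) * (1 / (m : ℝ) ^ 2)) :=
    ((Real.summable_one_div_nat_pow.2 one_lt_two).mul_left _).mul_left _
  refine exists_tendsto_of_norm_succ_sub_le 1 hv fun m hm => ?_
  have hm1 : (1 : ℝ) ≤ m := by exact_mod_cast hm
  have hm0 : 0 < (m : ℝ) * τ := by positivity
  have hm2 : 0 < (m : ℝ) * τ + τ := by positivity
  have e1 : ((m + 1 : ℕ) : ℝ) * τ = m * τ + τ := by push_cast; ring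
  rw [Finset.sum_Ico_succ_top hm, e1, deriv_barnesPsi hm0, deriv_barnesPsi hm2]
  -- the summand is a perfect square: `½ (u⁻² + v⁻²) - u⁻¹ v⁻¹ = ½ (u⁻¹ - v⁻¹)²`, `v = u + τ`
  have hs := (((summable_inv_add_sq hm0).hasSum.add (summable_inv_add_sq hm2).hasSum).mul_left
    (1 / 2)).sub (((hasSum_barnesPsi_sub hm2).sub (hasSum_barnesPsi_sub hm0)).mul_left (1 / τ))
  have e2 : ∀ l : ℕ, 1 / 2 * (1 / ((m : ℝ) * τ + l) ^ 2 + 1 / ((m : ℝ) * τ + τ + l) ^ 2) -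
      1 / τ * (1 / (1 + (l : ℝ)) - 1 / ((m : ℝ) * τ + τ + l)
        - (1 / (1 + (l : ℝ)) - 1 / ((m : ℝ) * τ + l))) =
      1 / 2 * (1 / ((m : ℝ) * τ + l) - 1 / ((m : ℝ) * τ + τ + l)) ^ 2 := by
    intro l
    have a1 : (m : ℝ) * τ + l ≠ 0 := by positivity
    have a2 : (m : ℝ) * τ + τ + l ≠ 0 := by positivity
    have a3 : 1 + (l : ℝ) ≠ 0 := by positivity
    field_simp
    ring
  have hs2 := hs.congr_fun fun l => (e2 l).symm
  have hle : ∀ l : ℕ, 1 / 2 * (1 / ((m : ℝ) * τ + l) - 1 / ((m : ℝ) * τ + τ + l)) ^ 2 ≤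
      1 / 2 * (1 / (m : ℝ) ^ 2) * (1 / ((m : ℝ) * τ + τ + l) ^ 2) := by
    intro l
    have a1 : 0 < (m : ℝ) * τ + l := by positivity
    have a2 : 0 < (m : ℝ) * τ + τ + l := by positivity
    have a4 : 1 / ((m : ℝ) * τ + l) - 1 / ((m : ℝ) * τ + τ + l) =
        τ / ((m : ℝ) * τ + l) * (1 / ((m : ℝ) * τ + τ + l)) := by
      field_simp; ring
    have a5 : τ / ((m : ℝ) * τ + l) ≤ 1 / m := by
      rw [div_le_div_iff₀ a1 (by positivity)]
      have : (0 : ℝ) ≤ l := l.cast_nonneg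
      linarith
    rw [a4, mul_assoc, mul_pow, ← one_div_pow, ← one_div_pow]
    gcongr
  have hub := hasSum_le hle hs2 ((summable_inv_add_sq hm2).hasSum.mul_left _)
  have hlb := hs2.nonneg fun l => by positivity
  have h3 : ∑' l : ℕ, 1 / ((m : ℝ) * τ + τ + l) ^ 2 ≤ 1 / τ ^ 2 + 1 / τ := by
    refine (tsum_inv_add_sq_le hm2).trans ?_
    gcongr <;> linarith
  rw [abs_of_nonneg (by linarith)]
  calc _ ≤ _ := by linarith
    _ ≤ 1 / 2 * (1 / (m : ℝ) ^ 2) * (1 / τ ^ 2 + 1 / τ) := mul_le_mul_of_nonneg_left h3 (by positivity)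
    _ = _ := by ring

/-! ### The Weierstrass product of the double gamma function -/

theorem summable_one_div_one_add_add_cube :
    Summable fun p : ℕ × ℕ => 1 / (1 + (p.1 : ℝ) + p.2) ^ 3 := by
  have h1 : Summable fun n : ℕ => 1 / (1 + (n : ℝ)) ^ (3 / 2 : ℝ) := by
    refine ((Real.summable_one_div_nat_add_rpow 1 (3 / 2)).2 (by norm_num)).congr fun l => ?_
    rw [abs_of_pos (by positivity), add_comm]
  have h2 := h1.mul_of_nonneg h1 (fun n => by positivity) (fun n => by positivity)
  refine Summable.of_nonneg_of_le (fun p => by positivity) (fun p => ?_) h2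
  rw [div_mul_div_comm, one_mul, ← Real.mul_rpow (by positivity) (by positivity)]
  have h3 : (1 + (p.1 : ℝ) + p.2) ^ 3 = ((1 + (p.1 : ℝ) + p.2) ^ 2) ^ (3 / 2 : ℝ) := by
    rw [← Real.rpow_natCast, ← Real.rpow_natCast, ← Real.rpow_mul (by positivity)]
    norm_num
  rw [h3]
  gcongr
  have a1 : (0 : ℝ) ≤ p.1 := Nat.cast_nonneg _
  have a2 : (0 : ℝ) ≤ p.2 := Nat.cast_nonneg _
  nlinarith [mul_nonneg a1 a2]

theorem norm_log_one_add_sub_le {u : ℂ} (hu : ‖u‖ ≤ 1 / 2) :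
    ‖Complex.log (1 + u) - u + u ^ 2 / 2‖ ≤ ‖u‖ ^ 3 := by
  have h := Complex.norm_log_sub_logTaylor_le 2 (z := u) (by linarith)
  have e : Complex.logTaylor 3 u = u - u ^ 2 / 2 := by
    simp [Complex.logTaylor, Finset.sum_range_succ]; ring
  rw [show (2 : ℕ) + 1 = 3 from rfl, e] at h
  have h0 : 0 ≤ ‖u‖ ^ 3 := by positivity
  have h2 : (1 - ‖u‖)⁻¹ ≤ 2 := by
    rw [inv_le_comm₀ (by linarith) two_pos]; linarith
  calc _ = ‖Complex.log (1 + u) - (u - u ^ 2 / 2)‖ := by congr 1; ring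
    _ ≤ _ := h
    _ ≤ ‖u‖ ^ 3 * 2 / (2 + 1) := by push_cast; gcongr
    _ ≤ _ := by linarith

theorem one_add_ne_zero_of_norm_le_half {u : ℂ} (hu : ‖u‖ ≤ 1 / 2) : 1 + u ≠ 0 := fun h => by
  have : u = -1 := by linear_combination h
  rw [this] at hu; norm_num at hu

theorem norm_canonicalFactor_sub_one_le {u : ℂ} (hu : ‖u‖ ≤ 1 / 2) :
    ‖(1 + u) * Complex.exp (-u + u ^ 2 / 2) - 1‖ ≤ 2 * ‖u‖ ^ 3 := by
  have h := norm_log_one_add_sub_le hu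
  have h3 : ‖u‖ ^ 3 ≤ 1 := pow_le_one₀ (norm_nonneg _) (by linarith)
  rw [← Complex.exp_log (one_add_ne_zero_of_norm_le_half hu), ← Complex.exp_add, ← add_assoc,
    ← sub_eq_add_neg]
  exact (Complex.norm_exp_sub_one_le (h.trans h3)).trans (by linarith)

/-- The canonical factor of `doubleGamma` at the lattice point `k τ + l`. At `(0, 0)` the division
by zero makes it equal to `1`, so that products may run over all of `ℕ × ℕ`. -/
noncomputable def doubleGammaFactor (τ : ℝ) (z : ℂ) (p : ℕ × ℕ) : ℂ :=
  (1 + z / ((p.1 : ℂ) * τ + p.2)) *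
    Complex.exp (-(z / ((p.1 : ℂ) * τ + p.2)) + z ^ 2 / (2 * ((p.1 : ℂ) * τ + p.2) ^ 2))

theorem doubleGammaFactor_zero (τ : ℝ) (z : ℂ) : doubleGammaFactor τ z (0, 0) = 1 := by
  simp [doubleGammaFactor]

theorem tprod_subtype_doubleGammaFactor (τ : ℝ) (z : ℂ) :
    ∏' k : {k : ℕ × ℕ // k ≠ (0, 0)}, doubleGammaFactor τ z k = ∏' p, doubleGammaFactor τ z p := by
  refine tprod_subtype_eq_of_mulSupport_subset (s := {k : ℕ × ℕ | k ≠ (0, 0)}) fun p hp => ?_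
  rintro rfl
  exact hp (doubleGammaFactor_zero τ z)

theorem doubleGamma_eq (τ : ℝ) (z : ℂ) :
    doubleGamma τ z = z / τ *
      Complex.exp ((barnesa τ : ℂ) * (z / τ) + (barnesb τ : ℂ) * (z ^ 2 / (2 * (τ : ℂ) ^ 2))) *
        ∏' p, doubleGammaFactor τ z p := by
  rw [← tprod_subtype_doubleGammaFactor]; rfl

theorem norm_lattice_ge {τ : ℝ} (hτ : 0 < τ) {p : ℕ × ℕ} (hp : p ≠ (0, 0)) :
    min τ 1 / 2 * (1 + p.1 + p.2) ≤ ‖(p.1 : ℂ) * τ + p.2‖ := by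
  have e : (p.1 : ℂ) * τ + p.2 = ((p.1 * τ + p.2 : ℝ) : ℂ) := by push_cast; rfl
  rw [e, Complex.norm_real, Real.norm_of_nonneg (by positivity)]
  have h1 : min τ 1 ≤ τ := min_le_left _ _
  have h2 : min τ 1 ≤ 1 := min_le_right _ _
  have h0 : 0 < min τ 1 := by positivity
  have h3 : (1 : ℝ) ≤ p.1 + p.2 := by
    have : 1 ≤ p.1 + p.2 := by
      by_contra h
      exact hp (Prod.ext (by simp; omega) (by simp; omega))
    exact_mod_cast this
  have a1 : (0 : ℝ) ≤ p.1 := Nat.cast_nonneg _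
  have a2 : (0 : ℝ) ≤ p.2 := Nat.cast_nonneg _
  nlinarith [mul_nonneg a1 (sub_nonneg.2 h1), mul_nonneg a2 (sub_nonneg.2 h2)]

theorem exists_norm_doubleGammaFactor_sub_one_le {τ : ℝ} (hτ : 0 < τ) (R : ℝ) :
    ∃ u : ℕ × ℕ → ℝ, Summable u ∧ ∀ᶠ p in cofinite, ∀ z : ℂ, ‖z‖ ≤ R →
      ‖doubleGammaFactor τ z p - 1‖ ≤ u p := by
  set c := min τ 1 / 2 with hc
  have hc0 : 0 < c := by positivity
  refine ⟨fun p => 2 * (R / c) ^ 3 * (1 / (1 + (p.1 : ℝ) + p.2) ^ 3),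
    summable_one_div_one_add_add_cube.mul_left _, ?_⟩
  have ht : ∀ᶠ p : ℕ × ℕ in cofinite, 1 / (1 + (p.1 : ℝ) + p.2) ^ 3 < (c / (2 * (|R| + 1))) ^ 3 :=
    summable_one_div_one_add_add_cube.tendsto_cofinite_zero.eventually_lt_const (by positivity)
  filter_upwards [ht, (Set.finite_singleton ((0, 0) : ℕ × ℕ)).compl_mem_cofinite] with p hp hp0 z hz
  have hw := norm_lattice_ge hτ (p := p) (by simpa using hp0)
  set w : ℂ := (p.1 : ℂ) * τ + p.2 with hwd
  set N : ℝ := 1 + (p.1 : ℝ) + p.2 with hN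
  have hN0 : 0 < N := by positivity
  have hw0 : 0 < ‖w‖ := lt_of_lt_of_le (by positivity) hw
  have hu : ‖z / w‖ ≤ R / c * (1 / N) := by
    rw [norm_div]
    calc ‖z‖ / ‖w‖ ≤ R / (c * N) := by gcongr; exact (norm_nonneg z).trans hz
      _ = _ := by field_simp
  have hN2 : 1 / N < c / (2 * (|R| + 1)) := by
    rw [← one_div_pow] at hp
    exact lt_of_pow_lt_pow_left₀ 3 (by positivity) hp
  have hu2 : ‖z / w‖ ≤ 1 / 2 := by
    refine hu.trans ?_
    have hR : 0 ≤ R := (norm_nonneg z).trans hz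
    calc R / c * (1 / N) ≤ R / c * (c / (2 * (|R| + 1))) := by gcongr
      _ = R / (2 * (|R| + 1)) := by field_simp
      _ ≤ 1 / 2 := by
        rw [abs_of_nonneg hR, div_le_div_iff₀ (by positivity) (by positivity)]; linarith
  have e : doubleGammaFactor τ z p = (1 + z / w) * Complex.exp (-(z / w) + (z / w) ^ 2 / 2) := by
    rw [doubleGammaFactor, ← hwd]; congr 3; rw [div_pow]; field_simp
  rw [e]
  refine (norm_canonicalFactor_sub_one_le hu2).trans ?_
  calc 2 * ‖z / w‖ ^ 3 ≤ 2 * (R / c * (1 / N)) ^ 3 := by gcongr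
    _ = _ := by rw [mul_pow, one_div_pow]; ring

theorem summable_norm_doubleGammaFactor_sub_one {τ : ℝ} (hτ : 0 < τ) (z : ℂ) :
    Summable fun p => ‖doubleGammaFactor τ z p - 1‖ := by
  obtain ⟨u, hu, h⟩ := exists_norm_doubleGammaFactor_sub_one_le hτ ‖z‖
  exact hu.of_norm_bounded_eventually (h.mono fun p hp => by simpa using hp z le_rfl)

theorem multipliable_doubleGammaFactor {τ : ℝ} (hτ : 0 < τ) (z : ℂ) :
    Multipliable (doubleGammaFactor τ z) := by
  simpa using multipliable_one_add_of_summable (summable_norm_doubleGammaFactor_sub_one hτ z)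

theorem differentiable_doubleGamma {τ : ℝ} (hτ : 0 < τ) : Differentiable ℂ (doubleGamma τ) := by
  have hfac : ∀ p, Differentiable ℂ fun z => doubleGammaFactor τ z p := fun p => by
    unfold doubleGammaFactor; fun_prop
  have hprod : Differentiable ℂ fun z => ∏' p, doubleGammaFactor τ z p := by
    intro z
    obtain ⟨u, hu, h⟩ := exists_norm_doubleGammaFactor_sub_one_le hτ (‖z‖ + 1)
    have hl := hu.hasProdLocallyUniformlyOn_one_add (K := Metric.ball z 1)
      (f := fun p z => doubleGammaFactor τ z p - 1) Metric.isOpen_ball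
      (h.mono fun p hp w hw => hp w (by
        have := norm_sub_norm_le w z
        have h2 : ‖w - z‖ < 1 := by simpa [dist_eq_norm] using hw
        linarith))
      (fun p => ((hfac p).continuous.sub continuous_const).continuousOn)
    simp only [add_sub_cancel] at hl
    exact (hl.differentiableOn (Eventually.of_forall fun s => by
      exact DifferentiableOn.fun_finsetProd fun p _ => (hfac p).differentiableOn)
      Metric.isOpen_ball).differentiableAt (Metric.isOpen_ball.mem_nhds (by simp))
  have : doubleGamma τ = _ := funext (doubleGamma_eq τ)
  rw [this]
  exact (by fun_prop : Differentiable ℂ fun z : ℂ => z / τ *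
      Complex.exp ((barnesa τ : ℂ) * (z / τ) + (barnesb τ : ℂ) * (z ^ 2 / (2 * (τ : ℂ) ^ 2)))).mul hprod

theorem doubleGamma_ne_zero {τ : ℝ} (hτ : 0 < τ) {z : ℂ} (hz : ∀ k l : ℕ, z + (k * τ + l) ≠ 0) :
    doubleGamma τ z ≠ 0 := by
  have hz0 : z ≠ 0 := by simpa using hz 0 0
  have hτ' : (τ : ℂ) ≠ 0 := by exact_mod_cast hτ.ne'
  rw [doubleGamma_eq]
  refine mul_ne_zero (mul_ne_zero (div_ne_zero hz0 hτ') (Complex.exp_ne_zero _)) ?_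
  have := tprod_one_add_ne_zero_of_summable (f := fun p => doubleGammaFactor τ z p - 1) (fun p => ?_)
    (summable_norm_doubleGammaFactor_sub_one hτ z)
  · simpa using this
  · simp only [add_sub_cancel]
    refine mul_ne_zero ?_ (Complex.exp_ne_zero _)
    by_cases hp : (p.1 : ℂ) * τ + p.2 = 0
    · simp [hp]
    · intro h
      apply hz p.1 p.2
      field_simp at h
      linear_combination h

theorem ne_zero_of_re_pos {τ : ℝ} (hτ : 0 < τ) {z : ℂ} (hz : 0 < z.re) (k l : ℕ) :
    z + (k * τ + l) ≠ 0 := fun h => by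
  have := congrArg Complex.re h
  simp at this
  have h1 : 0 ≤ (k : ℝ) * τ + l := by positivity
  linarith

theorem ne_zero_of_im_ne_zero (τ : ℝ) {z : ℂ} (hz : z.im ≠ 0) (k l : ℕ) :
    z + (k * τ + l) ≠ 0 := fun h => by
  have := congrArg Complex.im h
  simp at this
  exact hz this

/-! ### Summation of the product over rows -/

theorem prod_one_add_div_eq_GammaSeq {w : ℝ} (hw : 0 < w) (z : ℂ) {n : ℕ} (hn : n ≠ 0) :
    ∏ l ∈ Finset.range (n + 1), (1 + z / ((w : ℂ) + l)) =
      Complex.exp (z * Real.log n) * (Complex.GammaSeq w n / Complex.GammaSeq (w + z) n) := by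
  have hn0 : (n : ℂ) ≠ 0 := by exact_mod_cast hn
  have hwl : ∀ l : ℕ, (w : ℂ) + l ≠ 0 := fun l => by
    have : (w + l : ℝ) ≠ 0 := by positivity
    exact_mod_cast this
  have e1 : ∀ l : ℕ, 1 + z / ((w : ℂ) + l) = (w + z + l) / (w + l) := fun l => by
    have := hwl l
    field_simp; ring
  have hP : ∏ l ∈ Finset.range (n + 1), ((w : ℂ) + l) ≠ 0 :=
    Finset.prod_ne_zero_iff.2 fun l _ => hwl l
  simp only [e1, Finset.prod_div_distrib, Complex.GammaSeq]
  have hf : (n.factorial : ℂ) ≠ 0 := by exact_mod_cast n.factorial_ne_zero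
  have hp : (n : ℂ) ^ (w : ℂ) ≠ 0 := by simp [hn0]
  rw [Complex.cpow_add _ _ hn0, Complex.natCast_log, mul_comm z,
    ← Complex.cpow_def_of_ne_zero hn0]
  have hz : (n : ℂ) ^ z ≠ 0 := by simp [hn0]
  rw [div_div_div_eq]
  field_simp

/-- The part of the product of `doubleGamma` over one row of the lattice is a quotient of
Gamma functions. -/
noncomputable def gammaRow (w : ℝ) (z : ℂ) : ℂ :=
  Real.Gamma w / Complex.Gamma (w + z) *
    Complex.exp (z * barnesPsi w + z ^ 2 / 2 * (deriv barnesPsi w : ℝ))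

theorem tendsto_prod_gammaRow {w : ℝ} (hw : 0 < w) {z : ℂ} (hz : ∀ l : ℕ, (w : ℂ) + z + l ≠ 0) :
    Tendsto (fun n : ℕ => ∏ l ∈ Finset.range n, ((1 + z / ((w : ℂ) + l)) *
      Complex.exp (-(z / ((w : ℂ) + l)) + z ^ 2 / (2 * ((w : ℂ) + l) ^ 2)))) atTop
      (𝓝 (gammaRow w z)) := by
  rw [← tendsto_add_atTop_iff_nat 1]
  have hG : Complex.Gamma (w + z) ≠ 0 := Complex.Gamma_ne_zero fun m h => hz m (by rw [h]; ring)
  have h1 := (Complex.GammaSeq_tendsto_Gamma w).div (Complex.GammaSeq_tendsto_Gamma (w + z)) hG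
  have h2 := (Complex.continuous_ofReal.tendsto _).comp (tendsto_log_sub_sum_barnesPsi hw)
  have h3 := (Complex.continuous_ofReal.tendsto _).comp
    (((summable_inv_add_sq hw).hasSum.tendsto_sum_nat).comp (tendsto_add_atTop_nat 1))
  rw [← deriv_barnesPsi hw] at h3
  have h4 := (Complex.continuous_exp.tendsto _).comp ((h2.const_mul z).add (h3.const_mul (z ^ 2 / 2)))
  have h5 := h1.mul h4
  rw [gammaRow, ← Complex.Gamma_ofReal]
  refine h5.congr' ?_
  filter_upwards [eventually_ne_atTop 0] with n hn
  rw [Finset.prod_mul_distrib, prod_one_add_div_eq_GammaSeq hw z hn, ← Complex.exp_sum]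
  simp only [Function.comp, Pi.div_apply]
  rw [mul_comm (Complex.exp _) (_ / _), mul_assoc, ← Complex.exp_add]
  congr 2
  rw [Finset.sum_add_distrib, Finset.sum_neg_distrib]
  push_cast
  rw [mul_sub, Finset.mul_sum, Finset.mul_sum]
  have e1 : ∀ l ∈ Finset.range (n + 1), z * (1 / ((w : ℂ) + l)) = z / ((w : ℂ) + l) :=
    fun l _ => by ring
  have e2 : ∀ l ∈ Finset.range (n + 1), z ^ 2 / 2 * (1 / ((w : ℂ) + l) ^ 2) =
      z ^ 2 / (2 * ((w : ℂ) + l) ^ 2) := fun l _ => by rw [mul_one_div, div_div]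
  rw [Finset.sum_congr rfl e1, Finset.sum_congr rfl e2]
  ring

theorem hasProd_gammaRow {τ : ℝ} (hτ : 0 < τ) {z : ℂ} (hz : ∀ k l : ℕ, z + (k * τ + l) ≠ 0)
    {k : ℕ} (hk : 1 ≤ k) :
    HasProd (fun l => doubleGammaFactor τ z (k, l)) (gammaRow (k * τ) z) := by
  have hm : Multipliable fun l => doubleGammaFactor τ z (k, l) := by
    have := multipliable_one_add_of_summable
      ((summable_norm_doubleGammaFactor_sub_one hτ z).comp_injective
        (Prod.mk_right_injective k))
    simpa [Function.comp_def] using this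
  have hw : 0 < (k : ℝ) * τ := by positivity
  have h1 := tendsto_prod_gammaRow hw (z := z) fun l => by
    have := hz k l
    intro h; apply this; push_cast at h; linear_combination h
  have h2 := tendsto_nhds_unique (hm.hasProd.tendsto_prod_nat) (h1.congr fun n => by
    simp only [doubleGammaFactor]; push_cast; rfl)
  exact h2 ▸ hm.hasProd

theorem barnesPsi_one : barnesPsi 1 = -Real.eulerMascheroniConstant := by
  rw [barnesPsi, logDeriv_apply, Real.Gamma_one, div_one, Real.eulerMascheroniConstant_eq_neg_deriv,
    neg_neg]

theorem deriv_barnesPsi_one : deriv barnesPsi 1 = Real.pi ^ 2 / 6 := by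
  rw [deriv_barnesPsi one_pos, ← hasSum_zeta_two.tsum_eq, hasSum_zeta_two.summable.tsum_eq_zero_add]
  simp [add_comm]

theorem hasProd_gammaRow_zero {τ : ℝ} (hτ : 0 < τ) {z : ℂ} (hz : ∀ k l : ℕ, z + (k * τ + l) ≠ 0) :
    HasProd (fun l => doubleGammaFactor τ z (0, l)) (gammaRow 1 z) := by
  have hm : Multipliable fun l => doubleGammaFactor τ z (0, l) := by
    have := multipliable_one_add_of_summable
      ((summable_norm_doubleGammaFactor_sub_one hτ z).comp_injective
        (Prod.mk_right_injective 0))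
    simpa [Function.comp_def] using this
  have h1 := tendsto_prod_gammaRow one_pos (z := z) fun l => by
    have := hz 0 (l + 1)
    intro h; apply this; push_cast at h ⊢; linear_combination h
  have h2 := tendsto_nhds_unique (hm.hasProd.tendsto_prod_nat.comp (tendsto_add_atTop_nat 1))
    (h1.congr fun n => by
      simp only [Function.comp, Finset.prod_range_succ', doubleGammaFactor_zero, mul_one]
      refine Finset.prod_congr rfl fun l _ => ?_
      simp only [doubleGammaFactor]; push_cast; simp [add_comm])
  exact h2 ▸ hm.hasProd

/-- Partial products of Barnes' representation of `G(z; τ)` as a single product of Gamma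
functions. -/
noncomputable def doubleGammaPartial (τ : ℝ) (M : ℕ) (z : ℂ) : ℂ :=
  1 / (τ * Complex.Gamma z) *
    Complex.exp (z * (Real.log (2 * Real.pi * τ) / 2 + Real.log τ / (2 * τ) - barnesC τ : ℝ)
      - z ^ 2 / 2 * (Real.log τ / τ + barnesD τ : ℝ)) *
    ∏ k ∈ Finset.Ico 1 M, gammaRow (k * τ) z

/-- Barnes' product representation: the rows `k ≥ 1` of the lattice contribute `gammaRow (k τ) z`, and
the row `k = 0` contributes `gammaRow 1 z`, where the first point is missing. -/
theorem tendsto_doubleGammaPartial {τ : ℝ} (hτ : 0 < τ) {z : ℂ}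
    (hz : ∀ k l : ℕ, z + (k * τ + l) ≠ 0) :
    Tendsto (fun M => doubleGammaPartial τ M z) atTop (𝓝 (doubleGamma τ z)) := by
  have hz0 : z ≠ 0 := by simpa using hz 0 0
  have hτ' : (τ : ℂ) ≠ 0 := by exact_mod_cast hτ.ne'
  have h1 := (multipliable_doubleGammaFactor hτ z).hasProd.prod_fiberwise
    (g := fun k : ℕ => if k = 0 then gammaRow 1 z else gammaRow (k * τ) z) (fun k => by
      rcases Nat.eq_zero_or_pos k with rfl | hk
      · simpa using hasProd_gammaRow_zero hτ hz
      · simpa [hk.ne'] using hasProd_gammaRow hτ hz hk)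
  have h2 := h1.tendsto_prod_nat.const_mul (z / τ *
      Complex.exp ((barnesa τ : ℂ) * (z / τ) + (barnesb τ : ℂ) * (z ^ 2 / (2 * (τ : ℂ) ^ 2))))
  rw [← doubleGamma_eq] at h2
  refine h2.congr' ?_
  filter_upwards [eventually_ge_atTop 1] with M hM
  rw [Finset.range_eq_Ico, Finset.prod_eq_prod_Ico_succ_bot (by omega), if_pos rfl, zero_add,
    doubleGammaPartial, ← mul_assoc]
  congr 1
  · have hG : Complex.Gamma z ≠ 0 := Complex.Gamma_ne_zero fun m h => by
      have := hz 0 m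
      apply this; rw [h]; simp
    rw [gammaRow, barnesPsi_one, deriv_barnesPsi_one, Real.Gamma_one, Complex.ofReal_one,
      add_comm 1 z, Complex.Gamma_add_one _ hz0]
    rw [show ∀ a b c d : ℂ, a * b * (1 / c * d) = a / c * (b * d) by intros; ring,
      ← Complex.exp_add]
    congr 1
    · field_simp
    · congr 1
      rw [barnesa, barnesb]
      push_cast
      field_simp
      ring
  · refine Finset.prod_congr rfl fun k hk => ?_
    rw [if_neg (by have := Finset.mem_Ico.1 hk; omega)]

/-! ### The functional equation in the direction `τ` -/

/-- The tails `∑ₗ ‖z / (w + l)‖³` of the canonical factors vanish as `w → ∞`. -/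
theorem tendsto_gammaRow_one {τ : ℝ} (hτ : 0 < τ) {z : ℂ} (hz : 0 < z.re) :
    Tendsto (fun m : ℕ => gammaRow (m * τ) z) atTop (𝓝 1) := by
  have h0 : Tendsto (fun m : ℕ => (m : ℝ) * τ) atTop atTop :=
    tendsto_natCast_atTop_atTop.atTop_mul_const hτ
  have hev : ∀ᶠ m : ℕ in atTop, 2 * ‖z‖ + 1 ≤ (m : ℝ) * τ := h0.eventually_ge_atTop _
  have hbound : ∀ᶠ m : ℕ in atTop, ‖gammaRow (m * τ) z - 1‖ ≤
      Real.exp (2 * ‖z‖ ^ 3 * deriv barnesPsi (m * τ)) - 1 := by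
    filter_upwards [hev] with m hm
    have hz0 := norm_nonneg z
    set w : ℝ := m * τ with hw
    have hw0 : 0 < w := by linarith
    have hlim := tendsto_prod_gammaRow hw0 (z := z) fun l h => by
      have := congrArg Complex.re h
      simp at this
      have : (0 : ℝ) ≤ l := l.cast_nonneg
      linarith
    refine le_of_tendsto ((hlim.sub_const 1).norm) (Eventually.of_forall fun n => ?_)
    set u : ℕ → ℂ := fun l => z / ((w : ℂ) + l) with hu
    have hu2 : ∀ l, ‖u l‖ = ‖z‖ / (w + l) := fun l => by
      rw [hu, norm_div]
      congr 1
      rw [show (w : ℂ) + l = ((w + l : ℝ) : ℂ) by push_cast; rfl, Complex.norm_real,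
        Real.norm_of_nonneg (by positivity)]
    have hu3 : ∀ l, ‖u l‖ ≤ 1 / 2 := fun l => by
      rw [hu2, div_le_div_iff₀ (by positivity) two_pos]
      have : (0 : ℝ) ≤ l := l.cast_nonneg
      linarith
    have e : ∀ l : ℕ, (1 + z / ((w : ℂ) + l)) *
        Complex.exp (-(z / ((w : ℂ) + l)) + z ^ 2 / (2 * ((w : ℂ) + l) ^ 2)) =
        1 + ((1 + u l) * Complex.exp (-u l + u l ^ 2 / 2) - 1) := fun l => by
      rw [add_sub_cancel, hu]; congr 3; rw [div_pow, div_div, mul_comm (2 : ℂ)]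
    simp only [e]
    refine (Finset.norm_prod_one_add_sub_one_le _ _).trans ?_
    gcongr
    calc _ ≤ ∑ l ∈ Finset.range n, 2 * ‖z‖ ^ 3 * (1 / (w + l) ^ 2) := by
          refine Finset.sum_le_sum fun l _ => ?_
          refine (norm_canonicalFactor_sub_one_le (hu3 l)).trans ?_
          rw [hu2, div_pow, mul_one_div, mul_div_assoc]
          have : (0 : ℝ) ≤ l := l.cast_nonneg
          have h1 : 1 ≤ w + l := by linarith
          gcongr
          norm_num
      _ = 2 * ‖z‖ ^ 3 * ∑ l ∈ Finset.range n, 1 / (w + l) ^ 2 := by rw [Finset.mul_sum]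
      _ ≤ _ := by
          rw [deriv_barnesPsi hw0]
          gcongr
          exact (summable_inv_add_sq hw0).sum_le_tsum _ fun l _ => by positivity
  have hlim : Tendsto (fun m : ℕ => Real.exp (2 * ‖z‖ ^ 3 * deriv barnesPsi (m * τ)) - 1) atTop
      (𝓝 0) := by
    have := ((Real.continuous_exp.tendsto _).comp
      ((tendsto_deriv_barnesPsi_mul hτ).const_mul (2 * ‖z‖ ^ 3))).sub_const 1
    simpa using this
  have := squeeze_zero_norm' hbound hlim
  simpa using this.add_const 1

theorem Gamma_add_nat_mul_ne_zero {τ : ℝ} {z : ℂ} (hz : ∀ k l : ℕ, z + (k * τ + l) ≠ 0) (k : ℕ) :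
    Complex.Gamma (z + k * τ) ≠ 0 :=
  Complex.Gamma_ne_zero fun m h => hz k m (by linear_combination h)

theorem prod_gammaRow {τ : ℝ} {z : ℂ} (M : ℕ) :
    ∏ k ∈ Finset.Ico 1 M, gammaRow (k * τ) z =
      (∏ k ∈ Finset.Ico 1 M, (Real.Gamma (k * τ) : ℂ)) / (∏ k ∈ Finset.Ico 1 M, Complex.Gamma (z + k * τ)) *
      Complex.exp (z * (∑ k ∈ Finset.Ico 1 M, barnesPsi (k * τ) : ℝ) +
        z ^ 2 / 2 * (∑ k ∈ Finset.Ico 1 M, deriv barnesPsi (k * τ) : ℝ)) := by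
  simp only [gammaRow, Finset.prod_mul_distrib, Finset.prod_div_distrib, ← Complex.exp_sum]
  have e : ∀ k ∈ Finset.Ico 1 M, Complex.Gamma (((k * τ : ℝ) : ℂ) + z) =
      Complex.Gamma (z + k * τ) := fun k _ => by push_cast; rw [add_comm]
  rw [Finset.prod_congr rfl e, Finset.sum_add_distrib, ← Finset.mul_sum, ← Finset.mul_sum]
  push_cast
  rfl

theorem prod_Gamma_shift_mul (τ : ℝ) (z : ℂ) {M : ℕ} (hM : 1 ≤ M) :
    (∏ k ∈ Finset.Ico 1 M, Complex.Gamma (z + τ + k * τ)) * Complex.Gamma (z + τ) =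
      (∏ k ∈ Finset.Ico 1 M, Complex.Gamma (z + k * τ)) * Complex.Gamma (z + M * τ) := by
  induction M, hM using Nat.le_induction with
  | base => simp
  | succ n hn ih =>
    rw [Finset.prod_Ico_succ_top hn, Finset.prod_Ico_succ_top hn, mul_right_comm, ih,
      show z + ((n + 1 : ℕ) : ℂ) * τ = z + τ + n * τ by push_cast; ring]

theorem doubleGammaPartial_add {τ : ℝ} (hτ : 0 < τ) {z : ℂ} (hz : 0 < z.re) {M : ℕ} (hM : 1 ≤ M) :
    doubleGammaPartial τ M (z + τ) = doubleGammaPartial τ M z *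
      (Complex.Gamma z * gammaRow (M * τ) z * Complex.exp (
        τ * (Real.log (2 * Real.pi * τ) / 2 + Real.log τ / (2 * τ) - barnesC τ : ℝ)
        - (z * τ + τ ^ 2 / 2) * (Real.log τ / τ + barnesD τ : ℝ)
        + τ * (∑ k ∈ Finset.Ico 1 M, barnesPsi (k * τ) : ℝ)
        + (z * τ + τ ^ 2 / 2) * (∑ k ∈ Finset.Ico 1 M, deriv barnesPsi (k * τ) : ℝ)
        - z * barnesPsi (M * τ) - z ^ 2 / 2 * (deriv barnesPsi (M * τ) : ℝ)
        - Real.log (Real.Gamma (M * τ)))) := by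
  have hG := Gamma_add_nat_mul_ne_zero (ne_zero_of_re_pos hτ hz)
  have hτ' : (τ : ℂ) ≠ 0 := by exact_mod_cast hτ.ne'
  have hG0 : Complex.Gamma z ≠ 0 := by simpa using hG 0
  have hGτ : Complex.Gamma (z + τ) ≠ 0 := by simpa using hG 1
  have hMτ : 0 < Real.Gamma (M * τ) := Real.Gamma_pos_of_pos (by positivity)
  have hMτ' : (Real.Gamma (M * τ) : ℂ) ≠ 0 := by exact_mod_cast hMτ.ne'
  have hlog : (Real.Gamma (M * τ) : ℂ) = Complex.exp (Real.log (Real.Gamma (M * τ)) : ℝ) := by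
    rw [← Complex.ofReal_exp, Real.exp_log hMτ]
  have hP : ∏ k ∈ Finset.Ico 1 M, Complex.Gamma (z + k * τ) ≠ 0 :=
    Finset.prod_ne_zero_iff.2 fun k _ => hG k
  have htel := prod_Gamma_shift_mul τ z hM
  have hP2 : ∏ k ∈ Finset.Ico 1 M, Complex.Gamma (z + τ + k * τ) =
      (∏ k ∈ Finset.Ico 1 M, Complex.Gamma (z + k * τ)) * Complex.Gamma (z + M * τ) /
        Complex.Gamma (z + τ) := by rw [← htel]; field_simp
  have hGM := hG M
  rw [doubleGammaPartial, doubleGammaPartial, prod_gammaRow, prod_gammaRow, hP2, gammaRow]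
  rw [show (((M * τ : ℝ) : ℂ) + z) = z + M * τ by push_cast; ring]
  have key : ∀ A c d e f g h P R X : ℂ, Complex.exp c * Complex.exp d =
      Complex.exp e * Complex.exp f * Complex.exp h * Complex.exp g * R → P ≠ 0 → X ≠ 0 →
      1 / (τ * Complex.Gamma (z + τ)) * Complex.exp c *
        (A / (P * X / Complex.Gamma (z + τ)) * Complex.exp d) =
      1 / (τ * Complex.Gamma z) * Complex.exp e * (A / P * Complex.exp f) *
        (Complex.Gamma z * (R / X * Complex.exp g) * Complex.exp h) := by
    intro A c d e f g h P R X hh hP hX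
    field_simp
    linear_combination A * hh
  refine key _ _ _ _ _ _ _ _ _ _ ?_ hP hGM
  rw [hlog]
  simp only [← Complex.exp_add]
  congr 1
  ring

/-- The functional equation of the double gamma function in the direction `τ`. -/
theorem doubleGamma_add {τ : ℝ} (hτ : 0 < τ) {z : ℂ} (hz : 0 < z.re) :
    doubleGamma τ (z + τ) = Complex.exp ((τ - 1) / 2 * Real.log (2 * Real.pi) +
      (1 / 2 - z) * Real.log τ) * Complex.Gamma z * doubleGamma τ z := by
  have hτ' : (τ : ℂ) ≠ 0 := by exact_mod_cast hτ.ne'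
  have hl := tendsto_doubleGammaPartial hτ (z := z + τ)
    (ne_zero_of_re_pos hτ (by simp; linarith))
  have hr := tendsto_doubleGammaPartial hτ (ne_zero_of_re_pos hτ hz)
  have hC := (Complex.continuous_ofReal.tendsto _).comp (tendsto_barnesC hτ)
  have hD := (Complex.continuous_ofReal.tendsto _).comp (tendsto_barnesD hτ)
  have hψ := (Complex.continuous_ofReal.tendsto _).comp (tendsto_deriv_barnesPsi_mul hτ)
  -- the exponent in `doubleGammaPartial_add`, in terms of the sequences defining `C` and `D`
  have hX := (((hC.const_add ((Real.log (2 * Real.pi * τ) / 2 + Real.log τ / (2 * τ) -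
      barnesC τ : ℝ) : ℂ)).const_mul (τ : ℂ)).sub
    ((hD.const_sub ((Real.log τ / τ + barnesD τ : ℝ) : ℂ)).const_mul (z * τ + τ ^ 2 / 2))).sub
    ((hψ.const_mul ((z * τ + τ ^ 2 / 2) / 2 + z ^ 2 / 2)).add_const ((Real.log (2 * Real.pi) / 2 : ℝ) : ℂ))
  have hE := (Complex.continuous_exp.tendsto _).comp hX
  have hall := hr.mul (((tendsto_gammaRow_one hτ hz).const_mul (Complex.Gamma z)).mul hE)
  refine (tendsto_nhds_unique hl (hall.congr' ?_)).trans ?_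
  · filter_upwards [eventually_ge_atTop 1] with M hM
    have hMτ : 0 < Real.Gamma (M * τ) := Real.Gamma_pos_of_pos (by positivity)
    rw [doubleGammaPartial_add hτ hz hM]
    congr 2
    simp only [Function.comp]
    congr 1
    rw [Real.log_div hMτ.ne' (by positivity), Real.log_sqrt (by positivity)]
    push_cast
    field_simp
    ring
  · rw [mul_comm, mul_one, mul_comm (Complex.Gamma z)]
    congr 3
    rw [Real.log_mul (by positivity) hτ.ne']
    push_cast
    field_simp
    ring

/-! ### Stirling's formula for `|Γ|` -/

/-- A positive real shift does not cross the branch cut when `z` is not real. -/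
theorem log_add_ofReal {z : ℂ} (hz : z.im ≠ 0) {t : ℝ} (ht : 0 < t) :
    Complex.log (z + t) = Complex.log z + Complex.log (1 + t / z) := by
  have hz0 : z ≠ 0 := fun h => hz (by simp [h])
  have hn : 0 < Complex.normSq z := Complex.normSq_pos.2 hz0
  have him : (1 + t / z).im = -(t * z.im / Complex.normSq z) := by
    simp [Complex.div_im]
  have h1 : 1 + t / z ≠ 0 := fun h => by
    rw [h] at him
    simp at him
    rcases him with (h | h) | h
    · exact ht.ne' h
    · exact hz h
    · exact hz0 h
  have e : z + t = z * (1 + t / z) := by field_simp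
  rw [e]
  refine Complex.log_mul hz0 h1 ?_
  rcases lt_or_gt_of_ne hz with h | h
  · have h2 : 0 < (1 + t / z).im := by
      rw [him, Left.neg_pos_iff, div_lt_iff₀ hn]; nlinarith
    have a1 := Complex.arg_neg_iff.2 h
    have a2 := Complex.neg_pi_lt_arg z
    have a3 := Complex.arg_nonneg_iff.2 h2.le
    have a4 := Complex.arg_le_pi (1 + t / z)
    constructor <;> linarith
  · have h2 : (1 + t / z).im < 0 := by
      rw [him, Left.neg_neg_iff]; positivity
    have a1 := Complex.arg_nonneg_iff.2 h.le
    have a2 := Complex.arg_le_pi z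
    have a3 := Complex.arg_neg_iff.2 h2
    have a4 := Complex.neg_pi_lt_arg (1 + t / z)
    have a5 : z.arg ≠ 0 := fun h' => by
      have := Complex.arg_eq_zero_iff.1 h'
      exact hz this.2
    have a6 : 0 < z.arg := lt_of_le_of_ne a1 (Ne.symm a5)
    constructor <;> linarith

theorem norm_log_one_add_sub_cubic_le {u : ℂ} (hu : ‖u‖ ≤ 1 / 2) :
    ‖Complex.log (1 + u) - (u - u ^ 2 / 2 + u ^ 3 / 3)‖ ≤ ‖u‖ ^ 4 := by
  have h := Complex.norm_log_sub_logTaylor_le 3 (z := u) (by linarith)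
  have e : Complex.logTaylor 4 u = u - u ^ 2 / 2 + u ^ 3 / 3 := by
    simp [Complex.logTaylor, Finset.sum_range_succ]; ring
  rw [show (3 : ℕ) + 1 = 4 from rfl, e] at h
  have h0 : 0 ≤ ‖u‖ ^ 4 := by positivity
  have h2 : (1 - ‖u‖)⁻¹ ≤ 2 := by
    rw [inv_le_comm₀ (by linarith) two_pos]; linarith
  calc _ ≤ _ := h
    _ ≤ ‖u‖ ^ 4 * 2 / (3 + 1) := by push_cast; gcongr
    _ ≤ _ := by linarith

/-- Stirling's approximation of `log Γ`, up to terms of order `z⁻³`. -/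
noncomputable def stirlingApprox (z : ℂ) : ℂ :=
  (z - 1 / 2) * Complex.log z - z + Real.log (2 * Real.pi) / 2 + 1 / (12 * z)

theorem norm_stirlingApprox_step_le {z : ℂ} (hz : 2 ≤ |z.im|) :
    ‖stirlingApprox (z + 1) - stirlingApprox z - Complex.log z‖ ≤ 2 / ‖z‖ ^ 3 := by
  have him : z.im ≠ 0 := fun h => by norm_num [h] at hz
  have hz0 : z ≠ 0 := fun h => him (by simp [h])
  have hn : 2 ≤ ‖z‖ := hz.trans (Complex.abs_im_le_norm z)
  have hnpos : 0 < ‖z‖ := by linarith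
  have hu : ‖1 / z‖ ≤ 1 / 2 := by
    rw [norm_div, norm_one]; gcongr
  have h1 := norm_log_one_add_sub_cubic_le hu
  have hz1 : z + 1 ≠ 0 := fun h => by
    have := congrArg Complex.im h
    simp at this; exact him this
  have hz2 : ‖z‖ / 2 ≤ ‖z + 1‖ := by
    have := norm_sub_norm_le z (-1)
    simp at this
    linarith
  have hlog := log_add_ofReal him one_pos
  simp only [Complex.ofReal_one] at hlog
  have e : stirlingApprox (z + 1) - stirlingApprox z - Complex.log z =
      (z + 1 / 2) * (Complex.log (1 + 1 / z) - (1 / z - (1 / z) ^ 2 / 2 + (1 / z) ^ 3 / 3)) +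
      (1 / (6 * z ^ 3) + 1 / (12 * z ^ 2 * (z + 1))) := by
    rw [stirlingApprox, stirlingApprox, hlog]
    field_simp
    ring
  rw [e]
  have b1 : ‖(z + 1 / 2) * (Complex.log (1 + 1 / z) - (1 / z - (1 / z) ^ 2 / 2 + (1 / z) ^ 3 / 3))‖
      ≤ (5 / 4 * ‖z‖) * (1 / ‖z‖) ^ 4 := by
    rw [norm_mul]
    have h2 : ‖z + 1 / 2‖ ≤ 5 / 4 * ‖z‖ := by
      refine (norm_add_le _ _).trans ?_
      norm_num
      linarith
    have h3 : ‖1 / z‖ = 1 / ‖z‖ := by simp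
    rw [h3] at h1
    gcongr
  have b2 : ‖1 / (6 * z ^ 3)‖ = 1 / (6 * ‖z‖ ^ 3) := by simp
  have b3 : ‖1 / (12 * z ^ 2 * (z + 1))‖ ≤ 1 / (12 * ‖z‖ ^ 2 * (‖z‖ / 2)) := by
    rw [norm_div, norm_mul, norm_mul, norm_pow, norm_one,
      show ‖(12 : ℂ)‖ = 12 by simp]
    gcongr
  calc _ ≤ (5 / 4 * ‖z‖) * (1 / ‖z‖) ^ 4 + (1 / (6 * ‖z‖ ^ 3) + 1 / (12 * ‖z‖ ^ 2 * (‖z‖ / 2))) := by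
        refine (norm_add_le _ _).trans (add_le_add b1 ((norm_add_le _ _).trans ?_))
        rw [b2]; gcongr
    _ = (19 / 12) / ‖z‖ ^ 3 := by field_simp; norm_num
    _ ≤ _ := by gcongr; norm_num

theorem log_ofReal_add {N : ℝ} (hN : 0 < N) {z : ℂ} (hz : z + N ≠ 0) :
    Complex.log (z + N) = Real.log N + Complex.log (1 + z / N) := by
  have hN' : (N : ℂ) ≠ 0 := by exact_mod_cast hN.ne'
  have e : z + N = N * (1 + z / N) := by field_simp; ring
  have h1 : 1 + z / N ≠ 0 := fun h => hz (by rw [e, h, mul_zero])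
  rw [e, Complex.log_ofReal_mul hN h1]

theorem tendsto_stirlingApprox_add_nat {z : ℂ} (hz : z.im ≠ 0) :
    Tendsto (fun n : ℕ => z * Real.log n + Real.log n.factorial - stirlingApprox (z + (n + 1 : ℕ)))
      atTop (𝓝 0) := by
  have hz1 : ∀ w : ℂ, w.im = 0 → z + w ≠ 0 := fun w hw h => by
    have := congrArg Complex.im h
    simp [hw] at this; exact hz this
  have hS : Tendsto (fun n : ℕ => (Real.log (Stirling.stirlingSeq n) : ℂ)) atTop
      (𝓝 (Real.log (Real.sqrt Real.pi) : ℂ)) :=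
    (Complex.continuous_ofReal.tendsto _).comp
      ((Real.continuousAt_log (by positivity)).tendsto.comp Stirling.tendsto_stirlingSeq_sqrt_pi)
  have hL : Tendsto (fun n : ℕ => (n : ℂ) * Complex.log (1 + (z + 1) / n)) atTop (𝓝 (z + 1)) := by
    refine Complex.tendsto_nat_mul_log_one_add_of_tendsto (tendsto_const_nhds.congr' ?_)
    filter_upwards [eventually_ne_atTop 0] with n hn
    field_simp
  have hI : Tendsto (fun n : ℕ => (1 : ℂ) / n) atTop (𝓝 0) := tendsto_one_div_atTop_nhds_zero_nat
  have hL0 : Tendsto (fun n : ℕ => Complex.log (1 + (z + 1) / n)) atTop (𝓝 0) := by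
    have := hI.mul hL
    rw [zero_mul] at this
    refine this.congr' ?_
    filter_upwards [eventually_ne_atTop 0] with n hn
    field_simp
  have hinv : Tendsto (fun n : ℕ => 1 / (12 * (z + (n + 1 : ℕ)))) atTop (𝓝 0) := by
    have h1 : Tendsto (fun n : ℕ => ‖12 * (z + (n + 1 : ℕ))‖) atTop atTop := by
      have h2 : Tendsto (fun n : ℕ => (n : ℝ) - ‖z‖) atTop atTop :=
        tendsto_atTop_add_const_right _ _ tendsto_natCast_atTop_atTop
      refine tendsto_atTop_mono (fun n => ?_) h2
      have h3 := norm_sub_norm_le ((n + 1 : ℕ) : ℂ) (-z)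
      rw [sub_neg_eq_add, norm_neg, add_comm _ z, Complex.norm_natCast] at h3
      rw [norm_mul]
      push_cast at h3 ⊢
      norm_num
      nlinarith [norm_nonneg (z + (n + 1))]
    have := tendsto_inv₀_cobounded.comp (tendsto_norm_atTop_iff_cobounded.1 h1)
    refine this.congr fun n => by simp [Function.comp]
  have hall := (((hS.add_const ((Real.log 2 : ℂ) / 2 - Real.log (2 * Real.pi) / 2)).sub hL).sub
    (hL0.const_mul (z + 1 / 2))).add_const (z + 1) |>.sub hinv
  have e0 : ((Real.log (Real.sqrt Real.pi) : ℂ) + ((Real.log 2 : ℂ) / 2 - Real.log (2 * Real.pi) / 2)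
      - (z + 1) - (z + 1 / 2) * 0 + (z + 1) - 0) = 0 := by
    rw [Real.log_sqrt Real.pi_pos.le, Real.log_mul two_ne_zero Real.pi_ne_zero]
    push_cast; ring
  rw [e0] at hall
  refine hall.congr' ?_
  filter_upwards [eventually_ne_atTop 0] with n hn
  have hn0 : (n : ℝ) ≠ 0 := by exact_mod_cast hn
  have e1 : z + ((n + 1 : ℕ) : ℂ) = z + 1 + (n : ℝ) := by push_cast; ring
  have e2 := Stirling.log_stirlingSeq_formula n
  rw [Real.log_div hn0 (Real.exp_ne_zero 1), Real.log_exp, Real.log_mul two_ne_zero hn0] at e2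
  have e3 : Real.log n.factorial = Real.log (Stirling.stirlingSeq n) + 1 / 2 * (Real.log 2 + Real.log n)
      + n * (Real.log n - 1) := by rw [e2]; ring
  rw [e3, stirlingApprox, e1, log_ofReal_add (by positivity) (by rw [add_assoc]; exact hz1 _ (by simp))]
  push_cast
  ring

theorem log_norm_GammaSeq {z : ℂ} (hz : z.im ≠ 0) {n : ℕ} (hn : n ≠ 0) :
    Real.log ‖Complex.GammaSeq z n‖ = z.re * Real.log n + Real.log n.factorial
      - ∑ j ∈ Finset.range (n + 1), (Complex.log (z + j)).re := by
  have h1 : ∀ j : ℕ, ‖z + j‖ ≠ 0 := fun j => norm_ne_zero_iff.2 fun h => by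
    have := congrArg Complex.im h
    simp at this; exact hz this
  have hn' : 0 < n := Nat.pos_of_ne_zero hn
  have hf : (n.factorial : ℝ) ≠ 0 := by exact_mod_cast n.factorial_ne_zero
  rw [Complex.GammaSeq, norm_div, norm_mul, Complex.norm_natCast_cpow_of_pos hn', norm_prod,
    Complex.norm_natCast, Real.log_div (mul_ne_zero (by positivity) hf)
      (Finset.prod_ne_zero_iff.2 fun j _ => h1 j),
    Real.log_mul (by positivity) hf, Real.log_rpow (by positivity), Real.log_prod fun j _ => h1 j]
  simp only [Complex.log_re]

theorem tsum_one_div_add_cube_le {r : ℝ} (hr : 1 ≤ r) :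
    Summable (fun j : ℕ => 1 / (r + j) ^ 3) ∧ ∑' j : ℕ, 1 / (r + j) ^ 3 ≤ 2 / r ^ 2 := by
  have hr0 : 0 < r := by linarith
  have hle : ∀ j : ℕ, 1 / (r + j) ^ 3 ≤ 1 / r * (1 / (r + j) ^ 2) := fun j => by
    rw [pow_succ', one_div_mul_one_div]
    have : (0 : ℝ) ≤ j := j.cast_nonneg
    gcongr
    linarith
  have hs := (summable_inv_add_sq hr0).mul_left (1 / r)
  have hs' := Summable.of_nonneg_of_le (fun j => by positivity) hle hs
  refine ⟨hs', (hs'.tsum_le_tsum hle hs).trans ?_⟩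
  rw [tsum_mul_left]
  calc _ ≤ 1 / r * (1 / r ^ 2 + 1 / r) := by gcongr; exact tsum_inv_add_sq_le hr0
    _ ≤ 1 / r * (1 / r + 1 / r) := by
      gcongr
      nlinarith
    _ = _ := by field_simp; norm_num

/-- Stirling's formula for `|Γ|`, in regions where `z + t`, `t ≥ 0`, stays away from the origin. -/
theorem abs_log_norm_Gamma_sub_le {z : ℂ} (hz : 2 ≤ |z.im|) {c r : ℝ} (hc : 0 < c) (hr : 1 ≤ r)
    (h : ∀ t : ℝ, 0 ≤ t → c * (r + t) ≤ ‖z + t‖) :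
    |Real.log ‖Complex.Gamma z‖ - (stirlingApprox z).re| ≤ 4 / c ^ 3 / r ^ 2 := by
  have him : z.im ≠ 0 := fun h => by norm_num [h] at hz
  have hr0 : 0 < r := by linarith
  have hG : Complex.Gamma z ≠ 0 := Complex.Gamma_ne_zero fun m h => him (by simp [h])
  have h1 : Tendsto (fun n => Real.log ‖Complex.GammaSeq z n‖) atTop (𝓝 (Real.log ‖Complex.Gamma z‖)) :=
    (Real.continuousAt_log (norm_ne_zero_iff.2 hG)).tendsto.comp (Complex.GammaSeq_tendsto_Gamma z).norm
  have h2 := (Complex.continuous_re.tendsto _).comp (tendsto_stirlingApprox_add_nat him)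
  have h3 := ((h1.sub_const (stirlingApprox z).re).sub h2).abs
  rw [Complex.zero_re, sub_zero] at h3
  refine le_of_tendsto h3 ?_
  filter_upwards [eventually_ne_atTop 0] with n hn
  simp only [Function.comp]
  rw [log_norm_GammaSeq him hn]
  have e : z.re * Real.log n + Real.log n.factorial - ∑ j ∈ Finset.range (n + 1), (Complex.log (z + j)).re
      - (stirlingApprox z).re - (z * Real.log n + Real.log n.factorial - stirlingApprox (z + (n + 1 : ℕ))).re
      = ∑ j ∈ Finset.range (n + 1),
        (stirlingApprox (z + j + 1) - stirlingApprox (z + j) - Complex.log (z + j)).re := by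
    have := Finset.sum_range_sub (fun j : ℕ => (stirlingApprox (z + j)).re) (n + 1)
    have e4 : ∀ j : ℕ, z + (j : ℂ) + 1 = z + ((j + 1 : ℕ) : ℂ) := fun j => by push_cast; ring
    simp only [Complex.sub_re, Finset.sum_sub_distrib, e4]
    rw [Finset.sum_sub_distrib] at this
    simp only [Complex.add_re, Complex.mul_re, Complex.ofReal_re, Complex.ofReal_im]
    simp only [Nat.cast_zero, add_zero] at this
    linarith
  rw [e]
  obtain ⟨hs, hle⟩ := tsum_one_div_add_cube_le hr
  calc _ ≤ ∑ j ∈ Finset.range (n + 1), 2 / c ^ 3 * (1 / (r + j) ^ 3) := by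
        refine (Finset.abs_sum_le_sum_abs _ _).trans (Finset.sum_le_sum fun j _ => ?_)
        refine (Complex.abs_re_le_norm _).trans ((norm_stirlingApprox_step_le (by simpa using hz)).trans ?_)
        have hj := h j j.cast_nonneg
        rw [Complex.ofReal_natCast] at hj
        rw [div_mul_div_comm, mul_one, ← mul_pow]
        gcongr
    _ = 2 / c ^ 3 * ∑ j ∈ Finset.range (n + 1), 1 / (r + j) ^ 3 := by rw [Finset.mul_sum]
    _ ≤ 2 / c ^ 3 * (2 / r ^ 2) := by
        gcongr
        exact (hs.sum_le_tsum _ fun j _ => by positivity).trans hle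
    _ = _ := by ring

/-! ### An approximate solution of the functional equation -/

/-- The quadratic factor of the leading term `Q(z) log z` of `log G(z; τ)`. -/
noncomputable def barnesQuadratic (τ : ℝ) (z : ℂ) : ℂ :=
  z ^ 2 / (2 * τ) - (1 / 2 * (1 + 1 / τ)) * z + (τ / 12 + 1 / 4 + 1 / (12 * τ))

/-- Asymptotic solution of `K(z + τ) - K(z) = log Γ(z)`. -/
noncomputable def barnesApprox (τ : ℝ) (z : ℂ) : ℂ :=
  barnesQuadratic τ z * Complex.log z - 3 / (4 * τ) * z ^ 2 +
    (Real.log (2 * Real.pi) / 2 + 1 / 2 + τ / 2) / τ * z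

theorem exists_norm_barnesApprox_step_le {τ : ℝ} (hτ : 0 < τ) :
    ∃ C : ℝ, 0 ≤ C ∧ ∀ z : ℂ, z.im ≠ 0 → 2 * τ ≤ |z.im| →
      ‖barnesApprox τ (z + τ) - barnesApprox τ z - stirlingApprox z‖ ≤ C / ‖z‖ ^ 2 := by
  have hτ' : (τ : ℂ) ≠ 0 := by exact_mod_cast hτ.ne'
  -- `Q(z + τ) = q₂ z² + q₁ z + q₀`
  set q2 : ℂ := 1 / (2 * τ) with hq2
  set q1 : ℂ := 1 / 2 - 1 / (2 * τ) with hq1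
  set q0 : ℂ := τ / 12 - 1 / 4 + 1 / (12 * τ) with hq0
  set r2 : ℂ := q1 * τ ^ 3 / 3 - q0 * τ ^ 2 / 2 with hr2
  set r3 : ℂ := q0 * τ ^ 3 / 3 with hr3
  refine ⟨(‖q2‖ + ‖q1‖ / (2 * τ) + ‖q0‖ / (2 * τ) ^ 2) * τ ^ 4 + ‖r2‖ + ‖r3‖ / (2 * τ),
    by positivity, fun z him hz => ?_⟩
  have hz0 : z ≠ 0 := fun h => him (by simp [h])
  have hn : 2 * τ ≤ ‖z‖ := hz.trans (Complex.abs_im_le_norm z)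
  have hnpos : 0 < ‖z‖ := by linarith
  have hu3 : ‖(τ : ℂ) / z‖ = τ / ‖z‖ := by
    rw [norm_div, Complex.norm_real, Real.norm_of_nonneg hτ.le]
  have hu : ‖(τ : ℂ) / z‖ ≤ 1 / 2 := by
    rw [hu3, div_le_div_iff₀ hnpos two_pos]; linarith
  have h1 := norm_log_one_add_sub_cubic_le hu
  rw [hu3] at h1
  have e : barnesApprox τ (z + τ) - barnesApprox τ z - stirlingApprox z =
      (q2 * z ^ 2 + q1 * z + q0) *
        (Complex.log (1 + τ / z) - (τ / z - (τ / z) ^ 2 / 2 + (τ / z) ^ 3 / 3)) +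
      (r2 / z ^ 2 + r3 / z ^ 3) := by
    rw [barnesApprox, barnesApprox, stirlingApprox, log_add_ofReal him hτ]
    simp only [barnesQuadratic, hq2, hq1, hq0, hr2, hr3]
    field_simp
    ring
  rw [e]
  have b1 : ‖q2 * z ^ 2 + q1 * z + q0‖ ≤ (‖q2‖ + ‖q1‖ / (2 * τ) + ‖q0‖ / (2 * τ) ^ 2) * ‖z‖ ^ 2 := by
    have c1 : 1 ≤ ‖z‖ / (2 * τ) := by rw [le_div_iff₀ (by positivity)]; linarith
    calc _ ≤ ‖q2‖ * ‖z‖ ^ 2 + ‖q1‖ * ‖z‖ * 1 + ‖q0‖ * 1 ^ 2 := by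
          refine (norm_add₃_le).trans ?_
          simp
      _ ≤ ‖q2‖ * ‖z‖ ^ 2 + ‖q1‖ * ‖z‖ * (‖z‖ / (2 * τ)) + ‖q0‖ * (‖z‖ / (2 * τ)) ^ 2 := by gcongr
      _ = _ := by ring
  have b2 : ‖r3 / z ^ 3‖ ≤ ‖r3‖ / (2 * τ) / ‖z‖ ^ 2 := by
    rw [norm_div, norm_pow, div_div, pow_succ']
    gcongr
  calc _ ≤ (‖q2‖ + ‖q1‖ / (2 * τ) + ‖q0‖ / (2 * τ) ^ 2) * ‖z‖ ^ 2 * (τ / ‖z‖) ^ 4 +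
        (‖r2‖ / ‖z‖ ^ 2 + ‖r3‖ / (2 * τ) / ‖z‖ ^ 2) := by
        refine (norm_add_le _ _).trans (add_le_add ?_ ((norm_add_le _ _).trans (add_le_add ?_ b2)))
        · rw [norm_mul]; gcongr
        · rw [norm_div, norm_pow]
    _ = _ := by field_simp; ring

/-- Far to the right, `barnesApprox` is a quadratic polynomial with real coefficients. -/
theorem exists_tendsto_barnesApprox_add {τ : ℝ} (hτ : 0 < τ) :
    ∃ s₀ s₁ s₂ : ℕ → ℝ, ∀ z : ℂ, z.im ≠ 0 →
      Tendsto (fun M : ℕ => barnesApprox τ (z + M * τ) - (s₀ M + s₁ M * z + s₂ M * z ^ 2)) atTop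
        (𝓝 0) := by
  have hτ' : (τ : ℂ) ≠ 0 := by exact_mod_cast hτ.ne'
  set ϰ : ℝ := 1 / 2 * (1 + 1 / τ) with hϰ
  set κ : ℝ := τ / 12 + 1 / 4 + 1 / (12 * τ) with hκ
  set e₁ : ℝ := (Real.log (2 * Real.pi) / 2 + 1 / 2 + τ / 2) / τ with he₁
  set Q : ℝ → ℝ := fun N => N ^ 2 / (2 * τ) - ϰ * N + κ with hQ
  let s₀ : ℕ → ℝ := fun M => let N : ℝ := M * τ
    Q N * Real.log N - 3 / (4 * τ) * N ^ 2 + e₁ * N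
  let s₁ : ℕ → ℝ := fun M => let N : ℝ := M * τ
    (N / τ - ϰ) * Real.log N - 3 / (2 * τ) * N + e₁ + Q N / N
  let s₂ : ℕ → ℝ := fun M => let N : ℝ := M * τ
    1 / (2 * τ) * Real.log N - 3 / (4 * τ) + (N / τ - ϰ) / N - Q N / (2 * N ^ 2)
  refine ⟨s₀, s₁, s₂, fun z hz => ?_⟩
  have hN : Tendsto (fun M : ℕ => (M : ℝ) * τ) atTop atTop :=
    tendsto_natCast_atTop_atTop.atTop_mul_const hτ
  have hI : Tendsto (fun M : ℕ => 1 / ((M : ℂ) * τ)) atTop (𝓝 0) := by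
    have := (Complex.continuous_ofReal.tendsto _).comp (tendsto_inv_atTop_zero.comp hN)
    refine this.congr fun M => by simp [Function.comp]
  -- the remainder of the logarithm, against the quadratic growth of `Q`
  have hR : Tendsto (fun M : ℕ => barnesQuadratic τ (z + M * τ) * (Complex.log (1 + z / (M * τ)) -
      z / (M * τ) + (z / (M * τ)) ^ 2 / 2)) atTop (𝓝 0) := by
    have h1 : Tendsto (fun M : ℕ => ‖(1 / ((M : ℂ) * τ)) ^ 2 * barnesQuadratic τ (z + M * τ)‖ *
        (‖1 / ((M : ℂ) * τ)‖ * ‖z‖ ^ 3)) atTop (𝓝 0) := by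
      have h2 : Tendsto (fun M : ℕ => (1 / ((M : ℂ) * τ)) ^ 2 * barnesQuadratic τ (z + M * τ)) atTop
          (𝓝 ((z * 0 + 1) ^ 2 / (2 * τ) - ϰ * 0 * (z * 0 + 1) + κ * 0 ^ 2)) := by
        have h3 := ((((hI.const_mul z).add_const 1).pow 2).div_const (2 * (τ : ℂ))).sub
          ((hI.const_mul (ϰ : ℂ)).mul ((hI.const_mul z).add_const 1)) |>.add ((hI.pow 2).const_mul (κ : ℂ))
        refine h3.congr' ?_
        filter_upwards [eventually_ne_atTop 0] with M hM
        have hM' : (M : ℂ) ≠ 0 := by exact_mod_cast hM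
        simp only [barnesQuadratic, hϰ, hκ]
        push_cast
        field_simp
      have := h2.norm.mul (hI.norm.mul_const (‖z‖ ^ 3))
      simpa using this
    refine squeeze_zero_norm' ?_ h1
    have hv : Tendsto (fun M : ℕ => ‖z / ((M : ℂ) * τ)‖) atTop (𝓝 0) := by
      have := (hI.const_mul z).norm
      simpa [div_eq_mul_inv] using this
    filter_upwards [hv.eventually_le_const (show (0 : ℝ) < 1 / 2 by norm_num)] with M hM
    rw [norm_mul, norm_mul, mul_comm ‖_ ^ 2‖, mul_assoc]
    refine mul_le_mul_of_nonneg_left ((norm_log_one_add_sub_le hM).trans (le_of_eq ?_)) (norm_nonneg _)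
    rw [norm_div, norm_pow, norm_div, norm_one]
    ring
  have hrest : Tendsto (fun M : ℕ => z ^ 3 * (ϰ / 2) * (1 / ((M : ℂ) * τ)) ^ 2 -
      z ^ 4 / (4 * τ) * (1 / ((M : ℂ) * τ)) ^ 2) atTop (𝓝 0) := by
    have := ((hI.pow 2).const_mul (z ^ 3 * (ϰ / 2))).sub ((hI.pow 2).const_mul (z ^ 4 / (4 * τ)))
    simpa using this
  have hall := hR.add hrest
  rw [add_zero] at hall
  refine hall.congr' ?_
  filter_upwards [eventually_ne_atTop 0] with M hM
  have hM' : (M : ℂ) ≠ 0 := by exact_mod_cast hM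
  have hMτ : 0 < (M : ℝ) * τ := by
    have : 0 < M := Nat.pos_of_ne_zero hM
    positivity
  have hlog : Complex.log (z + M * τ) = Real.log (M * τ) + Complex.log (1 + z / (M * τ)) := by
    have := log_ofReal_add hMτ (z := z) (fun h => by
      have := congrArg Complex.im h
      simp at this; exact hz this)
    push_cast at this ⊢
    exact this
  rw [barnesApprox, hlog]
  simp only [s₀, s₁, s₂, hQ, barnesQuadratic, hϰ, hκ, he₁]
  generalize Complex.log (1 + z / (M * τ)) = L
  push_cast
  generalize (Complex.log (M * τ)) = L2
  generalize (Complex.log (2 * Real.pi)) = L3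
  field_simp
  ring

/-! ### Asymptotics of `|G|` on vertical strips -/

/-- The partial products are, up to a quadratic polynomial with real coefficients, products of the
functions `1 / Γ(z + k τ)`. -/
theorem log_norm_doubleGammaPartial {τ : ℝ} (hτ : 0 < τ) :
    ∃ p₀ p₁ p₂ : ℕ → ℝ, ∀ z : ℂ, z.im ≠ 0 → ∀ M : ℕ, 1 ≤ M →
      Real.log ‖doubleGammaPartial τ M z‖ = (p₀ M + p₁ M * z + p₂ M * z ^ 2 : ℂ).re -
        ∑ k ∈ Finset.range M, Real.log ‖Complex.Gamma (z + k * τ)‖ := by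
  refine ⟨fun M => Real.log ‖(1 / τ : ℂ)‖ + Real.log ‖∏ k ∈ Finset.Ico 1 M, (Real.Gamma (k * τ) : ℂ)‖,
    fun M => (Real.log (2 * Real.pi * τ) / 2 + Real.log τ / (2 * τ) - barnesC τ) +
      ∑ k ∈ Finset.Ico 1 M, barnesPsi (k * τ),
    fun M => -(1 / 2) * (Real.log τ / τ + barnesD τ) +
      1 / 2 * ∑ k ∈ Finset.Ico 1 M, deriv barnesPsi (k * τ), fun z hz M hM => ?_⟩
  have hG := Gamma_add_nat_mul_ne_zero (ne_zero_of_im_ne_zero τ hz)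
  have hτ' : (τ : ℂ) ≠ 0 := by exact_mod_cast hτ.ne'
  have hτi : (1 / τ : ℂ) ≠ 0 := one_div_ne_zero hτ'
  have hG0 : Complex.Gamma z ≠ 0 := by simpa using hG 0
  have hP : ∏ k ∈ Finset.range M, Complex.Gamma (z + k * τ) ≠ 0 :=
    Finset.prod_ne_zero_iff.2 fun k _ => hG k
  have hR : ∏ k ∈ Finset.Ico 1 M, (Real.Gamma (k * τ) : ℂ) ≠ 0 :=
    Finset.prod_ne_zero_iff.2 fun k hk => by
      have h1 : 0 < k := (Finset.mem_Ico.1 hk).1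
      exact_mod_cast (Real.Gamma_pos_of_pos (by positivity : 0 < (k : ℝ) * τ)).ne'
  have e : doubleGammaPartial τ M z = 1 / τ * (∏ k ∈ Finset.Ico 1 M, (Real.Gamma (k * τ) : ℂ)) /
      (∏ k ∈ Finset.range M, Complex.Gamma (z + k * τ)) * Complex.exp
        (z * ((Real.log (2 * Real.pi * τ) / 2 + Real.log τ / (2 * τ) - barnesC τ) +
          ∑ k ∈ Finset.Ico 1 M, barnesPsi (k * τ) : ℝ) +
        z ^ 2 * (-(1 / 2) * (Real.log τ / τ + barnesD τ) +
          1 / 2 * ∑ k ∈ Finset.Ico 1 M, deriv barnesPsi (k * τ) : ℝ)) := by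
    rw [doubleGammaPartial, prod_gammaRow, Finset.range_eq_Ico,
      Finset.prod_eq_prod_Ico_succ_bot (show 0 < M from hM) fun k => Complex.Gamma (z + k * τ),
      Nat.cast_zero, zero_mul, add_zero, zero_add]
    rw [show ∀ a b c d e : ℂ, a * b * (c / d * e) = a * c / d * (b * e) by intros; ring,
      ← Complex.exp_add]
    rw [show ∀ a b : ℂ, 1 / τ * a / (Complex.Gamma z * b) = 1 / (τ * Complex.Gamma z) * a / b by
      intros; field_simp]
    congr 2
    push_cast
    ring
  rw [e, norm_mul, norm_div, norm_mul, Complex.norm_exp, norm_prod (Finset.range M),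
    Real.log_mul (div_ne_zero (mul_ne_zero (norm_ne_zero_iff.2 hτi) (norm_ne_zero_iff.2 hR))
      (by rw [← norm_prod]; exact norm_ne_zero_iff.2 hP)) (Real.exp_ne_zero _), Real.log_exp,
    Real.log_div (mul_ne_zero (norm_ne_zero_iff.2 hτi) (norm_ne_zero_iff.2 hR))
      (by rw [← norm_prod]; exact norm_ne_zero_iff.2 hP),
    Real.log_mul (norm_ne_zero_iff.2 hτi) (norm_ne_zero_iff.2 hR),
    Real.log_prod fun k _ => norm_ne_zero_iff.2 (hG k)]
  simp only [Complex.add_re, Complex.ofReal_re, Complex.re_ofReal_mul, Complex.re_mul_ofReal]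
  ring

theorem norm_add_ofReal_ge {X : ℝ} {z : ℂ} (hx : |z.re| ≤ X) (hy : 1 ≤ |z.im|) (t : ℝ) :
    1 / (2 + X) * (1 + t) ≤ ‖z + t‖ := by
  have hX : 0 ≤ X := (abs_nonneg _).trans hx
  have h1 := Complex.abs_im_le_norm (z + t)
  have h2 := Complex.abs_re_le_norm (z + t)
  simp at h1 h2
  have h3 := (abs_le.1 hx).1
  have h4 := le_abs_self (z.re + t)
  rw [one_div, inv_mul_le_iff₀ (by positivity)]
  nlinarith

/-- The errors of Stirling's formula and of `barnesApprox` along `z + τ ℕ`, which are summable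
uniformly on vertical strips. -/
theorem exists_abs_log_norm_Gamma_sub_barnesApprox_le {τ : ℝ} (hτ : 0 < τ) (X : ℝ) :
    ∃ v : ℕ → ℝ, Summable v ∧ ∀ z : ℂ, |z.re| ≤ X → 2 + 2 * τ ≤ |z.im| → ∀ k : ℕ,
      |Real.log ‖Complex.Gamma (z + k * τ)‖ -
        (barnesApprox τ (z + (k + 1 : ℕ) * τ) - barnesApprox τ (z + k * τ)).re| ≤ v k := by
  obtain ⟨C, hC, hK⟩ := exists_norm_barnesApprox_step_le hτ
  set c : ℝ := 1 / (2 + |X|) with hc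
  have hc0 : 0 < c := by positivity
  refine ⟨fun k => (4 / c ^ 3 + C / c ^ 2) / τ ^ 2 * (1 / (1 / τ + k) ^ 2),
    (summable_inv_add_sq (by positivity)).mul_left _, fun z hx hy k => ?_⟩
  have hshift : ∀ t : ℝ, c * (1 + (k * τ + t)) ≤ ‖z + k * τ + t‖ := fun t => by
    have := norm_add_ofReal_ge (X := |X|) (z := z) (hx.trans (le_abs_self X)) (by linarith)
      (k * τ + t)
    push_cast at this
    rwa [← add_assoc z] at this
  have hr : 1 ≤ 1 + (k : ℝ) * τ := by
    have : 0 ≤ (k : ℝ) * τ := by positivity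
    linarith
  have him : (z + k * τ).im = z.im := by simp
  have h1 := abs_log_norm_Gamma_sub_le (z := z + k * τ) (by rw [him]; linarith) hc0 hr
    (fun t _ => by rw [add_assoc]; exact hshift t)
  have h2 := hK (z + k * τ) (by rw [him]; intro h; rw [h, abs_zero] at hy; linarith)
    (by rw [him]; linarith)
  have h3 := hshift 0
  rw [Complex.ofReal_zero, add_zero, add_zero] at h3
  have e : z + ((k + 1 : ℕ) : ℂ) * τ = z + k * τ + τ := by push_cast; ring
  rw [e]
  have h4 : |(barnesApprox τ (z + k * τ + τ) - barnesApprox τ (z + k * τ)).re -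
      (stirlingApprox (z + k * τ)).re| ≤ C / ‖z + k * τ‖ ^ 2 := by
    rw [← Complex.sub_re]; exact (Complex.abs_re_le_norm _).trans h2
  have h5 : C / ‖z + k * τ‖ ^ 2 ≤ C / c ^ 2 / (1 + k * τ) ^ 2 := by
    rw [div_div, ← mul_pow]; gcongr
  have h6 := abs_sub_le (Real.log ‖Complex.Gamma (z + k * τ)‖) (stirlingApprox (z + k * τ)).re
    (barnesApprox τ (z + k * τ + τ) - barnesApprox τ (z + k * τ)).re
  rw [abs_sub_comm (stirlingApprox _).re] at h6
  calc _ ≤ 4 / c ^ 3 / (1 + k * τ) ^ 2 + C / c ^ 2 / (1 + k * τ) ^ 2 := by linarith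
    _ = _ := by
      have : (1 / τ + k) = (1 + k * τ) / τ := by field_simp
      simp only [this]; field_simp

theorem re_real_quadratic (a b c : ℝ) (z : ℂ) :
    (a + b * z + c * z ^ 2 : ℂ).re = a + b * z.re + c * (z.re ^ 2 - z.im ^ 2) := by
  simp [sq, Complex.mul_re]

/-- Asymptotics of `|G(z; τ)|` on vertical strips, up to a bounded factor. -/
theorem exists_abs_log_norm_doubleGamma_sub_barnesApprox_le {τ : ℝ} (hτ : 0 < τ) :
    ∃ s₀ s₁ s₂ : ℝ, ∀ X : ℝ, ∃ B : ℝ, ∀ z : ℂ, |z.re| ≤ X → 2 + 2 * τ ≤ |z.im| →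
      |Real.log ‖doubleGamma τ z‖ - (barnesApprox τ z).re -
        (s₀ + s₁ * z.re + s₂ * (z.re ^ 2 - z.im ^ 2))| ≤ B := by
  obtain ⟨p₀, p₁, p₂, hp⟩ := log_norm_doubleGammaPartial hτ
  obtain ⟨t₀, t₁, t₂, ht⟩ := exists_tendsto_barnesApprox_add hτ
  set d : ℂ → ℕ → ℝ := fun z k => Real.log ‖Complex.Gamma (z + k * τ)‖ -
    (barnesApprox τ (z + (k + 1 : ℕ) * τ) - barnesApprox τ (z + k * τ)).re with hd
  have hdim : ∀ z : ℂ, 2 + 2 * τ ≤ |z.im| → z.im ≠ 0 := fun z hz h => by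
    rw [h, abs_zero] at hz; linarith
  have hds : ∀ z : ℂ, 2 + 2 * τ ≤ |z.im| → Summable (d z) := fun z hz => by
    obtain ⟨v, hv, hle⟩ := exists_abs_log_norm_Gamma_sub_barnesApprox_le hτ |z.re|
    exact hv.of_norm_bounded fun k => hle z le_rfl hz k
  -- the real quadratic polynomials relating the partial products to `barnesApprox` converge
  have hlim : ∀ z : ℂ, 2 + 2 * τ ≤ |z.im| → Tendsto (fun M =>
      (p₀ M - t₀ M) + (p₁ M - t₁ M) * z.re + (p₂ M - t₂ M) * (z.re ^ 2 - z.im ^ 2)) atTop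
      (𝓝 (Real.log ‖doubleGamma τ z‖ - (barnesApprox τ z).re + ∑' k, d z k)) := by
    intro z hz
    have him := hdim z hz
    have h1 : Tendsto (fun M => Real.log ‖doubleGammaPartial τ M z‖) atTop
        (𝓝 (Real.log ‖doubleGamma τ z‖)) :=
      (Real.continuousAt_log (norm_ne_zero_iff.2 (doubleGamma_ne_zero hτ
        (ne_zero_of_im_ne_zero τ him)))).tendsto.comp
        (tendsto_doubleGammaPartial hτ (ne_zero_of_im_ne_zero τ him)).norm
    have h2 := (Complex.continuous_re.tendsto _).comp (ht z him)
    have h3 := (hds z hz).hasSum.tendsto_sum_nat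
    have h4 := ((h1.sub_const (barnesApprox τ z).re).add h3).add h2
    rw [Complex.zero_re, add_zero] at h4
    refine h4.congr' ?_
    filter_upwards [eventually_ge_atTop 1] with M hM
    rw [hp z him M hM]
    simp only [Function.comp, Complex.sub_re, re_real_quadratic, hd, Finset.sum_sub_distrib]
    have := Finset.sum_range_sub (fun k : ℕ => (barnesApprox τ (z + k * τ)).re) M
    rw [Finset.sum_sub_distrib] at this
    simp only [Nat.cast_zero, zero_mul, add_zero] at this
    linarith
  set Y : ℝ := 2 + 2 * τ with hY
  have hY0 : 0 < Y := by positivity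
  have e1 := hlim (Y * Complex.I) (by simp [abs_of_pos hY0])
  have e2 := hlim (2 * Y * Complex.I) (by simp [abs_of_pos hY0]; linarith)
  have e3 := hlim (1 + Y * Complex.I) (by simp [abs_of_pos hY0])
  simp at e1 e2 e3
  -- a real quadratic polynomial is determined by its real parts at three points
  have f2 := (e1.sub e2).div_const (3 * Y ^ 2)
  have f0 := e1.add (f2.mul_const (Y ^ 2))
  have f1 := (e3.sub f0).sub (f2.mul_const (1 - Y ^ 2))
  have hYne : Y ≠ 0 := hY0.ne'
  obtain ⟨s₂, g2⟩ : ∃ s, Tendsto (fun M => p₂ M - t₂ M) atTop (𝓝 s) :=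
    ⟨_, f2.congr fun M => by field_simp; ring⟩
  obtain ⟨s₀, g0⟩ : ∃ s, Tendsto (fun M => p₀ M - t₀ M) atTop (𝓝 s) :=
    ⟨_, f0.congr fun M => by field_simp; ring⟩
  obtain ⟨s₁, g1⟩ : ∃ s, Tendsto (fun M => p₁ M - t₁ M) atTop (𝓝 s) :=
    ⟨_, f1.congr fun M => by field_simp; ring⟩
  refine ⟨s₀, s₁, s₂, fun X => ?_⟩
  obtain ⟨v, hv, hle⟩ := exists_abs_log_norm_Gamma_sub_barnesApprox_le hτ X
  refine ⟨∑' k, v k, fun z hx hz => ?_⟩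
  have h1 := tendsto_nhds_unique (hlim z hz) ((g0.add (g1.mul_const z.re)).add
    (g2.mul_const (z.re ^ 2 - z.im ^ 2)))
  rw [← h1, sub_add_cancel_left, abs_neg]
  exact tsum_of_norm_bounded (f := d z) hv.hasSum fun k => hle z hx hz k

/-! ### The leading terms of `log |G|` on vertical strips -/

/-- The filter of points `(x, y)` with `|x| ≤ X` and `|y| → ∞`: both ends of a vertical strip. -/
def stripFilter (X : ℝ) : Filter (ℝ × ℝ) :=
  𝓟 {p | |p.1| ≤ X} ⊓ comap (fun p : ℝ × ℝ => |p.2|) atTop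

/-- Boundedness near the ends of the strip `|x| ≤ X`. -/
def StripBounded (X : ℝ) (f : ℝ × ℝ → ℝ) : Prop := f =O[stripFilter X] fun _ => (1 : ℝ)

theorem eventually_stripFilter_iff {X : ℝ} {P : ℝ × ℝ → Prop} :
    (∀ᶠ p in stripFilter X, P p) ↔ ∃ Y : ℝ, ∀ x y : ℝ, |x| ≤ X → Y ≤ |y| → P (x, y) := by
  rw [stripFilter, inf_comm, eventually_inf_principal, eventually_comap, eventually_atTop]
  constructor
  · rintro ⟨Y, h⟩
    exact ⟨Y, fun x y hx hy => h _ hy (x, y) rfl hx⟩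
  · rintro ⟨Y, h⟩
    exact ⟨Y, fun b hb p hp hx => h p.1 p.2 hx (hp ▸ hb)⟩

theorem stripBounded_iff {X : ℝ} {f : ℝ × ℝ → ℝ} :
    StripBounded X f ↔ ∃ B Y : ℝ, ∀ x y : ℝ, |x| ≤ X → Y ≤ |y| → |f (x, y)| ≤ B := by
  rw [StripBounded, isBigO_one_iff, IsBoundedUnder, IsBounded]
  simp only [eventually_map, eventually_stripFilter_iff, Real.norm_eq_abs]

namespace StripBounded

variable {X : ℝ} {f g : ℝ × ℝ → ℝ}

theorem add (hf : StripBounded X f) (hg : StripBounded X g) :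
    StripBounded X fun p => f p + g p := IsBigO.add hf hg

theorem sub (hf : StripBounded X f) (hg : StripBounded X g) :
    StripBounded X fun p => f p - g p := IsBigO.sub hf hg

theorem mul (hf : StripBounded X f) (hg : StripBounded X g) :
    StripBounded X fun p => f p * g p := by
  simpa [StripBounded] using IsBigO.mul hf hg

theorem const (c : ℝ) : StripBounded X fun _ => c := isBigO_const_const _ one_ne_zero _

theorem const_mul (c : ℝ) (hf : StripBounded X f) : StripBounded X fun p => c * f p :=
  (const c).mul hf

theorem fst : StripBounded X Prod.fst :=
  stripBounded_iff.2 ⟨X, 0, fun _ _ hx _ => hx⟩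

theorem congr (hf : StripBounded X f) (h : ∀ᶠ p in stripFilter X, f p = g p) : StripBounded X g :=
  IsBigO.congr' hf h EventuallyEq.rfl

theorem sum {ι : Type*} {s : Finset ι} {F : ι → ℝ × ℝ → ℝ} (h : ∀ i ∈ s, StripBounded X (F i)) :
    StripBounded X fun p => ∑ i ∈ s, F i p := by
  simpa [StripBounded] using IsBigO.fun_sum h

end StripBounded

theorem eventually_stripFilter_abs_snd_ge (X Y : ℝ) : ∀ᶠ p in stripFilter X, Y ≤ |p.2| :=
  eventually_stripFilter_iff.2 ⟨Y, fun _ _ _ h => h⟩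

theorem eventually_stripFilter_snd_ne_zero (X : ℝ) : ∀ᶠ p in stripFilter X, p.2 ≠ 0 := by
  filter_upwards [eventually_stripFilter_abs_snd_ge X 1] with p hp h
  rw [h, abs_zero] at hp; linarith

theorem abs_log_norm_sub_log_abs_im_le (x : ℝ) {y : ℝ} (hy : y ≠ 0) :
    |Real.log ‖(x + y * Complex.I : ℂ)‖ - Real.log (|y|)| ≤ x ^ 2 / (2 * y ^ 2) := by
  have h1 : ‖(x + y * Complex.I : ℂ)‖ = Real.sqrt (x ^ 2 + y ^ 2) := Complex.norm_add_mul_I x y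
  have hy2 : 0 < y ^ 2 := by positivity
  have h2 : Real.log |y| = Real.log (y ^ 2) / 2 := by
    rw [Real.log_abs, Real.log_pow]; push_cast; ring
  rw [h1, Real.log_sqrt (by positivity), h2, ← sub_div,
    ← Real.log_div (by positivity) (by positivity)]
  have h3 : (x ^ 2 + y ^ 2) / y ^ 2 = 1 + x ^ 2 / y ^ 2 := by field_simp; ring
  rw [h3]
  have h4 : 0 ≤ x ^ 2 / y ^ 2 := by positivity
  have h5 := Real.log_le_sub_one_of_pos (show 0 < 1 + x ^ 2 / y ^ 2 by linarith)
  have h6 := Real.log_nonneg (show 1 ≤ 1 + x ^ 2 / y ^ 2 by linarith)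
  rw [abs_of_nonneg (by linarith)]
  calc _ ≤ x ^ 2 / y ^ 2 / 2 := by linarith
    _ = _ := by field_simp

theorem abs_im_mul_arg_sub_le {x y : ℝ} (hy : y ≠ 0) (hxy : 2 * |x| ≤ |y|) :
    |y * (x + y * Complex.I : ℂ).arg - |y| * (Real.pi / 2)| ≤ 3 / 2 * |x| := by
  have hy0 : 0 < |y| := abs_pos.2 hy
  have hI : y * (y * Complex.I : ℂ).arg = |y| * (Real.pi / 2) := by
    rcases lt_or_gt_of_ne hy with h | h
    · have : (y * Complex.I : ℂ) = ((-y : ℝ) : ℂ) * (-Complex.I) := by push_cast; ring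
      rw [this, Complex.arg_real_mul _ (by linarith), Complex.arg_neg_I, abs_of_neg h]; ring
    · rw [Complex.arg_real_mul _ h, Complex.arg_I, abs_of_pos h]
  have key : ∀ a b : ℂ, a.im ≠ 0 → |y| ≤ ‖a‖ → ∀ t : ℝ, 0 < t → t = |x| → b = a + t →
      |b.arg - a.arg| ≤ 3 / 2 * (|x| / |y|) := by
    intro a b ha hya t ht htx hb
    have hu : ‖(t : ℂ) / a‖ ≤ |x| / |y| := by
      rw [norm_div, Complex.norm_real, Real.norm_of_nonneg ht.le, htx]; gcongr
    have h1 := log_add_ofReal ha ht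
    have h2 := Complex.norm_log_one_add_half_le_self (z := t / a) (hu.trans (by
      rw [div_le_div_iff₀ hy0 two_pos]; linarith))
    have h3 : b.arg - a.arg = (Complex.log (1 + t / a)).im := by
      rw [← Complex.log_im, ← Complex.log_im, hb, h1, Complex.add_im]; ring
    rw [h3]
    exact (Complex.abs_im_le_norm _).trans (h2.trans (by gcongr))
  have harg : |(x + y * Complex.I : ℂ).arg - (y * Complex.I : ℂ).arg| ≤ 3 / 2 * (|x| / |y|) := by
    rcases lt_trichotomy x 0 with h | h | h
    · rw [abs_sub_comm]
      refine key _ _ (by simpa using hy) ?_ (-x) (by linarith) (abs_of_neg h).symm (by push_cast; ring)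
      simpa using Complex.abs_im_le_norm (x + y * Complex.I : ℂ)
    · simp [h]
    · exact key _ _ (by simpa using hy) (by simp) x h (abs_of_pos h).symm (by ring)
  rw [← hI, ← mul_sub, abs_mul]
  calc _ ≤ |y| * (3 / 2 * (|x| / |y|)) := by gcongr
    _ = _ := by field_simp

/-- Leading behaviour of `log |G(x + i y; τ)|` as `|y| → ∞`. The coefficient `A` of `y²` is left
unspecified. -/
noncomputable def doubleGammaLeading (τ A x y : ℝ) : ℝ :=
  -(y ^ 2 / (2 * τ)) * Real.log |y| - A * y ^ 2
    + |y| * (Real.pi / 2) * (1 / 2 * (1 + 1 / τ) - x / τ)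
    + (x ^ 2 / (2 * τ) - 1 / 2 * (1 + 1 / τ) * x + (τ / 12 + 1 / 4 + 1 / (12 * τ))) * Real.log |y|

theorem re_barnesApprox (τ x y : ℝ) :
    (barnesApprox τ (x + y * Complex.I)).re =
      ((x ^ 2 - y ^ 2) / (2 * τ) - 1 / 2 * (1 + 1 / τ) * x + (τ / 12 + 1 / 4 + 1 / (12 * τ))) *
        Real.log ‖(x + y * Complex.I : ℂ)‖
      - (x / τ - 1 / 2 * (1 + 1 / τ)) * (y * (x + y * Complex.I : ℂ).arg)
      - 3 / (4 * τ) * (x ^ 2 - y ^ 2) + (Real.log (2 * Real.pi) / 2 + 1 / 2 + τ / 2) / τ * x := by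
  have e : barnesQuadratic τ (x + y * Complex.I) =
      (((x ^ 2 - y ^ 2) / (2 * τ) - 1 / 2 * (1 + 1 / τ) * x + (τ / 12 + 1 / 4 + 1 / (12 * τ)) : ℝ) : ℂ)
      + (((x / τ - 1 / 2 * (1 + 1 / τ)) * y : ℝ) : ℂ) * Complex.I := by
    rw [barnesQuadratic]
    push_cast
    linear_combination (y ^ 2 / (2 * τ) : ℂ) * Complex.I_sq
  have e2 : barnesApprox τ (x + y * Complex.I) = barnesQuadratic τ (x + y * Complex.I) *
      Complex.log (x + y * Complex.I) + ((-(3 / (4 * τ)) : ℝ) : ℂ) * (x + y * Complex.I) ^ 2 +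
      (((Real.log (2 * Real.pi) / 2 + 1 / 2 + τ / 2) / τ : ℝ) : ℂ) * (x + y * Complex.I) := by
    rw [barnesApprox]; push_cast; ring
  rw [e2, e]
  simp only [Complex.add_re, Complex.mul_re, Complex.add_im,
    Complex.im_ofReal_mul, Complex.log_re, Complex.log_im, Complex.ofReal_re, Complex.ofReal_im,
    Complex.I_re, Complex.I_im, sq]
  ring

theorem exists_stripBounded_log_norm_doubleGamma {τ : ℝ} (hτ : 0 < τ) :
    ∃ A : ℝ, ∀ X : ℝ, StripBounded X fun p =>
      Real.log ‖doubleGamma τ (p.1 + p.2 * Complex.I)‖ - doubleGammaLeading τ A p.1 p.2 := by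
  obtain ⟨s₀, s₁, s₂, hs⟩ := exists_abs_log_norm_doubleGamma_sub_barnesApprox_le hτ
  refine ⟨-(3 / (4 * τ)) + s₂, fun X => ?_⟩
  set ϰ : ℝ := 1 / 2 * (1 + 1 / τ) with hϰ
  set κ : ℝ := τ / 12 + 1 / 4 + 1 / (12 * τ) with hκ
  set e₁ : ℝ := (Real.log (2 * Real.pi) / 2 + 1 / 2 + τ / 2) / τ with he₁
  have hx : StripBounded X Prod.fst := StripBounded.fst
  have h1 : StripBounded X fun p => Real.log ‖doubleGamma τ (p.1 + p.2 * Complex.I)‖ -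
      (barnesApprox τ (p.1 + p.2 * Complex.I)).re -
        (s₀ + s₁ * p.1 + s₂ * (p.1 ^ 2 - p.2 ^ 2)) := by
    obtain ⟨B, hB⟩ := hs X
    refine stripBounded_iff.2 ⟨B, 2 + 2 * τ, fun x y hx hy => ?_⟩
    have := hB (x + y * Complex.I) (by simpa using hx) (by simpa using hy)
    simpa using this
  have h2 : StripBounded X fun p => p.2 ^ 2 *
      (Real.log ‖(p.1 + p.2 * Complex.I : ℂ)‖ - Real.log |p.2|) := by
    refine stripBounded_iff.2 ⟨X ^ 2 / 2, 1, fun x y hx hy => ?_⟩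
    have hy0 : y ≠ 0 := fun h => by rw [h, abs_zero] at hy; linarith
    have := abs_log_norm_sub_log_abs_im_le x hy0
    rw [abs_mul, abs_of_nonneg (sq_nonneg _)]
    calc _ ≤ y ^ 2 * (x ^ 2 / (2 * y ^ 2)) := by gcongr
      _ = |x| ^ 2 / 2 := by rw [sq_abs]; field_simp
      _ ≤ _ := by gcongr
  have h3 : StripBounded X fun p =>
      Real.log ‖(p.1 + p.2 * Complex.I : ℂ)‖ - Real.log |p.2| := by
    have hi : StripBounded X fun p => (p.2 ^ 2)⁻¹ := stripBounded_iff.2 ⟨1, 1, fun x y hx hy => by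
      rw [abs_of_nonneg (by positivity), ← sq_abs]
      exact inv_le_one_of_one_le₀ (one_le_pow₀ hy)⟩
    refine (hi.mul h2).congr ?_
    filter_upwards [eventually_stripFilter_snd_ne_zero X] with p hp
    field_simp
  have h4 : StripBounded X fun p => p.2 * (p.1 + p.2 * Complex.I : ℂ).arg -
      |p.2| * (Real.pi / 2) := by
    refine stripBounded_iff.2 ⟨3 / 2 * X, 2 * X + 1, fun x y hx hy => ?_⟩
    have hX : 0 ≤ X := (abs_nonneg x).trans hx
    refine (abs_im_mul_arg_sub_le (fun h => ?_) (by linarith)).trans (by gcongr)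
    rw [show y = 0 from h, abs_zero] at hy; linarith
  have hall := ((((h1.add (StripBounded.const s₀)).add (hx.const_mul (s₁ + e₁))).add
    ((hx.mul hx).const_mul (s₂ - 3 / (4 * τ)))).add
    (((((hx.mul hx).const_mul (1 / (2 * τ))).sub (hx.const_mul ϰ)).add (StripBounded.const κ)).mul h3)).sub
    ((h2.const_mul (1 / (2 * τ))).add (((hx.const_mul (1 / τ)).sub (StripBounded.const ϰ)).mul h4))
  refine hall.congr (Eventually.of_forall fun p => ?_)
  simp only [re_barnesApprox, doubleGammaLeading, ← hϰ, ← hκ, ← he₁]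
  ring

/-! ### Affine changes of the variable -/

/-- Leading behaviour of `log |G(B + β (x + i y); τ)|` as `|y| → ∞`, expanded in `y`. -/
noncomputable def factorLeading (τ A : ℝ) (B : ℂ) (β x y : ℝ) : ℝ :=
  -(1 / (2 * τ)) * (β ^ 2 * (y ^ 2 * Real.log |y|) + β ^ 2 * Real.log |β| * y ^ 2
      + 2 * β * B.im * (y * Real.log |y|) + 2 * β * B.im * Real.log |β| * y + β * B.im * y
      + B.im ^ 2 * Real.log |y|)
    - A * (β ^ 2 * y ^ 2 + 2 * β * B.im * y)
    + |β| * |y| * (Real.pi / 2) * (1 / 2 * (1 + 1 / τ) - (B.re + β * x) / τ)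
    + ((B.re + β * x) ^ 2 / (2 * τ) - 1 / 2 * (1 + 1 / τ) * (B.re + β * x)
      + (τ / 12 + 1 / 4 + 1 / (12 * τ))) * Real.log |y|

theorem abs_log_abs_one_add_sub_le {t : ℝ} (ht : |t| ≤ 1 / 2) : |Real.log (|1 + t|) - t| ≤ t ^ 2 := by
  have h := Complex.norm_log_one_add_sub_self_le (z := (t : ℂ)) (by
    rw [Complex.norm_real, Real.norm_eq_abs]; linarith)
  have h2 : Real.log (|1 + t|) - t = (Complex.log (1 + t) - t).re := by
    rw [Complex.sub_re, Complex.log_re, Complex.ofReal_re, show (1 + t : ℂ) = ((1 + t : ℝ) : ℂ) by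
      push_cast; rfl, Complex.norm_real, Real.norm_eq_abs]
  rw [h2]
  refine (Complex.abs_re_le_norm _).trans (h.trans ?_)
  rw [Complex.norm_real, Real.norm_eq_abs, sq_abs]
  have : (1 - |t|)⁻¹ ≤ 2 := by
    rw [inv_le_comm₀ (by linarith) two_pos]; linarith
  calc _ ≤ t ^ 2 * 2 / 2 := by gcongr
    _ = _ := by ring

theorem tendsto_stripFilter_affine (B : ℂ) {β : ℝ} (hβ : β ≠ 0) (X : ℝ) :
    Tendsto (fun p : ℝ × ℝ => (B.re + β * p.1, B.im + β * p.2)) (stripFilter X)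
      (stripFilter (|B.re| + |β| * X)) := by
  intro s hs
  obtain ⟨Y, hY⟩ := eventually_stripFilter_iff.1 (show ∀ᶠ p in stripFilter (|B.re| + |β| * X), p ∈ s from hs)
  refine eventually_stripFilter_iff.2 ⟨(Y + |B.im|) / |β|, fun x y hx hy => hY _ _ ?_ ?_⟩
  · refine (abs_add_le _ _).trans ?_
    rw [abs_mul]; gcongr
  · have hb : 0 < |β| := abs_pos.2 hβ
    rw [div_le_iff₀ hb] at hy
    have := abs_sub_abs_le_abs_sub (β * y) (-B.im)
    rw [abs_neg, abs_mul, sub_neg_eq_add, add_comm (β * y)] at this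
    linarith

theorem StripBounded.inv_snd (X : ℝ) : StripBounded X fun p => 1 / p.2 :=
  stripBounded_iff.2 ⟨1, 1, fun x y _ hy => by
    rw [abs_div, abs_one]; exact (div_le_one (by linarith)).2 hy⟩

/-- Expansion of `doubleGammaLeading` at `B + β (x + i y)`: `log |Im B + β y|` is needed to second order
in `1 / y`, since it is multiplied by `(Im B + β y)²`. -/
theorem stripBounded_doubleGammaLeading_sub {τ : ℝ} (A : ℝ) (B : ℂ) {β : ℝ}
    (hβ : β ≠ 0) (X : ℝ) :
    StripBounded X fun p => doubleGammaLeading τ A (B.re + β * p.1) (B.im + β * p.2) -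
      factorLeading τ A B β p.1 p.2 := by
  set d := B.im with hd
  set ρ : ℝ × ℝ → ℝ := fun p => Real.log (|1 + d / (β * p.2)|) with hρ
  have hb : 0 < |β| := abs_pos.2 hβ
  have hx : StripBounded X Prod.fst := StripBounded.fst
  have hi := StripBounded.inv_snd X
  have hsmall : ∀ᶠ p in stripFilter X, |d / (β * p.2)| ≤ 1 / 2 := by
    filter_upwards [eventually_stripFilter_abs_snd_ge X (2 * |d| / |β| + 1)] with p hp
    have hp0 : 0 < |p.2| := lt_of_lt_of_le (by positivity) hp
    have h1 : 2 * |d| / |β| ≤ |p.2| := by linarith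
    rw [div_le_iff₀ hb] at h1
    rw [abs_div, abs_mul, div_le_div_iff₀ (by positivity) two_pos]
    linarith
  -- second-order expansion of `log |d + β y|`
  have h2 : StripBounded X fun p => p.2 ^ 2 * (ρ p - d / (β * p.2)) := by
    refine IsBigO.of_bound ((d / β) ^ 2) ?_
    filter_upwards [hsmall, eventually_stripFilter_snd_ne_zero X] with p hp hp0
    rw [norm_one, mul_one, Real.norm_eq_abs, abs_mul, abs_of_nonneg (sq_nonneg _)]
    calc _ ≤ p.2 ^ 2 * (d / (β * p.2)) ^ 2 := by gcongr; exact abs_log_abs_one_add_sub_le hp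
      _ = _ := by field_simp
  have h0 : StripBounded X ρ := by
    refine ((((hi.mul hi).mul h2)).add (hi.const_mul (d / β))).congr ?_
    filter_upwards [eventually_stripFilter_snd_ne_zero X] with p hp0
    field_simp
    ring
  have habs : StripBounded X fun p => |d + β * p.2| - |β| * |p.2| := by
    refine IsBigO.of_bound |d| (Eventually.of_forall fun p => ?_)
    rw [norm_one, mul_one, Real.norm_eq_abs, ← abs_mul]
    refine (abs_abs_sub_abs_le_abs_sub _ _).trans ?_
    simp
  have hlog : ∀ᶠ p in stripFilter X, Real.log |d + β * p.2| = Real.log |p.2| + Real.log |β| + ρ p := by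
    filter_upwards [hsmall, eventually_stripFilter_snd_ne_zero X] with p hp hp0
    have e : d + β * p.2 = p.2 * β * (1 + d / (β * p.2)) := by field_simp; ring
    have h1 : 1 + d / (β * p.2) ≠ 0 := fun h => by
      have := (abs_le.1 hp).1
      linarith
    rw [e, abs_mul, abs_mul, Real.log_mul (by positivity) (abs_ne_zero.2 h1),
      Real.log_mul (by positivity) (by positivity)]
  have hX := (hx.const_mul β).add (StripBounded.const B.re)
  have hpoly := ((hX.mul hX).const_mul (1 / (2 * τ))).sub (hX.const_mul (1 / 2 * (1 + 1 / τ))) |>.add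
    (StripBounded.const (τ / 12 + 1 / 4 + 1 / (12 * τ)))
  have hlin := (StripBounded.const (1 / 2 * (1 + 1 / τ))).sub (hX.const_mul (1 / τ)) |>.const_mul (Real.pi / 2)
  have hY2 : StripBounded X fun p => (d + β * p.2) ^ 2 * ρ p - β * d * p.2 := by
    have := ((h2.const_mul (β ^ 2)).add (h0.const_mul (d ^ 2))).add
      ((((hi.mul h2).const_mul (2 * d * β))).add (StripBounded.const (2 * d ^ 2)))
    refine this.congr ?_
    filter_upwards [eventually_stripFilter_snd_ne_zero X] with p hp0
    field_simp
    ring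
  have hall := ((((hY2.add (StripBounded.const (d ^ 2 * Real.log |β|))).const_mul (-(1 / (2 * τ)))).sub
    (StripBounded.const (A * d ^ 2))).add (habs.mul hlin)).add
      (hpoly.mul ((StripBounded.const (Real.log |β|)).add h0))
  refine hall.congr ?_
  filter_upwards [hlog] with p hp
  rw [doubleGammaLeading, factorLeading, ← hd, hp]
  ring

theorem exists_stripBounded_log_norm_doubleGamma_affine {τ : ℝ} (hτ : 0 < τ) :
    ∃ A : ℝ, ∀ (B : ℂ) (β : ℝ), β ≠ 0 → ∀ X : ℝ, StripBounded X fun p =>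
      Real.log ‖doubleGamma τ (B + β * (p.1 + p.2 * Complex.I))‖ - factorLeading τ A B β p.1 p.2 := by
  obtain ⟨A, hA⟩ := exists_stripBounded_log_norm_doubleGamma hτ
  refine ⟨A, fun B β hβ X => ?_⟩
  have h1 := IsBigO.comp_tendsto (hA (|B.re| + |β| * X)) (tendsto_stripFilter_affine B hβ X)
  have h2 := StripBounded.add h1 (stripBounded_doubleGammaLeading_sub (τ := τ) A B hβ X)
  refine h2.congr (Eventually.of_forall fun p => ?_)
  simp only [Function.comp]
  have e : B + β * (p.1 + p.2 * Complex.I) =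
      ((B.re + β * p.1 : ℝ) : ℂ) + ((B.im + β * p.2 : ℝ) : ℂ) * Complex.I := by
    conv_lhs => rw [← Complex.re_add_im B]
    push_cast; ring
  rw [e]
  ring

/-! ### Growth of the Fox-Barnes integrand -/

/-- `factorLeading` as a linear combination of the monomials entering the parameter sums. -/
theorem factorLeading_eq (τ A : ℝ) (B : ℂ) {β : ℝ} (hβ : 0 < β) (x y : ℝ) :
    factorLeading τ A B β x y =
      (-(y ^ 2 * Real.log |y|) / (2 * τ) - A * y ^ 2 + x ^ 2 * Real.log |y| / (2 * τ)
        - |y| * (Real.pi / 2) * x / τ) * β ^ 2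
      + (-y ^ 2 / (2 * τ)) * (β ^ 2 * Real.log β)
      + (-(2 * (y * Real.log |y|) + y) / (2 * τ) - 2 * A * y) * (B * β).im
      + (-y / τ) * (B * β * (Real.log β : ℂ)).im
      + (Real.log |y| / (2 * τ)) * (B ^ 2).re
      + (-(1 / 2 * (1 + 1 / τ)) * Real.log |y|) * (B ^ 1).re
      + (x * Real.log |y| / τ - |y| * (Real.pi / 2) / τ) * (B * β).re
      + (|y| * (Real.pi / 2) * (1 / 2 * (1 + 1 / τ)) - 1 / 2 * (1 + 1 / τ) * x * Real.log |y|) * β ^ 1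
      + (τ / 12 + 1 / 4 + 1 / (12 * τ)) * Real.log |y| := by
  have e1 : (B * β * (Real.log β : ℂ)).im = B.im * β * Real.log β := by
    rw [Complex.im_mul_ofReal, Complex.im_mul_ofReal]
  rw [factorLeading, e1, Complex.im_mul_ofReal, Complex.re_mul_ofReal, abs_of_pos hβ]
  simp only [sq, Complex.mul_re, pow_one]
  ring

/-- Under the reflection `(B, β) ↦ (1 + τ - B, -β)` only the term in `|y|` changes, by a sign. -/
theorem factorLeading_reflect {τ : ℝ} (hτ : 0 < τ) (A : ℝ) (B : ℂ) {β : ℝ} (hβ : 0 < β) (x y : ℝ) :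
    factorLeading τ A (1 + τ - B) (-β) x y = factorLeading τ A B β x y
      - Real.pi * |y| * (1 / 2 * (1 + 1 / τ) * β ^ 1 - (B * β).re / τ - x / τ * β ^ 2) := by
  have e1 : (1 + (τ : ℂ) - B).re = 1 + τ - B.re := by simp
  have e2 : (1 + (τ : ℂ) - B).im = -B.im := by simp
  rw [factorLeading, factorLeading, e1, e2, Complex.re_mul_ofReal, abs_neg, abs_of_pos hβ]
  field_simp
  ring

theorem sum_factorLeading {ι : Type*} (s : Finset ι) (τ A : ℝ) (B : ι → ℂ) {β : ι → ℝ}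
    (hβ : ∀ i, 0 < β i) (x y : ℝ) :
    ∑ i ∈ s, factorLeading τ A (B i) (β i) x y =
      (-(y ^ 2 * Real.log |y|) / (2 * τ) - A * y ^ 2 + x ^ 2 * Real.log |y| / (2 * τ)
        - |y| * (Real.pi / 2) * x / τ) * ∑ i ∈ s, β i ^ 2
      + (-y ^ 2 / (2 * τ)) * ∑ i ∈ s, β i ^ 2 * Real.log (β i)
      + (-(2 * (y * Real.log |y|) + y) / (2 * τ) - 2 * A * y) * (∑ i ∈ s, B i * β i).im
      + (-y / τ) * (∑ i ∈ s, B i * β i * (Real.log (β i) : ℂ)).im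
      + (Real.log |y| / (2 * τ)) * (∑ i ∈ s, B i ^ 2).re
      + (-(1 / 2 * (1 + 1 / τ)) * Real.log |y|) * (∑ i ∈ s, B i ^ 1).re
      + (x * Real.log |y| / τ - |y| * (Real.pi / 2) / τ) * (∑ i ∈ s, B i * β i).re
      + (|y| * (Real.pi / 2) * (1 / 2 * (1 + 1 / τ)) - 1 / 2 * (1 + 1 / τ) * x * Real.log |y|) *
        ∑ i ∈ s, β i ^ 1
      + (τ / 12 + 1 / 4 + 1 / (12 * τ)) * Real.log |y| * s.card := by
  rw [Finset.sum_congr rfl fun i _ => factorLeading_eq τ A (B i) (hβ i) x y]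
  simp only [Finset.sum_add_distrib, ← Finset.mul_sum, Finset.sum_const, nsmul_eq_mul,
    Complex.re_sum, Complex.im_sum]
  ring

theorem sum_factorLeading_reflect {ι : Type*} (s : Finset ι) {τ : ℝ} (hτ : 0 < τ) (A : ℝ) (B : ι → ℂ)
    {β : ι → ℝ} (hβ : ∀ i, 0 < β i) (x y : ℝ) :
    ∑ i ∈ s, factorLeading τ A (1 + τ - B i) (-β i) x y =
      ∑ i ∈ s, factorLeading τ A (B i) (β i) x y
      - Real.pi * |y| * (1 / 2 * (1 + 1 / τ) * ∑ i ∈ s, β i ^ 1 - (∑ i ∈ s, B i * β i).re / τ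
        - x / τ * ∑ i ∈ s, β i ^ 2) := by
  rw [Finset.sum_congr rfl fun i _ => factorLeading_reflect hτ A (B i) (hβ i) x y]
  simp only [Finset.sum_sub_distrib, ← Finset.mul_sum, Complex.re_sum, ← Finset.sum_div]

namespace FoxBarnes

variable {p q : ℕ}

theorem card_filter_val_lt {m q : ℕ} (h : m ≤ q) :
    (Finset.univ.filter fun i : Fin q => (i : ℕ) < m).card = m := by
  rw [Fin.card_filter_val_lt]; omega

theorem card_filter_le_val {m q : ℕ} (h : m ≤ q) :
    ((Finset.univ.filter fun i : Fin q => m ≤ (i : ℕ)).card : ℝ) = q - m := by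
  have h1 := Finset.card_filter_add_card_filter_not (s := (Finset.univ : Finset (Fin q)))
    (fun i : Fin q => (i : ℕ) < m)
  rw [card_filter_val_lt h, Finset.card_univ, Fintype.card_fin] at h1
  rw [eq_sub_iff_add_eq', ← Nat.cast_add, Nat.cast_inj]
  simpa only [not_lt] using h1

/-- Leading behaviour of `log |ℐ(s) e^{π ε s² / τ} x^{-s}|` at `s = x + i y`, `|y| → ∞`, for the point
with logarithm `w`. -/
noncomputable def integrandLeading (P : FoxBarnes p q) (A : ℝ) (w : ℂ) (x y : ℝ) : ℝ :=
  -(P.Delta 2 / (2 * P.τ)) * (y ^ 2 * Real.log |y|)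
    - ((P.Theta 2 + 2 * Real.pi * P.ε.re) / (2 * P.τ) + A * P.Delta 2) * y ^ 2
    - P.PiSum.im / P.τ * (y * Real.log |y|)
    + (w.im - P.Lambda.im / P.τ - P.PiSum.im * (1 / (2 * P.τ) + 2 * A)
      - 2 * Real.pi * x * P.ε.im / P.τ) * y
    - (Real.pi / 2) * (P.Phi1 x + 2 * P.Phi3 x) * |y|
    + (P.chi + x * P.Phi1 x - x ^ 2 * P.Delta 2 / (2 * P.τ)) * Real.log |y|

theorem integrandLeading_eq (P : FoxBarnes p q) (A : ℝ) (w : ℂ) (x y : ℝ) :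
    P.integrandLeading A w x y =
      ((∑ i ∈ P.lowNum, factorLeading P.τ A (P.b i) (P.β i) x y +
        ∑ i ∈ P.upNum, factorLeading P.τ A (1 + P.τ - P.a i) (-P.α i) x y) -
      (∑ i ∈ P.lowDen, factorLeading P.τ A (1 + P.τ - P.b i) (-P.β i) x y +
        ∑ i ∈ P.upDen, factorLeading P.τ A (P.a i) (P.α i) x y)) +
      (-(2 * Real.pi * P.ε.re / (2 * P.τ)) * y ^ 2 + w.im * y
        - 2 * Real.pi * x * P.ε.im / P.τ * y) := by
  rw [sum_factorLeading_reflect _ P.hτ _ _ P.hα, sum_factorLeading_reflect _ P.hτ _ _ P.hβ,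
    sum_factorLeading _ _ _ _ P.hα, sum_factorLeading _ _ _ _ P.hβ, sum_factorLeading _ _ _ _ P.hα,
    sum_factorLeading _ _ _ _ P.hβ]
  have c1 : (P.lowNum.card : ℝ) = P.m := by exact_mod_cast card_filter_val_lt P.hm
  have c2 : (P.upNum.card : ℝ) = P.n := by exact_mod_cast card_filter_val_lt P.hn
  have c3 : (P.lowDen.card : ℝ) = q - P.m := card_filter_le_val P.hm
  have c4 : (P.upDen.card : ℝ) = p - P.n := card_filter_le_val P.hn
  rw [c1, c2, c3, c4]
  simp only [integrandLeading, Phi1, Phi3, chi, kap, N, Delta, Theta, Omega, PiSum, Lambda, Upsilon, D,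
    Complex.sub_im, Complex.add_im, Complex.sub_re, Complex.add_re]
  have := P.hτ.ne'
  field_simp
  ring

theorem log_norm_integrand (P : FoxBarnes p q) {s : ℂ}
    (hb : ∀ i, (P.b i + P.β i * s).im ≠ 0) (ha : ∀ i, (P.a i + P.α i * s).im ≠ 0) (w : ℂ) :
    Real.log ‖P.integrand w s‖ =
      ((∑ i ∈ P.lowNum, Real.log ‖doubleGamma P.τ (P.b i + P.β i * s)‖ +
        ∑ i ∈ P.upNum, Real.log ‖doubleGamma P.τ (1 + P.τ - P.a i - P.α i * s)‖) -
      (∑ i ∈ P.lowDen, Real.log ‖doubleGamma P.τ (1 + P.τ - P.b i - P.β i * s)‖ +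
        ∑ i ∈ P.upDen, Real.log ‖doubleGamma P.τ (P.a i + P.α i * s)‖)) +
      ((Real.pi * P.ε * s ^ 2 / P.τ).re - (s * w).re) := by
  have h1 : ∀ {z : ℂ}, z.im ≠ 0 → ‖doubleGamma P.τ z‖ ≠ 0 := fun hz =>
    norm_ne_zero_iff.2 (doubleGamma_ne_zero P.hτ (ne_zero_of_im_ne_zero _ hz))
  have n1 : ∀ i ∈ P.lowNum, ‖doubleGamma P.τ (P.b i + P.β i * s)‖ ≠ 0 := fun i _ => h1 (hb i)
  have n2 : ∀ i ∈ P.upNum, ‖doubleGamma P.τ (1 + P.τ - P.a i - P.α i * s)‖ ≠ 0 := fun i _ =>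
    h1 (fun h => ha i (by simp at h ⊢; linarith))
  have n3 : ∀ i ∈ P.lowDen, ‖doubleGamma P.τ (1 + P.τ - P.b i - P.β i * s)‖ ≠ 0 := fun i _ =>
    h1 (fun h => hb i (by simp at h ⊢; linarith))
  have n4 : ∀ i ∈ P.upDen, ‖doubleGamma P.τ (P.a i + P.α i * s)‖ ≠ 0 := fun i _ => h1 (ha i)
  rw [integrand, quot, norm_mul, norm_mul, Complex.norm_exp, Complex.norm_exp, norm_div, norm_mul,
    norm_mul, norm_prod, norm_prod, norm_prod, norm_prod]
  have m1 := Finset.prod_ne_zero_iff.2 n1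
  have m2 := Finset.prod_ne_zero_iff.2 n2
  have m3 := Finset.prod_ne_zero_iff.2 n3
  have m4 := Finset.prod_ne_zero_iff.2 n4
  rw [Real.log_mul (mul_ne_zero (div_ne_zero (mul_ne_zero m1 m2) (mul_ne_zero m3 m4))
      (Real.exp_ne_zero _)) (Real.exp_ne_zero _),
    Real.log_mul (div_ne_zero (mul_ne_zero m1 m2) (mul_ne_zero m3 m4)) (Real.exp_ne_zero _),
    Real.log_div (mul_ne_zero m1 m2) (mul_ne_zero m3 m4), Real.log_mul m1 m2, Real.log_mul m3 m4,
    Real.log_prod n1, Real.log_prod n2, Real.log_prod n3, Real.log_prod n4, Real.log_exp, Real.log_exp,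
    Complex.neg_re]
  ring

theorem eventually_im_affine_ne_zero (B : ℂ) {β : ℝ} (hβ : 0 < β) (X : ℝ) :
    ∀ᶠ r in stripFilter X, (B + β * (r.1 + r.2 * Complex.I)).im ≠ 0 := by
  filter_upwards [(tendsto_stripFilter_affine B hβ.ne' X).eventually
    (eventually_stripFilter_snd_ne_zero _)] with r hr
  simpa using hr

/-- The modulus of the integrand on vertical strips, up to a bounded factor. -/
theorem exists_stripBounded_log_norm_integrand (P : FoxBarnes p q) :
    ∃ A : ℝ, ∀ (w : ℂ) (X : ℝ), StripBounded X fun r =>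
      Real.log ‖P.integrand w (r.1 + r.2 * Complex.I)‖ - P.integrandLeading A w r.1 r.2 := by
  obtain ⟨A, hA⟩ := exists_stripBounded_log_norm_doubleGamma_affine P.hτ
  refine ⟨A, fun w X => ?_⟩
  have hx : StripBounded X Prod.fst := StripBounded.fst
  have s1 := StripBounded.sum (s := P.lowNum) fun i _ => hA (P.b i) (P.β i) (P.hβ i).ne' X
  have s2 := StripBounded.sum (s := P.upNum) fun i _ =>
    hA (1 + P.τ - P.a i) (-P.α i) (neg_ne_zero.2 (P.hα i).ne') X
  have s3 := StripBounded.sum (s := P.lowDen) fun i _ =>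
    hA (1 + P.τ - P.b i) (-P.β i) (neg_ne_zero.2 (P.hβ i).ne') X
  have s4 := StripBounded.sum (s := P.upDen) fun i _ => hA (P.a i) (P.α i) (P.hα i).ne' X
  have s5 := ((hx.mul hx).const_mul (Real.pi * P.ε.re / P.τ)).sub (hx.const_mul w.re)
  refine (((s1.add s2).sub (s3.add s4)).add s5).congr ?_
  have hb : ∀ᶠ r in stripFilter X, ∀ i, (P.b i + P.β i * (r.1 + r.2 * Complex.I)).im ≠ 0 :=
    eventually_all.2 fun i => eventually_im_affine_ne_zero _ (P.hβ i) X
  have ha : ∀ᶠ r in stripFilter X, ∀ i, (P.a i + P.α i * (r.1 + r.2 * Complex.I)).im ≠ 0 :=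
    eventually_all.2 fun i => eventually_im_affine_ne_zero _ (P.hα i) X
  filter_upwards [hb, ha] with r hrb hra
  rw [P.log_norm_integrand hrb hra, integrandLeading_eq]
  have e1 : (Real.pi * P.ε * (r.1 + r.2 * Complex.I : ℂ) ^ 2 / P.τ).re =
      Real.pi / P.τ * (P.ε.re * (r.1 ^ 2 - r.2 ^ 2) - 2 * r.1 * r.2 * P.ε.im) := by
    rw [show Real.pi * P.ε * (r.1 + r.2 * Complex.I : ℂ) ^ 2 / P.τ =
      ((Real.pi / P.τ : ℝ) : ℂ) * (P.ε * (r.1 + r.2 * Complex.I : ℂ) ^ 2) by push_cast; ring,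
      Complex.re_ofReal_mul]
    simp [sq, Complex.mul_re]
    left; ring
  have e2 : ((r.1 + r.2 * Complex.I : ℂ) * w).re = r.1 * w.re - r.2 * w.im := by
    simp [Complex.mul_re]
  rw [e1, e2]
  simp only [Finset.sum_sub_distrib, Complex.ofReal_neg, neg_mul, ← sub_eq_add_neg]
  ring

end FoxBarnes

/-! ### Decay under the vertical-line conditions -/

theorem exists_log_le_mul {η : ℝ} (hη : 0 < η) :
    ∃ Y₀ : ℝ, 1 ≤ Y₀ ∧ ∀ Y : ℝ, Y₀ ≤ Y → Real.log Y ≤ η * Y := by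
  have h := Real.isLittleO_log_id_atTop.bound hη
  obtain ⟨Y₀, hY⟩ := eventually_atTop.1 (h.and (eventually_ge_atTop 1))
  refine ⟨max Y₀ 1, le_max_right _ _, fun Y hY' => ?_⟩
  obtain ⟨h1, h2⟩ := hY Y ((le_max_left _ _).trans hY')
  rw [Real.norm_eq_abs, Real.norm_eq_abs, id, abs_of_nonneg (by linarith : (0 : ℝ) ≤ Y)] at h1
  exact (le_abs_self _).trans h1

namespace FoxBarnes

variable {p q : ℕ}

theorem exists_bound_lower_terms (P : FoxBarnes p q) (A : ℝ) (w : ℂ) (c₁ c₂ : ℝ) :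
    ∃ K : ℝ, 0 < K ∧ ∀ x ∈ Set.Icc c₁ c₂,
      |w.im - P.Lambda.im / P.τ - P.PiSum.im * (1 / (2 * P.τ) + 2 * A)
        - 2 * Real.pi * x * P.ε.im / P.τ| ≤ K ∧
      |(Real.pi / 2) * (P.Phi1 x + 2 * P.Phi3 x)| ≤ K ∧
      |P.chi + x * P.Phi1 x - x ^ 2 * P.Delta 2 / (2 * P.τ)| ≤ K := by
  have hb : ∀ f : ℝ → ℝ, Continuous f → ∃ C, ∀ x ∈ Set.Icc c₁ c₂, |f x| ≤ C := fun f hf =>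
    isCompact_Icc.exists_bound_of_continuousOn hf.continuousOn
  obtain ⟨K₁, h1⟩ := hb (fun x => w.im - P.Lambda.im / P.τ - P.PiSum.im * (1 / (2 * P.τ) + 2 * A)
        - 2 * Real.pi * x * P.ε.im / P.τ) (by fun_prop)
  obtain ⟨K₂, h2⟩ := hb (fun x => (Real.pi / 2) * (P.Phi1 x + 2 * P.Phi3 x)) (by
    unfold Phi1 Phi3; fun_prop)
  obtain ⟨K₃, h3⟩ := hb (fun x => P.chi + x * P.Phi1 x - x ^ 2 * P.Delta 2 / (2 * P.τ)) (by
    unfold Phi1; fun_prop)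
  refine ⟨max 1 (max K₁ (max K₂ K₃)), by positivity, fun x hx => ⟨(h1 x hx).trans ?_,
    (h2 x hx).trans ?_, (h3 x hx).trans ?_⟩⟩ <;> simp

theorem Phi1_eq_of_Delta_eq_zero (P : FoxBarnes p q) (h : P.Delta 2 = 0) (x c : ℝ) :
    P.Phi1 x = P.Phi1 c := by simp [Phi1, h]

theorem Phi3_eq_of_Omega_eq_zero (P : FoxBarnes p q) (h : P.Omega 2 = 0) (x c : ℝ) :
    P.Phi3 x = P.Phi3 c := by simp [Phi3, h]

/-- The vertical-line conditions at the two ends of a strip make the leading terms decay at least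
like a power less than `-1`, uniformly on the strip. -/
theorem exists_integrandLeading_le (P : FoxBarnes p q) (A : ℝ) (w : ℂ) {c₁ c₂ : ℝ}
    (h₁ : P.VL c₁ w.im) (h₂ : P.VL c₂ w.im) :
    ∃ δ : ℝ, 0 < δ ∧ ∃ Y : ℝ, 1 ≤ Y ∧ ∀ x ∈ Set.Icc c₁ c₂, ∀ y : ℝ, Y ≤ |y| →
      P.integrandLeading A w x y ≤ -(1 + δ) * Real.log |y| := by
  obtain ⟨K, hK, hKb⟩ := P.exists_bound_lower_terms A w c₁ c₂
  have hτ := P.hτ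
  have hrw : ∀ x y : ℝ, P.integrandLeading A w x y ≤
      -(P.Delta 2 / (2 * P.τ)) * (|y| ^ 2 * Real.log |y|)
      - ((P.Theta 2 + 2 * Real.pi * P.ε.re) / (2 * P.τ) + A * P.Delta 2) * |y| ^ 2
      + |P.PiSum.im / P.τ| * (|y| * |Real.log (|y|)|)
      + |w.im - P.Lambda.im / P.τ - P.PiSum.im * (1 / (2 * P.τ) + 2 * A)
        - 2 * Real.pi * x * P.ε.im / P.τ| * |y|
      - (Real.pi / 2) * (P.Phi1 x + 2 * P.Phi3 x) * |y|
      + (P.chi + x * P.Phi1 x - x ^ 2 * P.Delta 2 / (2 * P.τ)) * Real.log |y| := by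
    intro x y
    rw [integrandLeading, sq_abs]
    have a1 := neg_abs_le (P.PiSum.im / P.τ * (y * Real.log |y|))
    have a2 := le_abs_self ((w.im - P.Lambda.im / P.τ - P.PiSum.im * (1 / (2 * P.τ) + 2 * A)
        - 2 * Real.pi * x * P.ε.im / P.τ) * y)
    rw [abs_mul, abs_mul y] at a1
    rw [abs_mul] at a2
    linarith
  set g := |P.PiSum.im / P.τ| with hg
  have hg0 : 0 ≤ g := abs_nonneg _
  rcases h₁ with h | h | h | h
  · -- the term `y² log |y|` dominates
    have h' : 0 < P.Delta 2 := h
    set a := P.Delta 2 / (2 * P.τ) with ha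
    have ha0 : 0 < a := by positivity
    set b := (P.Theta 2 + 2 * Real.pi * P.ε.re) / (2 * P.τ) + A * P.Delta 2 with hb
    obtain ⟨Y₀, hY₀, hlog⟩ := exists_log_le_mul one_pos
    refine ⟨1, one_pos, max Y₀ (Real.exp ((|b| + g + 3 * K + 2) / a)), hY₀.trans (le_max_left _ _),
      fun x hx y hy => (hrw x y).trans ?_⟩
    obtain ⟨k1, k2, k3⟩ := hKb x hx
    have y1 : Y₀ ≤ |y| := (le_max_left _ _).trans hy
    have y0 : 1 ≤ |y| := hY₀.trans y1
    have y2 := hlog _ y1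
    have y3 : (|b| + g + 3 * K + 2) / a ≤ Real.log |y| :=
      (Real.le_log_iff_exp_le (by linarith)).2 ((le_max_right _ _).trans hy)
    have y4 : 0 ≤ Real.log |y| := Real.log_nonneg y0
    rw [div_le_iff₀ ha0] at y3
    rw [abs_of_nonneg y4]
    set Z := |y|
    set L := Real.log Z
    have z1 : Z ≤ Z ^ 2 := by nlinarith
    have t1 : -b * Z ^ 2 ≤ |b| * Z ^ 2 := by gcongr; exact neg_le_abs b
    have t2 : g * (Z * L) ≤ g * Z ^ 2 := by gcongr; nlinarith
    have t3 : |w.im - P.Lambda.im / P.τ - P.PiSum.im * (1 / (2 * P.τ) + 2 * A)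
        - 2 * Real.pi * x * P.ε.im / P.τ| * Z ≤ K * Z ^ 2 := by gcongr
    have t4 : -((Real.pi / 2) * (P.Phi1 x + 2 * P.Phi3 x)) * Z ≤ K * Z ^ 2 := by
      gcongr; exact (neg_le_abs _).trans k2
    have t5 : (P.chi + x * P.Phi1 x - x ^ 2 * P.Delta 2 / (2 * P.τ)) * L ≤ K * Z ^ 2 := by
      gcongr
      · exact (le_abs_self _).trans k3
      · linarith
    have t6 : (|b| + g + 3 * K + 2) * Z ^ 2 ≤ L * a * Z ^ 2 := by gcongr
    nlinarith
  · -- the term `y²` dominates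
    obtain ⟨hΔ, hT⟩ := h
    set b := (P.Theta 2 + 2 * Real.pi * P.ε.re) / (2 * P.τ) with hb
    have hb0 : 0 < b := by positivity
    set η := b / (g + 3 * K + 2) with hη
    have hη0 : 0 < η := by positivity
    obtain ⟨Y₀, hY₀, hlog⟩ := exists_log_le_mul hη0
    refine ⟨1, one_pos, max Y₀ (1 / η), hY₀.trans (le_max_left _ _),
      fun x hx y hy => (hrw x y).trans ?_⟩
    obtain ⟨k1, k2, k3⟩ := hKb x hx
    have y1 : Y₀ ≤ |y| := (le_max_left _ _).trans hy
    have y0 : 1 ≤ |y| := hY₀.trans y1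
    have y2 := hlog _ y1
    have y3 : 1 / η ≤ |y| := (le_max_right _ _).trans hy
    have y4 : 0 ≤ Real.log |y| := Real.log_nonneg y0
    rw [div_le_iff₀ hη0] at y3
    rw [abs_of_nonneg y4]
    set Z := |y|
    set L := Real.log Z
    have z1 : Z ≤ η * Z ^ 2 := by nlinarith
    have z2 : L ≤ η * Z ^ 2 := by nlinarith
    have t2 : g * (Z * L) ≤ g * (η * Z ^ 2) :=
      mul_le_mul_of_nonneg_left (by nlinarith) hg0
    have t3 : |w.im - P.Lambda.im / P.τ - P.PiSum.im * (1 / (2 * P.τ) + 2 * A)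
        - 2 * Real.pi * x * P.ε.im / P.τ| * Z ≤ K * (η * Z ^ 2) := by gcongr
    have t4 : -((Real.pi / 2) * (P.Phi1 x + 2 * P.Phi3 x)) * Z ≤ K * (η * Z ^ 2) := by
      gcongr; exact (neg_le_abs _).trans k2
    have t5 : (P.chi + x * P.Phi1 x - x ^ 2 * P.Delta 2 / (2 * P.τ)) * L ≤ K * (η * Z ^ 2) := by
      gcongr
      exact (le_abs_self _).trans k3
    have t6 : (g + 3 * K + 2) * (η * Z ^ 2) = b * Z ^ 2 := by rw [hη]; field_simp
    rw [hΔ] at t5 ⊢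
    simp only [zero_div, mul_zero, neg_zero, zero_mul, add_zero, sub_zero] at t5 ⊢
    nlinarith
  · -- the term `|y|` dominates
    obtain ⟨⟨hΔ, hT, hΩ, hε, hPi⟩, hpos, harg⟩ := h
    set e := (P.Phi1 c₁ + 2 * P.Phi3 c₁) * Real.pi / 2 - |w.im - P.Lambda.im / P.τ| with he
    have he0 : 0 < e := by linarith
    obtain ⟨Y₀, hY₀, hlog⟩ := exists_log_le_mul (show 0 < e / (K + 2) by positivity)
    refine ⟨1, one_pos, Y₀, hY₀, fun x hx y hy => (hrw x y).trans ?_⟩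
    obtain ⟨k1, k2, k3⟩ := hKb x hx
    have y0 : 1 ≤ |y| := hY₀.trans hy
    have y2 := hlog _ hy
    have y4 : 0 ≤ Real.log |y| := Real.log_nonneg y0
    rw [hg, hΔ, hT, hε, hPi, P.Phi1_eq_of_Delta_eq_zero hΔ x c₁, P.Phi3_eq_of_Omega_eq_zero hΩ x c₁]
    rw [hΔ, P.Phi1_eq_of_Delta_eq_zero hΔ x c₁] at k3
    simp only [zero_div, mul_zero, neg_zero, zero_mul, add_zero, sub_zero, abs_zero, zero_add] at k3 ⊢
    have t5 : (P.chi + x * P.Phi1 c₁) * Real.log |y| ≤ K * Real.log |y| := by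
      gcongr; exact (le_abs_self _).trans k3
    have t6 : (K + 2) * Real.log |y| ≤ e * |y| := by
      calc _ ≤ (K + 2) * (e / (K + 2) * |y|) := by gcongr
        _ = _ := by field_simp
    rw [he] at t6
    nlinarith
  · -- only the term `log |y|` is left
    obtain ⟨⟨hΔ, hT, hΩ, hε, hPi⟩, hzero, harg, hχ⟩ := h
    have hχ₂ : P.chi + c₂ * P.Phi1 c₁ < -1 := by
      rcases h₂ with h | h | h | h
      · exact absurd hΔ (ne_of_gt h)
      · exact absurd hT (ne_of_gt h.2)
      · have := h.2.1
        rw [P.Phi1_eq_of_Delta_eq_zero hΔ c₂ c₁, P.Phi3_eq_of_Omega_eq_zero hΩ c₂ c₁] at this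
        linarith
      · rw [← P.Phi1_eq_of_Delta_eq_zero hΔ c₂ c₁]; exact h.2.2.2
    refine ⟨-1 - max (P.chi + c₁ * P.Phi1 c₁) (P.chi + c₂ * P.Phi1 c₁), by
      have := max_lt hχ hχ₂; linarith, 1, le_rfl, fun x hx y hy => (hrw x y).trans ?_⟩
    have y4 : 0 ≤ Real.log |y| := Real.log_nonneg hy
    rw [hg, hΔ, hT, hε, hPi, P.Phi1_eq_of_Delta_eq_zero hΔ x c₁, P.Phi3_eq_of_Omega_eq_zero hΩ x c₁,
      hzero, harg]
    simp only [zero_div, mul_zero, neg_zero, zero_mul, add_zero, sub_zero, abs_zero, zero_add, sub_self]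
    have : -(1 + (-1 - max (P.chi + c₁ * P.Phi1 c₁) (P.chi + c₂ * P.Phi1 c₁))) =
      max (P.chi + c₁ * P.Phi1 c₁) (P.chi + c₂ * P.Phi1 c₁) := by ring
    rw [this]
    gcongr
    rcases le_total 0 (P.Phi1 c₁) with h0 | h0
    · exact le_max_of_le_right (by nlinarith [hx.2])
    · exact le_max_of_le_left (by nlinarith [hx.1])

/-- Between two lines with vertical-line conditions the integrand decays uniformly, and integrably. -/
theorem exists_norm_integrand_le (P : FoxBarnes p q) (w : ℂ) {c₁ c₂ : ℝ}
    (h₁ : P.VL c₁ w.im) (h₂ : P.VL c₂ w.im) :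
    ∃ δ : ℝ, 0 < δ ∧ ∃ C Y : ℝ, 1 ≤ Y ∧ ∀ x ∈ Set.Icc c₁ c₂, ∀ y : ℝ, Y ≤ |y| →
      ‖P.integrand w (x + y * Complex.I)‖ ≤ C * |y| ^ (-(1 + δ)) := by
  obtain ⟨A, hA⟩ := P.exists_stripBounded_log_norm_integrand
  obtain ⟨δ, hδ, Y, hY, hle⟩ := P.exists_integrandLeading_le A w h₁ h₂
  obtain ⟨B, Y', hB⟩ := stripBounded_iff.1 (hA w (max |c₁| |c₂|))
  refine ⟨δ, hδ, Real.exp B, max Y Y', hY.trans (le_max_left _ _), fun x hx y hy => ?_⟩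
  have y1 := (le_max_left _ _).trans hy
  have y2 := (le_max_right _ _).trans hy
  have hyp : 0 < |y| := by linarith
  have hb := (le_abs_self _).trans (hB x y (abs_le_max_abs_abs hx.1 hx.2) y2)
  have hl := hle x hx y y1
  rcases eq_or_ne (P.integrand w (x + y * Complex.I)) 0 with h0 | h0
  · rw [h0, norm_zero]; positivity
  rw [← Real.log_le_log_iff (norm_pos_iff.2 h0) (by positivity), Real.log_mul (Real.exp_ne_zero _)
    (by positivity), Real.log_exp, Real.log_rpow hyp]
  simp only at hb
  linarith

end FoxBarnes

/-! ### Absolute convergence and change of the line -/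

namespace FoxBarnes

variable {p q : ℕ}

theorem re_pos_of_A_lt (P : FoxBarnes p q) {c : ℝ} (h : P.A < (c : EReal)) {i : Fin p}
    (hi : i ∈ P.upDen) : 0 < (P.a i).re + P.α i * c := by
  have h1 := lt_of_le_of_lt (Finset.le_sup (f := fun i => ((-((P.a i).re / P.α i) : ℝ) : EReal)) hi) h
  have h2 : -((P.a i).re / P.α i) < c := by exact_mod_cast h1
  have h3 := P.hα i
  rw [← neg_div, div_lt_iff₀ h3] at h2
  linarith

theorem re_pos_of_lt_B (P : FoxBarnes p q) {c : ℝ} (h : (c : EReal) < P.B) {i : Fin q}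
    (hi : i ∈ P.lowDen) : 0 < 1 + P.τ - (P.b i).re - P.β i * c := by
  have h1 := lt_of_lt_of_le h
    (Finset.inf_le (f := fun i => (((1 + P.τ - (P.b i).re) / P.β i : ℝ) : EReal)) hi)
  have h2 : c < (1 + P.τ - (P.b i).re) / P.β i := by exact_mod_cast h1
  have h3 := P.hβ i
  rw [lt_div_iff₀ h3] at h2
  linarith

theorem quot_den_ne_zero (P : FoxBarnes p q) {s : ℂ} (hA : P.A < (s.re : EReal))
    (hB : (s.re : EReal) < P.B) :
    (∏ i ∈ P.lowDen, doubleGamma P.τ (1 + P.τ - P.b i - P.β i * s)) *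
      (∏ i ∈ P.upDen, doubleGamma P.τ (P.a i + P.α i * s)) ≠ 0 := by
  refine mul_ne_zero (Finset.prod_ne_zero_iff.2 fun i hi => ?_)
    (Finset.prod_ne_zero_iff.2 fun i hi => ?_)
  · refine doubleGamma_ne_zero P.hτ (ne_zero_of_re_pos P.hτ ?_)
    simpa using P.re_pos_of_lt_B hB hi
  · refine doubleGamma_ne_zero P.hτ (ne_zero_of_re_pos P.hτ ?_)
    simpa using P.re_pos_of_A_lt hA hi

theorem differentiableAt_integrand (P : FoxBarnes p q) (w : ℂ) {s : ℂ} (hA : P.A < (s.re : EReal))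
    (hB : (s.re : EReal) < P.B) : DifferentiableAt ℂ (P.integrand w) s := by
  have hG : Differentiable ℂ (doubleGamma P.τ) := differentiable_doubleGamma P.hτ
  have h1 : ∀ (B β : ℂ), DifferentiableAt ℂ (fun s => doubleGamma P.τ (B + β * s)) s := fun B β =>
    (hG.comp (by fun_prop : Differentiable ℂ fun s : ℂ => B + β * s)).differentiableAt
  have h2 : ∀ (B β : ℂ), DifferentiableAt ℂ (fun s => doubleGamma P.τ (B - β * s)) s := fun B β =>
    (hG.comp (by fun_prop : Differentiable ℂ fun s : ℂ => B - β * s)).differentiableAt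
  have hq : DifferentiableAt ℂ P.quot s := by
    refine DifferentiableAt.fun_div ?_ ?_ (P.quot_den_ne_zero hA hB)
    · exact (DifferentiableAt.fun_finsetProd fun i _ => h1 _ _).mul
        (DifferentiableAt.fun_finsetProd fun i _ => h2 _ _)
    · exact (DifferentiableAt.fun_finsetProd fun i _ => h2 _ _).mul
        (DifferentiableAt.fun_finsetProd fun i _ => h1 _ _)
  exact (hq.mul (by fun_prop)).mul (by fun_prop)

theorem continuous_integrand_vertical (P : FoxBarnes p q) (w : ℂ) {c : ℝ} (hA : P.A < (c : EReal))
    (hB : (c : EReal) < P.B) : Continuous fun y : ℝ => P.integrand w (c + y * Complex.I) := by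
  refine continuous_iff_continuousAt.2 fun y => ?_
  have h := (P.differentiableAt_integrand w (s := c + y * Complex.I) (by simpa using hA)
    (by simpa using hB)).continuousAt
  exact ContinuousAt.comp (f := fun y : ℝ => (c + y * Complex.I : ℂ)) h (by fun_prop)

/-- A vertical-line condition gives absolute convergence of the defining integral. -/
theorem converges_of_VL (P : FoxBarnes p q) {w : ℂ} {c : ℝ} (hA : P.A < (c : EReal))
    (hB : (c : EReal) < P.B) (h : P.VL c w.im) : P.Converges c w := by
  obtain ⟨δ, hδ, C, Y, hY, hle⟩ := P.exists_norm_integrand_le w h h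
  have hg : Integrable fun y : ℝ => (1 + ‖y‖) ^ (-(1 + δ)) :=
    integrable_one_add_norm (by simp; linarith)
  refine (P.continuous_integrand_vertical w hA hB).locallyIntegrable.integrable_of_isBigO_cocompact
    (g := fun y : ℝ => (1 + ‖y‖) ^ (-(1 + δ))) ?_ (hg.integrableAtFilter _)
  refine Asymptotics.IsBigO.of_bound (|C| * (2 : ℝ) ^ (1 + δ)) ?_
  have hev : ∀ᶠ y : ℝ in cocompact ℝ, Y ≤ ‖y‖ := tendsto_norm_cocompact_atTop.eventually_ge_atTop Y
  filter_upwards [hev] with y hy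
  rw [Real.norm_eq_abs] at hy
  have hy0 : 0 < |y| := by linarith
  refine (hle c ⟨le_rfl, le_rfl⟩ y hy).trans ?_
  rw [Real.norm_of_nonneg (by positivity), Real.norm_eq_abs, mul_assoc]
  have h1 : |y| ^ (-(1 + δ)) ≤ (2 : ℝ) ^ (1 + δ) * (1 + |y|) ^ (-(1 + δ)) := by
    have h2 : ((1 + |y|) / 2) ^ (-(1 + δ)) = (2 : ℝ) ^ (1 + δ) * (1 + |y|) ^ (-(1 + δ)) := by
      rw [Real.div_rpow (by positivity) two_pos.le, Real.rpow_neg two_pos.le, div_inv_eq_mul, mul_comm]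
    rw [← h2]
    exact Real.rpow_le_rpow_of_nonpos (by positivity) (by linarith) (by linarith)
  exact mul_le_mul (le_abs_self C) h1 (by positivity) (abs_nonneg C)

theorem integral_integrand_eq_of_le (P : FoxBarnes p q) {w : ℂ} {c₁ c₂ : ℝ} (hc : c₁ ≤ c₂)
    (hA : P.A < (c₁ : EReal)) (hB : (c₂ : EReal) < P.B) (h₁ : P.VL c₁ w.im) (h₂ : P.VL c₂ w.im) :
    ∫ y : ℝ, P.integrand w (c₁ + y * Complex.I) = ∫ y : ℝ, P.integrand w (c₂ + y * Complex.I) := by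
  have hc' : (c₁ : EReal) ≤ c₂ := by exact_mod_cast hc
  obtain ⟨δ, hδ, C, Y, hY, hle⟩ := P.exists_norm_integrand_le w h₁ h₂
  have i1 : Integrable fun y : ℝ => P.integrand w (c₁ + y * Complex.I) :=
    P.converges_of_VL hA (hc'.trans_lt hB) h₁
  have i2 : Integrable fun y : ℝ => P.integrand w (c₂ + y * Complex.I) :=
    P.converges_of_VL (hA.trans_le hc') hB h₂
  have l1 := intervalIntegral_tendsto_integral i1 tendsto_neg_atTop_atBot tendsto_id
  have l2 := intervalIntegral_tendsto_integral i2 tendsto_neg_atTop_atBot tendsto_id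
  -- the horizontal sides of the rectangle vanish in the limit
  have hpow : Tendsto (fun T : ℝ => C * T ^ (-(1 + δ)) * |c₂ - c₁|) atTop (𝓝 0) := by
    have := ((tendsto_rpow_neg_atTop (show 0 < 1 + δ by linarith)).const_mul C).mul_const |c₂ - c₁|
    simpa using this
  have hhor : ∀ σ : ℝ, |σ| = 1 → Tendsto (fun T : ℝ =>
      ∫ x in c₁..c₂, P.integrand w (x + (σ * T : ℝ) * Complex.I)) atTop (𝓝 0) := by
    intro σ hσ
    refine squeeze_zero_norm' ?_ hpow
    filter_upwards [eventually_ge_atTop Y] with T hT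
    refine intervalIntegral.norm_integral_le_of_norm_le_const fun x hx => ?_
    rw [Set.uIoc_of_le hc] at hx
    have habs : |σ * T| = T := by rw [abs_mul, hσ, one_mul, abs_of_nonneg (by linarith)]
    have := hle x ⟨hx.1.le, hx.2⟩ (σ * T) (by rw [habs]; exact hT)
    rwa [habs] at this
  have hrect : ∀ T : ℝ, (∫ x in c₁..c₂, P.integrand w (x + (-1 * T : ℝ) * Complex.I)) -
      (∫ x in c₁..c₂, P.integrand w (x + (1 * T : ℝ) * Complex.I)) +
      Complex.I • (∫ y in (-T)..T, P.integrand w (c₂ + y * Complex.I)) -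
      Complex.I • (∫ y in (-T)..T, P.integrand w (c₁ + y * Complex.I)) = 0 := by
    intro T
    have := Complex.integral_boundary_rect_eq_zero_of_differentiableOn (P.integrand w)
      ((c₁ : ℂ) + ((-T : ℝ) : ℂ) * Complex.I) ((c₂ : ℂ) + (T : ℂ) * Complex.I) (fun s hs => by
        have hs1 := hs.1
        simp [Set.uIcc_of_le hc] at hs1
        refine (P.differentiableAt_integrand w ?_ ?_).differentiableWithinAt
        · exact hA.trans_le (by exact_mod_cast hs1.1)
        · exact lt_of_le_of_lt (by exact_mod_cast hs1.2) hB)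
    simpa using this
  have hlim := (((hhor (-1) (by simp)).sub (hhor 1 (by simp))).add (l2.const_smul Complex.I)).sub
    (l1.const_smul Complex.I)
  have h0 := tendsto_nhds_unique hlim (tendsto_const_nhds.congr fun T => (hrect T).symm)
  simp only [sub_zero, zero_add, sub_eq_zero, smul_eq_mul] at h0
  exact (mul_left_cancel₀ Complex.I_ne_zero h0).symm

/-- The Fox-Barnes function does not depend on the admissible line. -/
theorem value_eq_value (P : FoxBarnes p q) {w : ℂ} {c₁ c₂ : ℝ}
    (hA₁ : P.A < (c₁ : EReal)) (hB₁ : (c₁ : EReal) < P.B) (hA₂ : P.A < (c₂ : EReal))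
    (hB₂ : (c₂ : EReal) < P.B) (h₁ : P.VL c₁ w.im) (h₂ : P.VL c₂ w.im) :
    P.value c₁ w = P.value c₂ w := by
  rw [value, value, integral_mul_const, integral_mul_const]
  rcases le_total c₁ c₂ with h | h
  · rw [P.integral_integrand_eq_of_le h hA₁ hB₂ h₁ h₂]
  · rw [P.integral_integrand_eq_of_le h hA₂ hB₁ h₂ h₁]

end FoxBarnes

/-! ### Parameters of the Laplace transform -/

theorem Fin.filter_val_lt_castSucc {m q : ℕ} (h : m ≤ q) :
    (Finset.univ.filter fun i : Fin (q + 1) => (i : ℕ) < m) =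
      (Finset.univ.filter fun i : Fin q => (i : ℕ) < m).map Fin.castSuccEmb := by
  ext i
  refine Fin.lastCases ?_ (fun i => ?_) i
  · simp [h]
  · simp

theorem Fin.filter_le_val_castSucc {m q : ℕ} (h : m ≤ q) :
    (Finset.univ.filter fun i : Fin (q + 1) => m ≤ (i : ℕ)) =
      insert (Fin.last q) ((Finset.univ.filter fun i : Fin q => m ≤ (i : ℕ)).map Fin.castSuccEmb) := by
  ext i
  refine Fin.lastCases ?_ (fun i => ?_) i
  · simp [h]
  · simp [Fin.castSucc_ne_last]

theorem Fin.filter_val_lt_succ (n p : ℕ) :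
    (Finset.univ.filter fun i : Fin (p + 1) => (i : ℕ) < n + 1) =
      insert 0 ((Finset.univ.filter fun i : Fin p => (i : ℕ) < n).map (Fin.succEmb p)) := by
  ext i
  refine Fin.cases ?_ (fun i => ?_) i
  · simp
  · simp [Fin.succ_ne_zero]

theorem Fin.filter_le_val_succ (n p : ℕ) :
    (Finset.univ.filter fun i : Fin (p + 1) => n + 1 ≤ (i : ℕ)) =
      (Finset.univ.filter fun i : Fin p => n ≤ (i : ℕ)).map (Fin.succEmb p) := by
  ext i
  refine Fin.cases ?_ (fun i => ?_) i
  · simp [Fin.succ_ne_zero]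
  · simp

namespace FoxBarnes

variable {p q : ℕ} (P : FoxBarnes p q) {ν : ℝ} (hν : 0 < ν)

theorem laplaceParams_lowNum :
    (P.laplaceParams ν hν).lowNum = P.lowNum.map Fin.castSuccEmb := Fin.filter_val_lt_castSucc P.hm

theorem laplaceParams_lowDen :
    (P.laplaceParams ν hν).lowDen = insert (Fin.last q) (P.lowDen.map Fin.castSuccEmb) :=
  Fin.filter_le_val_castSucc P.hm

theorem laplaceParams_upNum :
    (P.laplaceParams ν hν).upNum = insert 0 (P.upNum.map (Fin.succEmb p)) :=
  Fin.filter_val_lt_succ P.n p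

theorem laplaceParams_upDen :
    (P.laplaceParams ν hν).upDen = P.upDen.map (Fin.succEmb p) := Fin.filter_le_val_succ P.n p

theorem laplaceParamsInv_lowNum :
    (P.laplaceParamsInv ν hν).lowNum = insert 0 (P.upNum.map (Fin.succEmb p)) :=
  Fin.filter_val_lt_succ P.n p

theorem laplaceParamsInv_lowDen :
    (P.laplaceParamsInv ν hν).lowDen = P.upDen.map (Fin.succEmb p) := Fin.filter_le_val_succ P.n p

theorem laplaceParamsInv_upNum :
    (P.laplaceParamsInv ν hν).upNum = P.lowNum.map Fin.castSuccEmb := Fin.filter_val_lt_castSucc P.hm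

theorem laplaceParamsInv_upDen :
    (P.laplaceParamsInv ν hν).upDen = insert (Fin.last q) (P.lowDen.map Fin.castSuccEmb) :=
  Fin.filter_le_val_castSucc P.hm

theorem last_notMem (s : Finset (Fin q)) : Fin.last q ∉ s.map Fin.castSuccEmb := by
  simp [Fin.castSucc_ne_last]

theorem zero_notMem (s : Finset (Fin p)) : (0 : Fin (p + 1)) ∉ s.map (Fin.succEmb p) := by
  simp [Fin.succ_ne_zero]

theorem laplaceParams_A : (P.laplaceParams ν hν).A = P.A := by
  rw [A, laplaceParams_upDen, Finset.sup_map]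
  rfl

theorem laplaceParams_B :
    (P.laplaceParams ν hν).B = min ((1 / ν : ℝ) : EReal) P.B := by
  rw [B, laplaceParams_lowDen, Finset.inf_insert, Finset.inf_map]
  congr 1
  · simp [laplaceParams]
  · simp [B, laplaceParams, Function.comp_def]

theorem Delta_laplaceParams (k : ℕ) : (P.laplaceParams ν hν).Delta k = P.Delta k := by
  rw [Delta, Delta, laplaceParams_lowNum, laplaceParams_lowDen, laplaceParams_upNum,
    laplaceParams_upDen, Finset.sum_insert (last_notMem _), Finset.sum_insert (zero_notMem _)]
  simp only [Finset.sum_map, laplaceParams]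
  simp
  ring

theorem Theta_laplaceParams (k : ℕ) : (P.laplaceParams ν hν).Theta k = P.Theta k := by
  rw [Theta, Theta, laplaceParams_lowNum, laplaceParams_lowDen, laplaceParams_upNum,
    laplaceParams_upDen, Finset.sum_insert (last_notMem _), Finset.sum_insert (zero_notMem _)]
  simp only [Finset.sum_map, laplaceParams]
  simp
  ring

theorem Omega_laplaceParams (k : ℕ) : (P.laplaceParams ν hν).Omega k = P.Omega k := by
  rw [Omega, Omega, laplaceParams_lowDen, laplaceParams_upNum,
    Finset.sum_insert (last_notMem _), Finset.sum_insert (zero_notMem _)]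
  simp only [Finset.sum_map, laplaceParams]
  simp

theorem PiSum_laplaceParams : (P.laplaceParams ν hν).PiSum = P.PiSum - P.τ * ν := by
  rw [PiSum, PiSum, laplaceParams_lowNum, laplaceParams_lowDen, laplaceParams_upNum,
    laplaceParams_upDen, Finset.sum_insert (last_notMem _), Finset.sum_insert (zero_notMem _)]
  simp only [Finset.sum_map, laplaceParams]
  simp
  ring

theorem Lambda_laplaceParams :
    (P.laplaceParams ν hν).Lambda = P.Lambda - P.τ * ν * (Real.log ν : ℂ) := by
  rw [Lambda, Lambda, laplaceParams_lowNum, laplaceParams_lowDen, laplaceParams_upNum,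
    laplaceParams_upDen, Finset.sum_insert (last_notMem _), Finset.sum_insert (zero_notMem _)]
  simp only [Finset.sum_map, laplaceParams]
  simp
  ring

theorem Upsilon_laplaceParams : (P.laplaceParams ν hν).Upsilon = P.Upsilon + P.τ * ν := by
  rw [Upsilon, Upsilon, laplaceParams_lowDen, laplaceParams_upNum,
    Finset.sum_insert (last_notMem _), Finset.sum_insert (zero_notMem _)]
  simp only [Finset.sum_map, laplaceParams]
  simp
  ring

theorem Phi_laplaceParams (c : ℝ) :
    (P.laplaceParams ν hν).Phi1 c + 2 * (P.laplaceParams ν hν).Phi3 c =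
      P.Phi1 c + 2 * P.Phi3 c + ν := by
  have hτ := P.hτ.ne'
  have h1 : (P.laplaceParams ν hν).τ = P.τ := rfl
  simp only [Phi1, Phi3, kap, Delta_laplaceParams, Omega_laplaceParams, PiSum_laplaceParams,
    Upsilon_laplaceParams, h1, Complex.sub_re, Complex.add_re, Complex.re_ofReal_mul, Complex.ofReal_re]
  field_simp
  ring

theorem Lambda_im_laplaceParams : (P.laplaceParams ν hν).Lambda.im = P.Lambda.im := by
  rw [Lambda_laplaceParams, Complex.sub_im, ← Complex.ofReal_mul, ← Complex.ofReal_mul,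
    Complex.ofReal_im, sub_zero]

theorem VLBalanced_laplaceParams (h : P.VLBalanced) : (P.laplaceParams ν hν).VLBalanced := by
  obtain ⟨h1, h2, h3, h4, h5⟩ := h
  refine ⟨by rw [Delta_laplaceParams, h1], ?_, by rw [Omega_laplaceParams, h3], h4, ?_⟩
  · rw [Theta_laplaceParams]; exact h2
  · rw [PiSum_laplaceParams, Complex.sub_im, ← Complex.ofReal_mul, Complex.ofReal_im, h5, sub_zero]

/-- The factor `Γ(1 - ν s)` widens the sector of convergence by `ν π / 2` on each side, so that the
Laplace transform never falls into condition 4. -/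
theorem VL1_or_VL2_or_VL3_laplaceParams {c θ φ : ℝ} (h : P.VL c θ) (hφ : |φ| < Real.pi / 2)
    (c₁ : ℝ) : (P.laplaceParams ν hν).VL1 ∨ (P.laplaceParams ν hν).VL2 ∨
      (P.laplaceParams ν hν).VL3 c₁ (θ - ν * φ) := by
  have h3 : P.VLBalanced → 0 ≤ P.Phi1 c + 2 * P.Phi3 c →
      |θ - P.Lambda.im / P.τ| ≤ (P.Phi1 c + 2 * P.Phi3 c) * Real.pi / 2 →
      (P.laplaceParams ν hν).VL3 c₁ (θ - ν * φ) := by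
    intro hb h0 hle
    have e : (P.laplaceParams ν hν).Phi1 c₁ + 2 * (P.laplaceParams ν hν).Phi3 c₁ =
        P.Phi1 c + 2 * P.Phi3 c + ν := by
      rw [Phi_laplaceParams, P.Phi1_eq_of_Delta_eq_zero hb.1 c₁ c,
        P.Phi3_eq_of_Omega_eq_zero hb.2.2.1 c₁ c]
    refine ⟨P.VLBalanced_laplaceParams hν hb, by rw [e]; linarith, ?_⟩
    rw [e, Lambda_im_laplaceParams]
    have h1 : (P.laplaceParams ν hν).τ = P.τ := rfl
    rw [h1, show θ - ν * φ - P.Lambda.im / P.τ = (θ - P.Lambda.im / P.τ) - ν * φ by ring]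
    refine (abs_sub _ _).trans_lt ?_
    rw [abs_mul, abs_of_pos hν]
    nlinarith
  rcases h with h | h | h | h
  · left
    rw [VL1, Delta_laplaceParams]; exact h
  · right; left
    refine ⟨by rw [Delta_laplaceParams]; exact h.1, ?_⟩
    rw [Theta_laplaceParams]; exact h.2
  · exact Or.inr (Or.inr (h3 h.1 h.2.1.le h.2.2.le))
  · refine Or.inr (Or.inr (h3 h.1 h.2.1.ge ?_))
    rw [h.2.1, h.2.2.1]; simp

theorem VL_laplaceParams {c θ φ : ℝ} (h : P.VL c θ) (hφ : |φ| < Real.pi / 2) (c₁ : ℝ) :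
    (P.laplaceParams ν hν).VL c₁ (θ - ν * φ) := by
  rcases P.VL1_or_VL2_or_VL3_laplaceParams hν h hφ c₁ with h | h | h
  exacts [Or.inl h, Or.inr (Or.inl h), Or.inr (Or.inr (Or.inl h))]

theorem quot_laplaceParams (s : ℂ) :
    (P.laplaceParams ν hν).quot s =
      P.quot s * (doubleGamma P.τ (1 - ν * s + P.τ) / doubleGamma P.τ (1 - ν * s)) := by
  rw [quot, quot, laplaceParams_lowNum, laplaceParams_lowDen, laplaceParams_upNum,
    laplaceParams_upDen, Finset.prod_insert (last_notMem _), Finset.prod_insert (zero_notMem _)]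
  simp only [Finset.prod_map, laplaceParams]
  simp only [Fin.coe_castSuccEmb, Fin.snoc_castSucc, Fin.snoc_last, Fin.cons_zero, Fin.coe_succEmb,
    Fin.cons_succ, sub_zero]
  rw [show 1 + (P.τ : ℂ) - ν * s = 1 - ν * s + P.τ by ring,
    show 1 + (P.τ : ℂ) - P.τ - ν * s = 1 - ν * s by ring, mul_left_comm, mul_assoc, mul_div_mul_comm,
    mul_comm]

theorem quot_laplaceParamsInv (s : ℂ) :
    (P.laplaceParamsInv ν hν).quot s = (P.laplaceParams ν hν).quot (-s) := by
  rw [quot_laplaceParams, quot, quot, laplaceParamsInv_lowNum, laplaceParamsInv_lowDen,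
    laplaceParamsInv_upNum, laplaceParamsInv_upDen, Finset.prod_insert (last_notMem _),
    Finset.prod_insert (zero_notMem _)]
  simp only [Finset.prod_map, laplaceParamsInv]
  simp only [Fin.coe_castSuccEmb, Fin.snoc_castSucc, Fin.snoc_last, Fin.cons_zero, Fin.coe_succEmb,
    Fin.cons_succ]
  have e1 : ∀ x y : ℂ, 1 + (P.τ : ℂ) - (1 + P.τ - x) - y * s = x + y * -s := fun x y => by ring
  have e2 : ∀ x y : ℂ, 1 + (P.τ : ℂ) - x + y * s = 1 + P.τ - x - y * -s := fun x y => by ring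
  simp only [e1, e2]
  rw [show 1 + (P.τ : ℂ) + ν * s = 1 - ν * -s + P.τ by ring, show 1 + (ν : ℂ) * s = 1 - ν * -s by ring]
  rw [div_mul_div_comm]
  congr 1 <;> ring

theorem integrand_laplaceParamsInv (w s : ℂ) :
    (P.laplaceParamsInv ν hν).integrand w s = (P.laplaceParams ν hν).integrand (-w) (-s) := by
  rw [integrand, integrand, quot_laplaceParamsInv]
  have h1 : (P.laplaceParamsInv ν hν).τ = (P.laplaceParams ν hν).τ := rfl
  have h2 : (P.laplaceParamsInv ν hν).ε = (P.laplaceParams ν hν).ε := rfl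
  rw [h1, h2, neg_sq, neg_mul_neg]

theorem integrand_laplaceParamsInv_vertical (w : ℂ) (c y : ℝ) :
    (P.laplaceParamsInv ν hν).integrand w (c + y * Complex.I) =
      (P.laplaceParams ν hν).integrand (-w) (((-c : ℝ) : ℂ) + ((-y : ℝ) : ℂ) * Complex.I) := by
  rw [integrand_laplaceParamsInv]; congr 1; push_cast; ring

theorem converges_laplaceParamsInv {c : ℝ} {w : ℂ} (h : (P.laplaceParams ν hν).Converges (-c) (-w)) :
    (P.laplaceParamsInv ν hν).Converges c w := by
  have := Integrable.comp_neg h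
  simp only [Converges, integrand_laplaceParamsInv_vertical]
  exact this

theorem value_laplaceParamsInv (c : ℝ) (w : ℂ) :
    (P.laplaceParamsInv ν hν).value c w = (P.laplaceParams ν hν).value (-c) (-w) := by
  simp only [value, integrand_laplaceParamsInv_vertical]
  rw [integral_neg_eq_self (fun y : ℝ => (P.laplaceParams ν hν).integrand (-w)
    (((-c : ℝ) : ℂ) + (y : ℂ) * Complex.I) * Complex.I)]

theorem coe_lt_coe_div_iff (x c a : ℝ) (ha : 0 < a) :
    ((-(x / a) : ℝ) : EReal) < c ↔ 0 < x + a * c := by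
  rw [EReal.coe_lt_coe_iff, ← neg_div, div_lt_iff₀ ha]
  constructor <;> intro h <;> linarith

theorem A_lt_coe_iff (c : ℝ) : P.A < (c : EReal) ↔ ∀ i ∈ P.upDen, 0 < (P.a i).re + P.α i * c := by
  refine ⟨fun h i hi => P.re_pos_of_A_lt h hi, fun h => ?_⟩
  refine (Finset.sup_lt_iff (EReal.bot_lt_coe c)).2 fun i hi => ?_
  exact (coe_lt_coe_div_iff _ _ _ (P.hα i)).2 (h i hi)

theorem coe_lt_B_iff (c : ℝ) :
    (c : EReal) < P.B ↔ ∀ i ∈ P.lowDen, 0 < 1 + P.τ - (P.b i).re - P.β i * c := by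
  refine ⟨fun h i hi => P.re_pos_of_lt_B h hi, fun h => ?_⟩
  refine (Finset.lt_inf_iff (EReal.coe_lt_top c)).2 fun i hi => ?_
  rw [EReal.coe_lt_coe_iff, lt_div_iff₀ (P.hβ i)]
  linarith [h i hi]

theorem laplaceParamsInv_A_lt_iff (c : ℝ) :
    (P.laplaceParamsInv ν hν).A < (c : EReal) ↔ ((-c : ℝ) : EReal) < (P.laplaceParams ν hν).B := by
  rw [A_lt_coe_iff, coe_lt_B_iff, laplaceParamsInv_upDen, laplaceParams_lowDen]
  simp only [Finset.forall_mem_insert, Finset.forall_mem_map, laplaceParams, laplaceParamsInv]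
  simp

theorem lt_laplaceParamsInv_B_iff (c : ℝ) :
    (c : EReal) < (P.laplaceParamsInv ν hν).B ↔ (P.laplaceParams ν hν).A < ((-c : ℝ) : EReal) := by
  rw [A_lt_coe_iff, coe_lt_B_iff, laplaceParamsInv_lowDen, laplaceParams_upDen]
  simp only [Finset.forall_mem_map, laplaceParams, laplaceParamsInv]
  simp

end FoxBarnes

/-! ### Parameters of the reflected function -/

namespace FoxBarnes

variable {p q : ℕ} (P : FoxBarnes p q) {ν : ℝ} (hν : 0 < ν)

theorem Delta_laplaceParamsInv (k : ℕ) :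
    (P.laplaceParamsInv ν hν).Delta k = (P.laplaceParams ν hν).Delta k := by
  rw [Delta_laplaceParams, Delta, Delta, laplaceParamsInv_lowNum, laplaceParamsInv_lowDen,
    laplaceParamsInv_upNum, laplaceParamsInv_upDen, Finset.sum_insert (last_notMem _),
    Finset.sum_insert (zero_notMem _)]
  simp only [Finset.sum_map, laplaceParamsInv]
  simp
  ring

theorem Theta_laplaceParamsInv (k : ℕ) :
    (P.laplaceParamsInv ν hν).Theta k = (P.laplaceParams ν hν).Theta k := by
  rw [Theta_laplaceParams, Theta, Theta, laplaceParamsInv_lowNum, laplaceParamsInv_lowDen,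
    laplaceParamsInv_upNum, laplaceParamsInv_upDen, Finset.sum_insert (last_notMem _),
    Finset.sum_insert (zero_notMem _)]
  simp only [Finset.sum_map, laplaceParamsInv]
  simp
  ring

theorem Omega_laplaceParamsInv (k : ℕ) :
    (P.laplaceParamsInv ν hν).Omega k =
      (P.laplaceParams ν hν).Delta k - (P.laplaceParams ν hν).Omega k := by
  rw [Delta_laplaceParams, Omega_laplaceParams, Omega, Omega, Delta, laplaceParamsInv_lowDen,
    laplaceParamsInv_upNum]
  simp only [Finset.sum_map, laplaceParamsInv]
  simp
  ring

theorem PiSum_laplaceParamsInv :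
    (P.laplaceParamsInv ν hν).PiSum =
      (1 + P.τ) * (P.laplaceParams ν hν).Delta 1 - (P.laplaceParams ν hν).PiSum := by
  rw [Delta_laplaceParams, PiSum_laplaceParams, PiSum, PiSum, Delta, laplaceParamsInv_lowNum,
    laplaceParamsInv_lowDen, laplaceParamsInv_upNum, laplaceParamsInv_upDen,
    Finset.sum_insert (last_notMem _), Finset.sum_insert (zero_notMem _)]
  simp only [Finset.sum_map, laplaceParamsInv]
  simp [sub_mul, Finset.sum_sub_distrib, ← Finset.mul_sum]
  ring

theorem Lambda_laplaceParamsInv :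
    (P.laplaceParamsInv ν hν).Lambda =
      (1 + P.τ) * (P.laplaceParams ν hν).Theta 1 - (P.laplaceParams ν hν).Lambda := by
  rw [Theta_laplaceParams, Lambda_laplaceParams, Lambda, Lambda, Theta, laplaceParamsInv_lowNum,
    laplaceParamsInv_lowDen, laplaceParamsInv_upNum, laplaceParamsInv_upDen,
    Finset.sum_insert (last_notMem _), Finset.sum_insert (zero_notMem _)]
  simp only [Finset.sum_map, laplaceParamsInv]
  simp [sub_mul, mul_assoc, Finset.sum_sub_distrib, ← Finset.mul_sum]
  ring

theorem Upsilon_laplaceParamsInv :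
    (P.laplaceParamsInv ν hν).Upsilon =
      (1 + P.τ) * ((P.laplaceParams ν hν).Omega 1 - (P.laplaceParams ν hν).Delta 1)
        + (P.laplaceParams ν hν).PiSum + (P.laplaceParams ν hν).Upsilon := by
  rw [Delta_laplaceParams, PiSum_laplaceParams, Upsilon_laplaceParams, Omega_laplaceParams, Upsilon,
    Upsilon, PiSum, Delta, Omega, laplaceParamsInv_lowDen, laplaceParamsInv_upNum]
  simp only [Finset.sum_map, laplaceParamsInv]
  simp [sub_mul, Finset.sum_sub_distrib, ← Finset.mul_sum]
  ring

theorem Phi_laplaceParamsInv (c : ℝ) :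
    (P.laplaceParamsInv ν hν).Phi1 c + 2 * (P.laplaceParamsInv ν hν).Phi3 c =
      (P.laplaceParams ν hν).Phi1 (-c) + 2 * (P.laplaceParams ν hν).Phi3 (-c) := by
  have hτ := P.hτ.ne'
  have h1 : (P.laplaceParamsInv ν hν).τ = P.τ := rfl
  have h2 : (P.laplaceParams ν hν).τ = P.τ := rfl
  simp only [Phi1, Phi3, kap, Delta_laplaceParamsInv, Omega_laplaceParamsInv, PiSum_laplaceParamsInv,
    Upsilon_laplaceParamsInv, h1, h2, Complex.sub_re, Complex.add_re, ← Complex.ofReal_one,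
    ← Complex.ofReal_add, ← Complex.ofReal_sub, ← Complex.ofReal_mul, Complex.ofReal_re]
  field_simp
  ring

/-- The substitution `s ↦ -s` preserves the vertical-line conditions. -/
theorem VL_laplaceParamsInv {c θ φ : ℝ} (h : P.VL c θ) (hφ : |φ| < Real.pi / 2) (c₂ : ℝ) :
    (P.laplaceParamsInv ν hν).VL c₂ (ν * φ - θ) := by
  have e1 := P.Delta_laplaceParamsInv hν 2
  have e2 := P.Theta_laplaceParamsInv hν 2
  rcases P.VL1_or_VL2_or_VL3_laplaceParams hν h hφ (-c₂) with h | h | ⟨⟨h1, h2, h3, h4, h5⟩, h6, h7⟩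
  · exact Or.inl (by rw [VL1, e1]; exact h)
  · exact Or.inr (Or.inl ⟨e1.trans h.1, by rw [e2]; exact h.2⟩)
  · refine Or.inr (Or.inr (Or.inl ⟨⟨e1.trans h1, by rw [e2]; exact h2, ?_, h4, ?_⟩, ?_, ?_⟩))
    · rw [Omega_laplaceParamsInv, h1, h3, sub_zero]
    · rw [PiSum_laplaceParamsInv, Complex.sub_im, h5, ← Complex.ofReal_one, ← Complex.ofReal_add,
        ← Complex.ofReal_mul, Complex.ofReal_im, sub_zero]
    · rw [Phi_laplaceParamsInv]; exact h6
    · rw [Phi_laplaceParamsInv, Lambda_laplaceParamsInv, Complex.sub_im, ← Complex.ofReal_one,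
        ← Complex.ofReal_add, ← Complex.ofReal_mul, Complex.ofReal_im, zero_sub, ← abs_neg]
      convert h7 using 2
      have : (P.laplaceParamsInv ν hν).τ = (P.laplaceParams ν hν).τ := rfl
      rw [this]
      ring

theorem laplaceParams_A_lt_B (hAB : P.A < P.B) (hAν : P.A < ((1 / ν : ℝ) : EReal)) :
    (P.laplaceParams ν hν).A < (P.laplaceParams ν hν).B := by
  rw [laplaceParams_A, laplaceParams_B]
  exact lt_min hAν hAB

theorem laplaceParamsInv_A_lt_B (hAB : P.A < P.B) (hAν : P.A < ((1 / ν : ℝ) : EReal)) :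
    (P.laplaceParamsInv ν hν).A < (P.laplaceParamsInv ν hν).B := by
  obtain ⟨c, h1, h2⟩ := EReal.lt_iff_exists_real_btwn.1 (P.laplaceParams_A_lt_B hν hAB hAν)
  exact ((P.laplaceParamsInv_A_lt_iff hν (-c)).2 (by rwa [neg_neg])).trans
    ((P.lt_laplaceParamsInv_B_iff hν (-c)).2 (by rwa [neg_neg]))

end FoxBarnes

/-! ### Euler's integral and the interchange of integrations -/

theorem Complex.norm_cpow_mul_exp_neg_mul {a z : ℂ} {t : ℝ} (ht : 0 < t) :
    ‖(t : ℂ) ^ a * Complex.exp (-(z * t))‖ = t ^ a.re * Real.exp (-z.re * t ^ (1 : ℝ)) := by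
  rw [norm_mul, Complex.norm_cpow_eq_rpow_re_of_pos ht, Complex.norm_exp, Real.rpow_one]
  simp

theorem Complex.aestronglyMeasurable_cpow_mul_exp_neg_mul (a z : ℂ) :
    AEStronglyMeasurable (fun t : ℝ => (t : ℂ) ^ a * Complex.exp (-(z * t)))
      (volume.restrict (Set.Ioi 0)) := by
  refine ContinuousOn.aestronglyMeasurable (fun t ht => ?_) measurableSet_Ioi
  refine ContinuousAt.continuousWithinAt (ContinuousAt.mul ?_ (by fun_prop))
  exact Complex.continuousAt_ofReal_cpow_const _ _ (Or.inr (ne_of_gt ht))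

/-- Euler's integral with a complex rate `z`, `Re z > 0`, obtained from real rates by the identity
principle. -/
theorem Complex.integral_cpow_mul_exp_neg_mul_Ioi_of_re_pos {a z : ℂ} (ha : 0 < a.re)
    (hz : 0 < z.re) :
    ∫ t in Set.Ioi (0 : ℝ), (t : ℂ) ^ (a - 1) * Complex.exp (-(z * t)) =
      (1 / z) ^ a * Complex.Gamma a := by
  have hU : IsOpen {z : ℂ | 0 < z.re} := isOpen_lt continuous_const Complex.continuous_re
  have hint : ∀ {b z : ℂ}, -1 < b.re → 0 < z.re →
      IntegrableOn (fun t : ℝ => (t : ℂ) ^ b * Complex.exp (-(z * t))) (Set.Ioi 0) := by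
    intro b z hb hz
    refine (integrableOn_rpow_mul_exp_neg_mul_rpow hb one_pos hz).mono'
      (Complex.aestronglyMeasurable_cpow_mul_exp_neg_mul b z) ?_
    filter_upwards [ae_restrict_mem measurableSet_Ioi] with t ht
    exact (Complex.norm_cpow_mul_exp_neg_mul ht).le
  have hF : DifferentiableOn ℂ (fun z : ℂ => ∫ t in Set.Ioi (0 : ℝ),
      (t : ℂ) ^ (a - 1) * Complex.exp (-(z * t))) {z : ℂ | 0 < z.re} := by
    intro z₀ hz₀
    have hz₀' : 0 < z₀.re := hz₀
    have hs : {z : ℂ | z₀.re / 2 < z.re} ∈ 𝓝 z₀ :=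
      (isOpen_lt continuous_const Complex.continuous_re).mem_nhds (half_lt_self hz₀')
    refine (hasDerivAt_integral_of_dominated_loc_of_deriv_le (𝕜 := ℂ)
      (F' := fun z (t : ℝ) => -((t : ℂ) ^ a * Complex.exp (-(z * t))))
      (bound := fun t : ℝ => t ^ a.re * Real.exp (-(z₀.re / 2) * t ^ (1 : ℝ))) hs
      (Eventually.of_forall fun z => Complex.aestronglyMeasurable_cpow_mul_exp_neg_mul (a - 1) z)
      (hint (by simpa using ha) hz₀) (Complex.aestronglyMeasurable_cpow_mul_exp_neg_mul a z₀).neg ?_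
      (integrableOn_rpow_mul_exp_neg_mul_rpow (by linarith) one_pos (half_pos hz₀'))
      ?_).2.differentiableAt.differentiableWithinAt
    · filter_upwards [ae_restrict_mem measurableSet_Ioi] with t ht z hz
      have ht : 0 < t := ht
      have hz : z₀.re / 2 < z.re := hz
      rw [norm_neg, Complex.norm_cpow_mul_exp_neg_mul ht]
      gcongr
    · filter_upwards [ae_restrict_mem measurableSet_Ioi] with t ht z _
      have ht0 : (t : ℂ) ≠ 0 := by exact_mod_cast ne_of_gt ht
      have h1 : HasDerivAt (fun z : ℂ => -(z * t)) (-(1 * (t : ℂ))) z :=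
        ((hasDerivAt_id z).mul_const (t : ℂ)).neg
      refine (h1.cexp.const_mul ((t : ℂ) ^ (a - 1))).congr_deriv ?_
      rw [Complex.cpow_sub _ _ ht0, Complex.cpow_one]
      field_simp
  have hG : DifferentiableOn ℂ (fun z : ℂ => (1 / z) ^ a * Complex.Gamma a) {z : ℂ | 0 < z.re} := by
    intro z hz
    have hz' : 0 < z.re := hz
    have hz0 : z ≠ 0 := by rintro rfl; simp at hz'
    refine DifferentiableAt.differentiableWithinAt (DifferentiableAt.mul_const ?_ _)
    refine DifferentiableAt.cpow_const (by fun_prop (disch := exact hz0)) (Or.inl ?_)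
    rw [one_div, Complex.inv_re]
    exact div_pos hz' (Complex.normSq_pos.2 hz0)
  refine (hF.analyticOnNhd hU).eqOn_of_preconnected_of_frequently_eq (hG.analyticOnNhd hU)
    (convex_halfSpace_re_gt 0).isPreconnected (z₀ := 1) (by simp) ?_ hz
  -- the two sides agree at the points `1 + 1 / (n + 1)`
  have hseq : Tendsto (fun n : ℕ => ((1 + 1 / ((n : ℝ) + 1) : ℝ) : ℂ)) atTop (𝓝[≠] 1) := by
    refine tendsto_nhdsWithin_iff.2 ⟨?_, Eventually.of_forall fun n => ?_⟩
    · have := (tendsto_one_div_add_atTop_nhds_zero_nat (𝕜 := ℝ)).const_add 1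
      have h2 := (Complex.continuous_ofReal.tendsto _).comp this
      simpa [Function.comp_def] using h2
    · have h : (1 + 1 / ((n : ℝ) + 1)) ≠ 1 := by
        have : 0 < 1 / ((n : ℝ) + 1) := by positivity
        linarith
      exact fun h' => h (Complex.ofReal_injective (by simpa using h'))
  refine hseq.frequently (Frequently.of_forall fun n => ?_)
  exact Complex.integral_cpow_mul_exp_neg_mul_Ioi ha (by positivity)

namespace FoxBarnes

variable {p q : ℕ} (P : FoxBarnes p q) {ν : ℝ} (hν : 0 < ν)

theorem integrand_add (w v s : ℂ) :
    P.integrand (w + v) s = P.integrand w s * Complex.exp (-(s * v)) := by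
  rw [integrand, integrand, mul_assoc _ _ (Complex.exp (-(s * v))), ← Complex.exp_add]
  congr 2
  ring

theorem integrand_add_mul_log (w s : ℂ) {t : ℝ} (ht : 0 < t) :
    P.integrand (w + ν * Real.log t) s = P.integrand w s * (t : ℂ) ^ (1 - ν * s - 1) := by
  rw [integrand_add, Complex.cpow_def_of_ne_zero (by exact_mod_cast ht.ne'), Complex.ofReal_log ht.le]
  congr 2
  ring

/-- By the functional equation `G(u + τ) = e^{…} Γ(u) G(u)`, the two factors that the Laplace
transform appends to the integrand amount to the value `z^{-u} Γ(u)`, `u = 1 - ν s`, of an Euler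
integral. -/
theorem integrand_laplaceParams {z : ℂ} (hz : 0 < z.re) (w : ℂ) {s : ℂ} (hs : 0 < (1 - ν * s).re) :
    ((P.τ ^ (1 / 2 : ℝ) / (2 * Real.pi) ^ ((P.τ - 1) / 2) : ℝ) : ℂ) * (1 / z) *
        (P.laplaceParams ν hν).integrand (w + ν * Real.log P.τ - ν * Complex.log z) s =
      P.integrand w s * ((1 / z) ^ (1 - ν * s) * Complex.Gamma (1 - ν * s)) := by
  have hz0 : z ≠ 0 := by rintro rfl; simp at hz
  have harg : z.arg ≠ Real.pi := by
    intro h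
    have := Complex.abs_arg_lt_pi_div_two_iff.2 (Or.inl hz)
    rw [h, abs_of_pos Real.pi_pos] at this
    linarith [Real.pi_pos]
  have hτ := P.hτ
  have hK : P.τ ^ (1 / 2 : ℝ) / (2 * Real.pi) ^ ((P.τ - 1) / 2) =
      Real.exp (1 / 2 * Real.log P.τ - (P.τ - 1) / 2 * Real.log (2 * Real.pi)) := by
    rw [Real.exp_sub, Real.rpow_def_of_pos hτ, Real.rpow_def_of_pos (by positivity), mul_comm (Real.log P.τ),
      mul_comm (Real.log (2 * Real.pi))]
  have hG := doubleGamma_ne_zero hτ (ne_zero_of_re_pos hτ hs)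
  rw [hK, integrand, quot_laplaceParams, doubleGamma_add hτ hs, mul_div_cancel_right₀ _ hG, integrand,
    Complex.cpow_def_of_ne_zero (one_div_ne_zero hz0), one_div z, Complex.log_inv _ harg]
  nth_rewrite 1 [← Complex.exp_log (inv_ne_zero hz0)]
  rw [Complex.log_inv _ harg]
  have h1 : (P.laplaceParams ν hν).τ = P.τ := rfl
  have h2 : (P.laplaceParams ν hν).ε = P.ε := rfl
  rw [h1, h2]
  rw [Complex.ofReal_exp]
  -- the exponents agree: the prefactor and `τ^{-ν s}` cancel the exponential of the functional equation
  have e1 : ∀ a b d g x e : ℂ, a + b + d + g = x + e →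
      Complex.exp a * Complex.exp b * Complex.exp d * Complex.exp g =
        Complex.exp x * Complex.exp e := by
    intro a b d g x e h
    rw [← Complex.exp_add, ← Complex.exp_add, ← Complex.exp_add, ← Complex.exp_add, h]
  have e2 := e1 ((1 / 2 * Real.log P.τ - (P.τ - 1) / 2 * Real.log (2 * Real.pi) : ℝ) : ℂ)
    (-Complex.log z) (((P.τ : ℂ) - 1) / 2 * (Real.log (2 * Real.pi) : ℂ) +
      (1 / 2 - (1 - ν * s)) * (Real.log P.τ : ℂ))
    (-(s * (w + ν * Real.log P.τ - ν * Complex.log z))) (-(s * w)) (-Complex.log z * (1 - ν * s)) (by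
      push_cast; ring)
  linear_combination P.quot s * Complex.exp (Real.pi * P.ε * s ^ 2 / P.τ) *
    Complex.Gamma (1 - ν * s) * e2

theorem integral_exp_mul_integrand {z : ℂ} (hz : 0 < z.re) (w : ℂ) {s : ℂ}
    (hs : 0 < (1 - ν * s).re) :
    ∫ t in Set.Ioi (0 : ℝ), Complex.exp (-(z * t)) * P.integrand (w + ν * Real.log t) s =
      ((P.τ ^ (1 / 2 : ℝ) / (2 * Real.pi) ^ ((P.τ - 1) / 2) : ℝ) : ℂ) * (1 / z) *
        (P.laplaceParams ν hν).integrand (w + ν * Real.log P.τ - ν * Complex.log z) s := by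
  rw [integrand_laplaceParams P hν hz w hs, ← Complex.integral_cpow_mul_exp_neg_mul_Ioi_of_re_pos hs hz,
    ← integral_const_mul]
  refine setIntegral_congr_fun measurableSet_Ioi fun t ht => ?_
  rw [integrand_add_mul_log P w s ht]
  ring

/-- On a line to the left of `1 / ν` the double integral defining the Laplace transform converges
absolutely. -/
theorem integrable_exp_mul_integrand {z : ℂ} (hz : 0 < z.re) {w : ℂ} {c : ℝ} (hc : ν * c < 1)
    (h : P.Converges c w) :
    Integrable (fun x : ℝ × ℝ => Complex.exp (-(z * x.1)) *
        P.integrand (w + ν * Real.log x.1) (c + x.2 * Complex.I))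
      ((volume.restrict (Set.Ioi 0)).prod volume) := by
  have hf : Integrable (fun t : ℝ => t ^ (-(ν * c)) * Real.exp (-z.re * t ^ (1 : ℝ)))
      (volume.restrict (Set.Ioi 0)) :=
    integrableOn_rpow_mul_exp_neg_mul_rpow (by linarith) one_pos hz
  refine (hf.mul_prod h.norm).mono' ?_ ?_
  · simp only [integrand_add]
    refine AEStronglyMeasurable.mul ?_ (AEStronglyMeasurable.mul ?_ ?_)
    · exact Continuous.aestronglyMeasurable (by fun_prop)
    · exact h.aestronglyMeasurable.comp_snd
    · refine Measurable.aestronglyMeasurable ?_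
      fun_prop
  · have : ∀ᵐ x : ℝ × ℝ ∂((volume.restrict (Set.Ioi (0 : ℝ))).prod volume), x.1 ∈ Set.Ioi (0 : ℝ) :=
      Measure.quasiMeasurePreserving_fst.ae (ae_restrict_mem measurableSet_Ioi)
    filter_upwards [this] with x hx
    have hx0 : 0 < x.1 := hx
    rw [integrand_add, norm_mul, norm_mul, Complex.norm_exp, Complex.norm_exp, Real.rpow_def_of_pos hx0,
      Real.rpow_one, ← mul_assoc, mul_right_comm]
    refine le_of_eq ?_
    congr 1
    rw [mul_comm]
    congr 2
    · simp; ring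
    · simp

theorem laplaceExists_value {z : ℂ} (hz : 0 < z.re) {w : ℂ} {c : ℝ} (hc : ν * c < 1)
    (h : P.Converges c w) : LaplaceExists (fun t => P.value c (w + ν * Real.log t)) z := by
  have h1 := (P.integrable_exp_mul_integrand hz hc h).integral_prod_left.const_mul
    (1 / (2 * Real.pi * Complex.I) * Complex.I)
  refine h1.congr (Eventually.of_forall fun t => ?_)
  simp only [value]
  rw [integral_const_mul, integral_mul_const]
  ring

/-- The Laplace transform on a line to the left of `1 / ν`, by Fubini's theorem. -/
theorem laplaceTransform_value {z : ℂ} (hz : 0 < z.re) {w : ℂ} {c : ℝ} (hc : ν * c < 1)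
    (h : P.Converges c w) :
    laplaceTransform (fun t => P.value c (w + ν * Real.log t)) z =
      ((P.τ ^ (1 / 2 : ℝ) / (2 * Real.pi) ^ ((P.τ - 1) / 2) : ℝ) : ℂ) * (1 / z) *
        (P.laplaceParams ν hν).value c (w + ν * Real.log P.τ - ν * Complex.log z) := by
  have hint := P.integrable_exp_mul_integrand hz hc h
  have hs : ∀ y : ℝ, 0 < (1 - ν * ((c : ℂ) + y * Complex.I)).re := by
    intro y; simp; linarith
  have e1 : ∀ t : ℝ, Complex.exp (-(z * t)) * P.value c (w + ν * Real.log t) =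
      1 / (2 * Real.pi * Complex.I) * Complex.I * ∫ y : ℝ, Complex.exp (-(z * t)) *
        P.integrand (w + ν * Real.log t) (c + y * Complex.I) := by
    intro t
    rw [value, integral_const_mul, integral_mul_const]
    ring
  rw [laplaceTransform, integral_congr_ae (Eventually.of_forall e1)]
  rw [integral_const_mul, integral_integral_swap hint]
  rw [integral_congr_ae (Eventually.of_forall fun y : ℝ =>
    P.integral_exp_mul_integrand hν hz w (hs y)), integral_const_mul, value, integral_mul_const]
  ring

end FoxBarnes

/-! ### The Laplace transform on every admissible line -/

/-- Condition 3 does not depend on the line, because it includes `Δ₂ = Ω₂ = 0`; only condition 4 does. -/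
theorem FoxBarnes.VL_of_not_VL4 {p q : ℕ} (P : FoxBarnes p q) {c θ : ℝ} (h : P.VL c θ)
    (h4 : ¬ P.VL4 c θ) (c₀ : ℝ) : P.VL c₀ θ := by
  rcases h with h | h | h | h
  · exact Or.inl h
  · exact Or.inr (Or.inl h)
  · refine Or.inr (Or.inr (Or.inl ?_))
    rw [FoxBarnes.VL3, P.Phi1_eq_of_Delta_eq_zero h.1.1 c₀ c,
      P.Phi3_eq_of_Omega_eq_zero h.1.2.2.1 c₀ c]
    exact h
  · exact absurd h h4

theorem proposition5 {p q : ℕ} (P : FoxBarnes p q) (ν : ℝ) (hν : 0 < ν)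
    -- `ell = log lam`: `lam` is a point of the Riemann surface of the logarithm
    (ell : ℂ) (c : ℝ)
    (hAB : P.A < P.B) (hAν : P.A < ((1 / ν : ℝ) : EReal))
    (hAc : P.A < (c : EReal)) (hcB : (c : EReal) < P.B)
    (hVL : P.VL c ell.im)
    -- under condition 4 some admissible line also lies to the left of `1 / ν`
    (hVL4 : P.VL4 c ell.im → ∃ c₀ : ℝ, P.A < (c₀ : EReal) ∧ (c₀ : EReal) < P.B ∧ c₀ < 1 / ν ∧
      P.VL4 c₀ ell.im) :
    (∀ t : ℝ, 0 < t → P.Converges c (ell + ν * Real.log t)) ∧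
    (P.laplaceParams ν hν).A < (P.laplaceParams ν hν).B ∧
    (P.laplaceParamsInv ν hν).A < (P.laplaceParamsInv ν hν).B ∧
    ∀ z : ℂ, 0 < z.re →
      LaplaceExists (fun t => P.value c (ell + ν * Real.log t)) z ∧
      (∀ c₁ : ℝ, (P.laplaceParams ν hν).A < (c₁ : EReal) →
        (c₁ : EReal) < (P.laplaceParams ν hν).B →
        (P.laplaceParams ν hν).VL c₁ (ell + ν * Real.log P.τ - ν * Complex.log z).im ∧
        (P.laplaceParams ν hν).Converges c₁ (ell + ν * Real.log P.τ - ν * Complex.log z) ∧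
        laplaceTransform (fun t => P.value c (ell + ν * Real.log t)) z =
          ((P.τ ^ (1 / 2 : ℝ) / (2 * Real.pi) ^ ((P.τ - 1) / 2) : ℝ) : ℂ) * (1 / z) *
            (P.laplaceParams ν hν).value c₁ (ell + ν * Real.log P.τ - ν * Complex.log z)) ∧
      (∀ c₂ : ℝ, (P.laplaceParamsInv ν hν).A < (c₂ : EReal) →
        (c₂ : EReal) < (P.laplaceParamsInv ν hν).B →
        (P.laplaceParamsInv ν hν).VL c₂ (ν * Complex.log z - (ell + ν * Real.log P.τ)).im ∧
        (P.laplaceParamsInv ν hν).Converges c₂ (ν * Complex.log z - (ell + ν * Real.log P.τ)) ∧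
        laplaceTransform (fun t => P.value c (ell + ν * Real.log t)) z =
          ((P.τ ^ (1 / 2 : ℝ) / (2 * Real.pi) ^ ((P.τ - 1) / 2) : ℝ) : ℂ) * (1 / z) *
            (P.laplaceParamsInv ν hν).value c₂
              (ν * Complex.log z - (ell + ν * Real.log P.τ))) := by
  have him : ∀ t : ℝ, (ell + ν * Real.log t : ℂ).im = ell.im := fun t => by
    rw [Complex.add_im, ← Complex.ofReal_mul, Complex.ofReal_im, add_zero]
  refine ⟨fun t _ => P.converges_of_VL hAc hcB (by rwa [him]), P.laplaceParams_A_lt_B hν hAB hAν,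
    P.laplaceParamsInv_A_lt_B hν hAB hAν, fun z hz => ?_⟩
  -- the line is moved to the left of `1 / ν`, where the double integral converges absolutely
  obtain ⟨c₀, hA₀, hB₀, hν₀, hVL₀⟩ : ∃ c₀ : ℝ, P.A < (c₀ : EReal) ∧ (c₀ : EReal) < P.B ∧
      c₀ < 1 / ν ∧ P.VL c₀ ell.im := by
    by_cases h4 : P.VL4 c ell.im
    · obtain ⟨c₀, h1, h2, h3, h⟩ := hVL4 h4
      exact ⟨c₀, h1, h2, h3, Or.inr (Or.inr (Or.inr h))⟩
    · obtain ⟨c₀, h1, h2⟩ := EReal.lt_iff_exists_real_btwn.1 (lt_min hAν hAB)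
      exact ⟨c₀, h1, h2.trans_le (min_le_right _ _),
        EReal.coe_lt_coe_iff.1 (h2.trans_le (min_le_left _ _)), P.VL_of_not_VL4 hVL h4 c₀⟩
  have hνc : ν * c₀ < 1 := by rwa [lt_div_iff₀ hν, mul_comm] at hν₀
  have hfun : (fun t : ℝ => P.value c (ell + ν * Real.log t)) =
      fun t : ℝ => P.value c₀ (ell + ν * Real.log t) := funext fun t =>
    P.value_eq_value hAc hcB hA₀ hB₀ (by rwa [him]) (by rwa [him])
  have hconv := P.converges_of_VL hA₀ hB₀ hVL₀
  rw [hfun]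
  have harg : |z.arg| < Real.pi / 2 := Complex.abs_arg_lt_pi_div_two_iff.2 (Or.inl hz)
  have hw : (ell + ν * Real.log P.τ - ν * Complex.log z).im = ell.im - ν * z.arg := by
    rw [Complex.sub_im, him, Complex.im_ofReal_mul, Complex.log_im]
  have hlap : ∀ c₁ : ℝ, (P.laplaceParams ν hν).A < (c₁ : EReal) →
      (c₁ : EReal) < (P.laplaceParams ν hν).B →
      (P.laplaceParams ν hν).VL c₁ (ell + ν * Real.log P.τ - ν * Complex.log z).im ∧
      (P.laplaceParams ν hν).Converges c₁ (ell + ν * Real.log P.τ - ν * Complex.log z) ∧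
      laplaceTransform (fun t => P.value c₀ (ell + ν * Real.log t)) z =
        ((P.τ ^ (1 / 2 : ℝ) / (2 * Real.pi) ^ ((P.τ - 1) / 2) : ℝ) : ℂ) * (1 / z) *
          (P.laplaceParams ν hν).value c₁ (ell + ν * Real.log P.τ - ν * Complex.log z) := by
    intro c₁ h1 h2
    have hVL₁ : ∀ c : ℝ, (P.laplaceParams ν hν).VL c
        (ell + ν * Real.log P.τ - ν * Complex.log z).im := fun c => by
      rw [hw]
      exact P.VL_laplaceParams hν hVL₀ harg c
    refine ⟨hVL₁ c₁, (P.laplaceParams ν hν).converges_of_VL h1 h2 (hVL₁ c₁), ?_⟩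
    rw [P.laplaceTransform_value hν hz hνc hconv]
    congr 1
    refine (P.laplaceParams ν hν).value_eq_value ?_ ?_ h1 h2 (hVL₁ _) (hVL₁ _)
    · rwa [FoxBarnes.laplaceParams_A]
    · rw [FoxBarnes.laplaceParams_B]
      exact lt_min (EReal.coe_lt_coe_iff.2 hν₀) hB₀
  refine ⟨P.laplaceExists_value hz hνc hconv, hlap, fun c₂ h1 h2 => ?_⟩
  obtain ⟨-, hc, hv⟩ := hlap (-c₂) ((P.lt_laplaceParamsInv_B_iff hν c₂).1 h2)
    ((P.laplaceParamsInv_A_lt_iff hν c₂).1 h1)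
  rw [← neg_sub (ν * Complex.log z)] at hc hv
  refine ⟨?_, P.converges_laplaceParamsInv hν hc, ?_⟩
  · rw [← neg_sub, Complex.neg_im, hw, neg_sub]
    exact P.VL_laplaceParamsInv hν hVL₀ harg c₂
  · rw [hv, P.value_laplaceParamsInv hν]
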